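/- Random regular $k$-SAT model. Let $d\ge 0$ be even, $k\ge1$, and let $n$ range over the integers with $k\mid dn$; put $m=dn/k$. A formula is a bijection $\Phi:\{x_1,\dots,x_n\}\times[d]\to\{a_1,\dots,a_m\}\times[k]$ from variable clones to clause clones; the first $d/2$ clones of each variable are its positive and the last $d/2$ its negative occurrences. $\mathbf\Phi=\mathbf\Phi_{d,k}(n)$ is a uniformly random such bijection. For $\sigma\in\{\pm1\}^n$ let $E_\Phi(\sigma)$ be the number of clauses of $\Phi$ violated by $\sigma$ (i.e. with all $k$ literals false, where $1$ stands for "true"), and $$Z_\Phi(\beta)=\sum_{\sigma\in\{\pm1\}^n}e^{-\beta E_\Phi(\sigma)},\qquad \mathcal C_{\Phi,\tau}(\beta)=\sum_{\sigma:\ \sigma\cdot\tau>n(1-2^{-k/10})}e^{-\beta E_\Phi(\sigma)}\qquad(\tau\in\{\pm1\}^n).$$ The planted pair $(\hat{\mathbf\Phi},\hat{\boldsymbol\sigma})$ is a random formula/assignment pair that equals $(\Phi,\sigma)$ with probability proportional to $e^{-\beta E_\Phi(\sigma)}$. Let $d_{k\text{-SAT}}$ be the satisfiability threshold, i.e. the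 largest real $D$ such that $\liminf_{n\to\infty}\mathbb P[\mathbf\Phi_{d',k}(n)\text{ is satisfiable}]>0$ for all even $d'<D$. **Lemma 2.2.** There is $k_0\ge3$ such that for all $k\ge k_0$, all even $d\le d_{k\text{-SAT}}$ and all $\beta\in(0,\infty)$ the following holds (all limits being taken along the $n$ with $k\mid dn$). The limit $\lim_{n\to\infty}\frac1n\ln\mathbb E[Z_{\mathbf\Phi}(\beta)]$ exists in $\mathbb R$, and the annealed formula $$\phi_{d,k}(\beta):=\lim_{n\to\infty}\frac1n\mathbb E[\ln Z_{\mathbf\Phi}(\beta)]=\lim_{n\to\infty}\frac1n\ln\mathbb E[Z_{\mathbf\Phi}(\beta)]$$ holds (that is, the limit on the left exists and has this value) if and only if $$\limsup_{n\to\infty}\frac1n\mathbb E\bigl[\ln\mathcal C_{\hat{\mathbf\Phi},\hat{\boldsymbol\sigma}}(\beta)\bigr]\le\lim_{n\to\infty}\frac1n\ln\mathbb E[Z_{\mathbf\Phi}(\beta)].$$ -/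

import Mathlib

open Filter Topology

noncomputable section

namespace RegKSAT

/-- A `d`-regular `k`-SAT formula with `n` variables and `m` clauses in the configuration model:
a bijection from the variable clones `(x, i)` to the clause clones `(a, j)`.  (There is one only if
`n * d = m * k`.)  The first `d / 2` clones of a variable are its positive occurrences, the
remaining ones its negative occurrences. -/
abbrev Formula (n d m k : ℕ) : Type := Fin n × Fin d ≃ Fin m × Fin k

/-- Truth assignments `σ ∈ {±1}ⁿ`, where `1` stands for true and `-1` for false. -/
abbrev Assignment (n : ℕ) : Type := Fin n → ℤˣ

variable {n d m k : ℕ}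

/-- The truth value under `σ` of the literal at the variable clone `(x, i)`: it is `σ x` if the
clone is a positive occurrence and `-σ x` if it is a negative one. -/
def literalValue (σ : Assignment n) (c : Fin n × Fin d) : ℤˣ :=
  if (c.2 : ℕ) < d / 2 then σ c.1 else -σ c.1

/-- The Hamiltonian `E_Φ(σ)`: the number of clauses all of whose `k` literals are false. -/
def energy (Φ : Formula n d m k) (σ : Assignment n) : ℕ :=
  (Finset.univ.filter fun a : Fin m => ∀ j : Fin k, literalValue σ (Φ.symm (a, j)) = -1).card

/-- The Gibbs weight `exp(-β E_Φ(σ))`. -/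
def weight (β : ℝ) (Φ : Formula n d m k) (σ : Assignment n) : ℝ :=
  Real.exp (-β * (energy Φ σ : ℝ))

/-- The partition function `Z_Φ(β) = ∑_σ exp(-β E_Φ(σ))`. -/
def partitionFunction (β : ℝ) (Φ : Formula n d m k) : ℝ :=
  ∑ σ : Assignment n, weight β Φ σ

/-- The inner product `σ · τ = ∑_x σ(x) τ(x)`. -/
def overlap (σ τ : Assignment n) : ℤ := ∑ x, (σ x : ℤ) * (τ x : ℤ)

/-- The weighted cluster size `C_{Φ,τ}(β) = Z_Φ(β) ⟨1{σ · τ > n (1 - 2^{-k/10})}⟩_{Φ,β}`, i.e. the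
sum of the Gibbs weights of all `σ` with `σ · τ > n (1 - 2^{-k/10})`. -/
def clusterSize (β : ℝ) (Φ : Formula n d m k) (τ : Assignment n) : ℝ :=
  ∑ σ : Assignment n,
    if (n : ℝ) * (1 - (2 : ℝ) ^ (-(k : ℝ) / 10)) < (overlap σ τ : ℝ) then weight β Φ σ else 0

/-- The expectation `E[X(Φ)]` for a uniformly random formula `Φ`. -/
def expect (X : Formula n d m k → ℝ) : ℝ :=
  (∑ Φ : Formula n d m k, X Φ) / (Fintype.card (Formula n d m k) : ℝ)

/-- The expectation `E[X(Φ̂, σ̂)]` in the planted model, in which the pair `(Φ̂, σ̂)` comes up with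
probability proportional to `exp(-β E_Φ̂(σ̂))`. -/
def plantedExpect (β : ℝ) (X : Formula n d m k → Assignment n → ℝ) : ℝ :=
  (∑ Φ : Formula n d m k, ∑ σ : Assignment n, weight β Φ σ * X Φ σ) /
    ∑ Φ : Formula n d m k, partitionFunction β Φ

/-- The formula `Φ` has an assignment that violates no clause. -/
def Satisfiable (Φ : Formula n d m k) : Prop := ∃ σ : Assignment n, energy Φ σ = 0

open Classical in
/-- The probability that the uniformly random formula is satisfiable. -/
def satProb (n d m k : ℕ) : ℝ :=
  expect fun Φ : Formula n d m k => if Satisfiable Φ then 1 else 0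

/-- The limit `n → ∞` along those `n` for which `k` divides `d n`; for these `n` the formula has
`m = d n / k` clauses. -/
def nLimit (d k : ℕ) : Filter ℕ := atTop ⊓ 𝓟 {n | k ∣ d * n}

/-- The satisfiability threshold of the random regular `k`-SAT model: the largest `D` such
that `liminf P[Φ_{d,k}(n) is satisfiable] > 0` for all (even) degrees `d < D`. -/
def dSAT (k : ℕ) : ℝ :=
  sSup {D : ℝ | ∀ d : ℕ, Even d → (d : ℝ) < D →
    0 < liminf (fun n : ℕ => satProb n d (d * n / k) k) (nLimit d k)}

/-- `n⁻¹ E[ln Z_Φ(β)]`; its limit is the free energy `φ_{d,k}(β)`. -/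
def quenchedRate (d k : ℕ) (β : ℝ) (n : ℕ) : ℝ :=
  expect (fun Φ : Formula n d (d * n / k) k => Real.log (partitionFunction β Φ)) / n

/-- `n⁻¹ ln E[Z_Φ(β)]`. -/
def annealedRate (d k : ℕ) (β : ℝ) (n : ℕ) : ℝ :=
  Real.log (expect fun Φ : Formula n d (d * n / k) k => partitionFunction β Φ) / n

/-- `n⁻¹ E[ln C_{Φ̂,σ̂}(β)]`, the expectation being in the planted model. -/
def clusterRate (d k : ℕ) (β : ℝ) (n : ℕ) : ℝ :=
  plantedExpect β
    (fun (Φ : Formula n d (d * n / k) k) σ => Real.log (clusterSize β Φ σ)) / n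

end RegKSAT

end

/-!
Fix `β` and let `q = 1 - exp (-β)`.  For a fixed assignment the truth values of the literals of the
random formula are a uniformly random arrangement of `n * d / 2` true and as many false ones, and
the Gibbs weight is a product over clauses.  Let `ε` solve `ε = q * ((1 + ε) / 2) ^ k`.  Independent
clauses whose literals are false with probability `(1 + ε) / 2`, reweighted by the Gibbs weight
(`tiltedLaw`), contain `k / 2` false literals on average.  Hence the random arrangement reweighted
by the Gibbs weight is the law of these independent clauses, conditioned on an event (`balanced`)
whose probability is not exponentially small (`eventually_exp_le_balancedMass`).  This yields the
annealed limit `annealedValue` (`tendsto_annealedRate`), and it transfers the bounded differences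
inequality from the independent clauses to the planted model (`sum_weight_mul_exp_le`).

Suppose that the free energy `n⁻¹ E[log Z]` converges to the annealed value `a`.  As
`Ê[Z ^ (-lam)] = E[Z ^ (1 - lam)] / E[Z]` is at least `exp (-lam * a * n + o(n))` by Jensen's
inequality and `C ≤ Z`, concentration of `log C` in the planted model gives
`Ê[log C] ≤ (a + O(lam)) * n` for every `lam > 0` (`mul_plantedExpect_log_clusterSize_le`).

Conversely, suppose that `limsup n⁻¹ Ê[log C] ≤ a`.  By Markov's inequality the assignments whose
cluster has size at most `exp ((a + θ) * n)` still contribute `exp (a * n - o(n))` to `E[Z]`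
(`mul_expect_partitionFunction_le`).  In the second moment of this contribution, pairs in a common
cluster give at most `exp ((a + θ) * n) * E[Z]`.  Pairs of overlap `α * n` outside a common cluster
are compared with independent clauses again, with a joint law of the two truth values
(`expect_weight_mul_weight_le`).  The fixed point equation removes the terms linear in `α`, and a
first moment bound on the satisfiability threshold (`dSAT_le`) gives `d / k ≤ 2 ^ k * log 2 + 2`, so
that for large `k` the gain is at most the loss of entropy (`excess_le`) for all
`α ≤ 1 - 2 ^ (-k / 10)`.  So the second moment exceeds the square of the first by a factor
`exp (O(θ) * n)` only.  An elementary interpolation turns this into a lower bound on `E[Z ^ lam]`,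
and concentration of `log Z` under transpositions of clause clones turns the latter into
`E[log Z] ≥ (a - o(1)) * n` (`eventually_le_quenchedRate`).
-/

/-! ### Exponential moments of functions with bounded differences -/

/-- Symmetrised form of Hoeffding's lemma: comparison with an independent copy replaces the
exponential by a hyperbolic cosine, which is at most `exp (c ^ 2 / 2)`. -/
theorem sum_mul_exp_le_of_osc {ι : Type*} [Fintype ι] (p f : ι → ℝ) (hp : ∀ i, 0 ≤ p i)
    (hs : ∑ i, p i = 1) {c : ℝ} (hf : ∀ i j, |f i - f j| ≤ c) :
    ∑ i, p i * Real.exp (f i) ≤ Real.exp (∑ i, p i * f i + c ^ 2 / 2) := by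
  set M := ∑ i, p i * f i with hM
  have hJ : Real.exp (-M) ≤ ∑ j, p j * Real.exp (-f j) := by
    have := convexOn_exp.map_sum_le (t := Finset.univ) (w := p) (p := fun j => -f j)
      (fun i _ => hp i) hs (fun _ _ => Set.mem_univ _)
    simpa [hM, Finset.sum_neg_distrib] using this
  have hpos : 0 ≤ ∑ i, p i * Real.exp (f i) :=
    Finset.sum_nonneg fun i _ => mul_nonneg (hp i) (Real.exp_pos _).le
  have h1 : (∑ i, p i * Real.exp (f i)) * Real.exp (-M) ≤ Real.exp (c ^ 2 / 2) := by
    refine (mul_le_mul_of_nonneg_left hJ hpos).trans ?_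
    have e1 : (∑ i, p i * Real.exp (f i)) * (∑ j, p j * Real.exp (-f j))
        = ∑ i, ∑ j, p i * p j * Real.exp (f i - f j) := by
      rw [Finset.sum_mul_sum]
      refine Finset.sum_congr rfl fun i _ => Finset.sum_congr rfl fun j _ => ?_
      rw [sub_eq_add_neg, Real.exp_add]; ring
    have e2 : ∑ i, ∑ j, p i * p j * Real.exp (f i - f j)
        = ∑ i, ∑ j, p i * p j * Real.cosh (f i - f j) := by
      have h2 : ∑ i, ∑ j, p i * p j * Real.exp (f i - f j)
          = ∑ i, ∑ j, p i * p j * Real.exp (-(f i - f j)) := by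
        rw [Finset.sum_comm]
        refine Finset.sum_congr rfl fun i _ => Finset.sum_congr rfl fun j _ => ?_
        rw [neg_sub]; ring
      have h3 : ∑ i, ∑ j, p i * p j * Real.cosh (f i - f j)
          = (∑ i, ∑ j, p i * p j * Real.exp (f i - f j)
            + ∑ i, ∑ j, p i * p j * Real.exp (-(f i - f j))) / 2 := by
        rw [← Finset.sum_add_distrib, Finset.sum_div]
        refine Finset.sum_congr rfl fun i _ => ?_
        rw [← Finset.sum_add_distrib, Finset.sum_div]
        refine Finset.sum_congr rfl fun j _ => ?_
        rw [Real.cosh_eq]; ring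
      rw [h3, ← h2]; ring
    rw [e1, e2]
    calc ∑ i, ∑ j, p i * p j * Real.cosh (f i - f j)
        ≤ ∑ i, ∑ j, p i * p j * Real.exp (c ^ 2 / 2) := by
          refine Finset.sum_le_sum fun i _ => Finset.sum_le_sum fun j _ => ?_
          refine mul_le_mul_of_nonneg_left ?_ (mul_nonneg (hp i) (hp j))
          refine (Real.cosh_le_exp_half_sq _).trans (Real.exp_le_exp.2 ?_)
          have := sq_le_sq' (by linarith [(abs_le.1 (hf i j)).1]) (abs_le.1 (hf i j)).2
          linarith
      _ = Real.exp (c ^ 2 / 2) := by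
          simp only [← Finset.sum_mul, ← Finset.mul_sum, hs, mul_one, one_mul]
  rw [Real.exp_add]
  have h4 : Real.exp (-M) * Real.exp M = 1 := by rw [← Real.exp_add]; simp
  calc ∑ i, p i * Real.exp (f i)
      = ((∑ i, p i * Real.exp (f i)) * Real.exp (-M)) * Real.exp M := by
        rw [mul_assoc, h4, mul_one]
    _ ≤ Real.exp (c ^ 2 / 2) * Real.exp M :=
        mul_le_mul_of_nonneg_right h1 (Real.exp_pos _).le
    _ = _ := mul_comm _ _

/-- Bounded differences inequality on a product space `Fin m → Ω` with independent coordinates of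
law `p`: the exponential moment of a function that changes by at most `c` with each coordinate. -/
theorem sum_pi_mul_exp_le {Ω : Type*} [Fintype Ω] (p : Ω → ℝ) (hp : ∀ i, 0 ≤ p i)
    (hs : ∑ i, p i = 1) {c : ℝ} (m : ℕ) (f : (Fin m → Ω) → ℝ)
    (hf : ∀ (a : Fin m) (T T' : Fin m → Ω), (∀ b, b ≠ a → T b = T' b) → |f T - f T'| ≤ c) :
    ∑ T : Fin m → Ω, (∏ a, p (T a)) * Real.exp (f T)
      ≤ Real.exp (∑ T : Fin m → Ω, (∏ a, p (T a)) * f T + m * (c ^ 2 / 2)) := by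
  classical
  induction m with
  | zero => simp
  | succ m ih =>
    have hcons : ∀ g : (Fin (m + 1) → Ω) → ℝ,
        ∑ T : Fin (m + 1) → Ω, (∏ a, p (T a)) * g T
          = ∑ x, p x * ∑ T : Fin m → Ω, (∏ a, p (T a)) * g (Fin.cons x T) := by
      intro g
      rw [← (Fin.consEquiv fun _ : Fin (m + 1) => Ω).sum_comp, Fintype.sum_prod_type]
      refine Finset.sum_congr rfl fun x _ => ?_
      rw [Finset.mul_sum]
      refine Finset.sum_congr rfl fun T _ => ?_
      simp [Fin.consEquiv, Fin.prod_univ_succ, mul_assoc]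
    rw [hcons, hcons]
    have hmass : ∑ T : Fin m → Ω, ∏ a, p (T a) = 1 := by
      rw [← Fintype.piFinset_univ, Finset.sum_prod_piFinset]
      simp [hs]
    set F : Ω → ℝ := fun x => ∑ T : Fin m → Ω, (∏ a, p (T a)) * f (Fin.cons x T) with hF
    have hosc : ∀ x y, |F x - F y| ≤ c := by
      intro x y
      have : F x - F y
          = ∑ T : Fin m → Ω, (∏ a, p (T a)) * (f (Fin.cons x T) - f (Fin.cons y T)) := by
        simp only [hF, mul_sub, Finset.sum_sub_distrib]
      rw [this]
      refine (Finset.abs_sum_le_sum_abs _ _).trans ?_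
      calc ∑ T : Fin m → Ω, |(∏ a, p (T a)) * (f (Fin.cons x T) - f (Fin.cons y T))|
          ≤ ∑ T : Fin m → Ω, (∏ a, p (T a)) * c := by
            refine Finset.sum_le_sum fun T _ => ?_
            have h0 : 0 ≤ ∏ a, p (T a) := Finset.prod_nonneg fun a _ => hp _
            rw [abs_mul, abs_of_nonneg h0]
            refine mul_le_mul_of_nonneg_left (hf 0 _ _ ?_) h0
            intro b hb
            obtain ⟨b', rfl⟩ := Fin.exists_succ_eq.2 hb
            simp
        _ = c := by rw [← Finset.sum_mul, hmass, one_mul]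
    calc ∑ x, p x * ∑ T : Fin m → Ω, (∏ a, p (T a)) * Real.exp (f (Fin.cons x T))
        ≤ ∑ x, p x * Real.exp (F x + m * (c ^ 2 / 2)) := by
          refine Finset.sum_le_sum fun x _ => mul_le_mul_of_nonneg_left ?_ (hp x)
          refine ih (fun T => f (Fin.cons x T)) ?_
          intro a T T' h
          refine hf a.succ _ _ ?_
          intro b hb
          rcases Fin.eq_zero_or_eq_succ b with rfl | ⟨b', rfl⟩
          · simp
          · simpa using h b' fun h => hb (by rw [h])
      _ = (∑ x, p x * Real.exp (F x)) * Real.exp (m * (c ^ 2 / 2)) := by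
          rw [Finset.sum_mul]
          refine Finset.sum_congr rfl fun x _ => ?_
          rw [Real.exp_add]; ring
      _ ≤ Real.exp (∑ x, p x * F x + c ^ 2 / 2) * Real.exp (m * (c ^ 2 / 2)) :=
          mul_le_mul_of_nonneg_right (sum_mul_exp_le_of_osc p F hp hs hosc) (Real.exp_pos _).le
      _ = _ := by
          rw [← Real.exp_add]; congr 1; push_cast; ring

/-- Exponential moment of a function of a uniformly random permutation that changes by at most `c`
under transpositions.  Choosing the permutation as a product of independent random transpositions,
one for each point, gives a martingale with increments at most `2 * c`. -/
theorem sum_perm_exp_le (α : Type*) [Fintype α] [DecidableEq α] {c : ℝ}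
    (f : Equiv.Perm α → ℝ) (hf : ∀ x y π, |f (Equiv.swap x y * π) - f π| ≤ c) :
    ∑ π, Real.exp (f π) ≤ (Fintype.card α).factorial *
      Real.exp ((∑ π, f π) / (Fintype.card α).factorial + 2 * Fintype.card α * c ^ 2) := by
  revert f
  suffices H : ∀ [DecidableEq α], ∀ f : Equiv.Perm α → ℝ,
      (∀ x y π, |f (Equiv.swap x y * π) - f π| ≤ c) →
      ∑ π, Real.exp (f π) ≤ (Fintype.card α).factorial *
        Real.exp ((∑ π, f π) / (Fintype.card α).factorial + 2 * Fintype.card α * c ^ 2) from H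
  refine Fintype.induction_empty_option (P := fun α _ => ∀ [DecidableEq α],
      ∀ f : Equiv.Perm α → ℝ, (∀ x y π, |f (Equiv.swap x y * π) - f π| ≤ c) →
      ∑ π, Real.exp (f π) ≤ (Fintype.card α).factorial *
        Real.exp ((∑ π, f π) / (Fintype.card α).factorial + 2 * Fintype.card α * c ^ 2))
      ?_ ?_ ?_ α
  · intro α β _ e ih _ f hf
    classical
    let _ := Fintype.ofEquiv β e.symm
    have hcard : Fintype.card β = Fintype.card α := (Fintype.card_congr e).symm
    have h1 := ih (fun π => f (e.permCongr π)) (by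
      intro x y π
      have : e.permCongr (Equiv.swap x y * π) = Equiv.swap (e x) (e y) * e.permCongr π := by
        ext z
        simp only [Equiv.permCongr_apply, Equiv.Perm.mul_apply, Equiv.swap_apply_def]
        split_ifs <;> simp_all
      rw [this]
      exact hf _ _ _)
    rw [e.permCongr.sum_comp (fun π => Real.exp (f π)), e.permCongr.sum_comp f] at h1
    rw [hcard]
    convert h1
  · intro _ f hf
    simp
  · intro α _ ih inst f hf
    classical
    obtain rfl : inst = Option.instDecidableEq := Subsingleton.elim _ _
    set N := Fintype.card α with hN
    have hN0 : ((N.factorial : ℕ) : ℝ) ≠ 0 := by exact_mod_cast N.factorial_ne_zero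
    have hNp : (0 : ℝ) < (N.factorial : ℕ) := by exact_mod_cast N.factorial_pos
    have hdec : ∀ g : Equiv.Perm (Option α) → ℝ,
        ∑ π, g π = ∑ i : Option α, ∑ e : Equiv.Perm α,
          g (Equiv.swap none i * Equiv.optionCongr e) := by
      intro g
      rw [← (Equiv.Perm.decomposeOption (α := α)).symm.sum_comp, Fintype.sum_prod_type]
      refine Finset.sum_congr rfl fun i _ => Finset.sum_congr rfl fun e _ => ?_
      simp
    rw [hdec, hdec]
    set F : Option α → ℝ :=
      fun i => (∑ e : Equiv.Perm α, f (Equiv.swap none i * Equiv.optionCongr e)) / N.factorial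
      with hF
    have hosc : ∀ i j, |F i - F j| ≤ 2 * c := by
      intro i j
      have : F i - F j = (∑ e : Equiv.Perm α, (f (Equiv.swap none i * Equiv.optionCongr e)
          - f (Equiv.swap none j * Equiv.optionCongr e))) / N.factorial := by
        simp only [hF, Finset.sum_sub_distrib, sub_div]
      rw [this, abs_div, Nat.abs_cast, div_le_iff₀ hNp]
      refine (Finset.abs_sum_le_sum_abs _ _).trans ?_
      calc ∑ e : Equiv.Perm α, |f (Equiv.swap none i * Equiv.optionCongr e)
            - f (Equiv.swap none j * Equiv.optionCongr e)|
          ≤ ∑ e : Equiv.Perm α, 2 * c := by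
            refine Finset.sum_le_sum fun e _ => ?_
            have h1 := abs_le.1 (hf none i (Equiv.optionCongr e))
            have h2 := abs_le.1 (hf none j (Equiv.optionCongr e))
            rw [abs_le]; constructor <;> linarith [h1.1, h1.2, h2.1, h2.2]
        _ = 2 * c * N.factorial := by
            simp [Fintype.card_perm, hN, mul_comm]
    have hcardO : Fintype.card (Option α) = N + 1 := Fintype.card_option
    have hw : ∑ _i : Option α, (1 : ℝ) / (N + 1) = 1 := by
      rw [Finset.sum_const, Finset.card_univ, hcardO]
      have : (N : ℝ) + 1 ≠ 0 := by positivity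
      simp [this]
    have hoef := sum_mul_exp_le_of_osc (fun _ : Option α => (1 : ℝ) / (N + 1)) F
      (fun _ => by positivity) hw hosc
    rw [← Finset.mul_sum, ← Finset.mul_sum] at hoef
    have hstep : ∀ i : Option α,
        ∑ e : Equiv.Perm α, Real.exp (f (Equiv.swap none i * Equiv.optionCongr e))
          ≤ N.factorial * (Real.exp (F i) * Real.exp (2 * N * c ^ 2)) := by
      intro i
      rw [← Real.exp_add]
      refine ih (fun e => f (Equiv.swap none i * Equiv.optionCongr e)) ?_
      intro x y π
      have : Equiv.optionCongr (Equiv.swap x y * π)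
          = Equiv.swap (some x) (some y) * Equiv.optionCongr π := by
        rw [← Equiv.optionCongr_swap]
        ext z : 1
        cases z <;> rfl
      rw [this, ← mul_assoc, Equiv.mul_swap_eq_swap_mul, mul_assoc]
      exact hf _ _ _
    rw [hcardO]
    have hfac : ((N + 1).factorial : ℝ) = (N + 1) * N.factorial := by
      rw [Nat.factorial_succ]; push_cast; ring
    have hmean : (∑ i, ∑ e : Equiv.Perm α, f (Equiv.swap none i * Equiv.optionCongr e))
        / ((N + 1).factorial : ℝ) = 1 / (N + 1) * ∑ i, F i := by
      simp only [hF]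
      rw [← Finset.sum_div, hfac]
      field_simp
    rw [hmean]
    calc ∑ i, ∑ e : Equiv.Perm α, Real.exp (f (Equiv.swap none i * Equiv.optionCongr e))
        ≤ ∑ i, N.factorial * (Real.exp (F i) * Real.exp (2 * N * c ^ 2)) :=
          Finset.sum_le_sum fun i _ => hstep i
      _ = (N + 1) * N.factorial * Real.exp (2 * N * c ^ 2)
            * (1 / (N + 1) * ∑ i, Real.exp (F i)) := by
          rw [← Finset.mul_sum, ← Finset.sum_mul]
          field_simp
      _ ≤ (N + 1) * N.factorial * Real.exp (2 * N * c ^ 2)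
            * Real.exp (1 / (N + 1) * ∑ i, F i + (2 * c) ^ 2 / 2) := by
          refine mul_le_mul_of_nonneg_left hoef ?_
          positivity
      _ = _ := by
          rw [hfac, mul_assoc ((N + 1 : ℝ) * N.factorial), ← Real.exp_add]
          congr 2; push_cast; ring

/-! ### Colourings transported by a uniformly random bijection -/

section Colourings

variable {V S Γ : Type*} [Fintype V] [DecidableEq V] [Fintype S] [DecidableEq S]
  [DecidableEq Γ]

theorem card_equiv_comp_symm_eq [Fintype Γ] (c : V → Γ) (Φ₀ : V ≃ S) :
    Fintype.card {Φ : V ≃ S // c ∘ Φ.symm = c ∘ Φ₀.symm}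
      = ∏ γ, (Fintype.card {v // c v = γ}).factorial := by
  rw [← DomMulAct.stabilizer_card c]
  refine Fintype.card_congr
    { toFun := fun Φ => ⟨Φ.1.trans Φ₀.symm, ?_⟩
      invFun := fun g => ⟨g.1.trans Φ₀, ?_⟩
      left_inv := fun Φ => ?_
      right_inv := fun g => ?_ }
  · funext v
    have := congrFun Φ.2 (Φ.1 v)
    simpa using this.symm
  · funext s
    have := congrFun g.2 (g.1.symm (Φ₀.symm s))
    simpa using this.symm
  · ext v; simp
  · ext v; simp

/-- A function of the colouring `c ∘ Φ⁻¹` induced on the clause clones, summed over all bijections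
`Φ`: every colouring that occurs comes from the same number of bijections. -/
theorem sum_equiv_comp_symm [Fintype Γ] (c : V → Γ) (H : (S → Γ) → ℝ) :
    ∑ Φ : V ≃ S, H (c ∘ Φ.symm)
      = ((∏ γ, (Fintype.card {v // c v = γ}).factorial : ℕ) : ℝ) *
        ∑ T ∈ Finset.univ.image (fun Φ : V ≃ S => c ∘ Φ.symm), H T := by
  classical
  rw [← Finset.sum_fiberwise_of_maps_to (t := Finset.univ.image (fun Φ : V ≃ S => c ∘ Φ.symm))
    (g := fun Φ : V ≃ S => c ∘ Φ.symm) (fun Φ _ => Finset.mem_image_of_mem _ (Finset.mem_univ Φ)),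
    Finset.mul_sum]
  refine Finset.sum_congr rfl fun T hT => ?_
  obtain ⟨Φ₀, -, rfl⟩ := Finset.mem_image.1 hT
  rw [Finset.sum_congr rfl (g := fun _ => H (c ∘ Φ₀.symm)) (by
    intro Φ hΦ; rw [(Finset.mem_filter.1 hΦ).2]), Finset.sum_const, nsmul_eq_mul,
    ← card_equiv_comp_symm_eq c Φ₀, Fintype.card_subtype]

theorem mem_image_comp_symm_iff (c : V → Γ) (T : S → Γ) :
    T ∈ Finset.univ.image (fun Φ : V ≃ S => c ∘ Φ.symm) ↔
      ∀ γ, Fintype.card {v // c v = γ} = Fintype.card {s // T s = γ} := by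
  constructor
  · intro h γ
    obtain ⟨Φ, -, rfl⟩ := Finset.mem_image.1 h
    exact Fintype.card_congr (Φ.subtypeEquiv fun v => by simp)
  · intro h
    refine Finset.mem_image.2
      ⟨Equiv.ofFiberEquiv (f := c) (g := T) fun γ => Fintype.equivOfCardEq (h γ),
        Finset.mem_univ _, ?_⟩
    funext s
    have := Equiv.ofFiberEquiv_map (f := c) (g := T) (fun γ => Fintype.equivOfCardEq (h γ))
      ((Equiv.ofFiberEquiv (f := c) (g := T) fun γ => Fintype.equivOfCardEq (h γ)).symm s)
    rw [Equiv.apply_symm_apply] at this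
    exact this.symm

/-- Replacing a colouring with prescribed colour counts by one with independent colours: the
weights `y` of the colours are at our disposal. -/
theorem sum_equiv_mul_prod_le [Fintype Γ] (c : V → Γ) (y : Γ → ℝ) (hy : ∀ γ, 0 ≤ y γ)
    (H : (S → Γ) → ℝ)
    (hH : ∀ T, 0 ≤ H T) :
    (∑ Φ : V ≃ S, H (c ∘ Φ.symm)) * ∏ γ, y γ ^ Fintype.card {v // c v = γ}
      ≤ ((∏ γ, (Fintype.card {v // c v = γ}).factorial : ℕ) : ℝ) *
        ∑ T : S → Γ, (∏ s, y (T s)) * H T := by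
  rw [sum_equiv_comp_symm, mul_assoc, Finset.sum_mul]
  refine mul_le_mul_of_nonneg_left ?_ (Nat.cast_nonneg _)
  refine le_trans (le_of_eq ?_) (Finset.sum_le_univ_sum_of_nonneg
    (s := Finset.univ.image (fun Φ : V ≃ S => c ∘ Φ.symm)) fun T =>
      mul_nonneg (Finset.prod_nonneg fun s _ => hy _) (hH T))
  refine Finset.sum_congr rfl fun T hT => ?_
  rw [mul_comm]
  congr 1
  rw [mem_image_comp_symm_iff] at hT
  rw [← Finset.prod_fiberwise Finset.univ T (fun s => y (T s))]
  refine Finset.prod_congr rfl fun γ _ => ?_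
  rw [hT γ, Finset.prod_congr rfl (g := fun _ => y γ) (by
    intro s hs; rw [(Finset.mem_filter.1 hs).2]), Finset.prod_const, Fintype.card_subtype]

end Colourings

namespace RegKSAT

variable {n d m k : ℕ}

/-! ### Literal patterns of formulas -/

/-- The sign of a clone: positive occurrences come first. -/
def cloneSign (i : Fin d) : ℤˣ := if (i : ℕ) < d / 2 then 1 else -1

theorem literalValue_eq (σ : Assignment n) (c : Fin n × Fin d) :
    literalValue σ c = cloneSign c.2 * σ c.1 := by
  unfold literalValue cloneSign
  split_ifs <;> simp

theorem card_cloneSign_eq (hd : Even d) (u : ℤˣ) :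
    (Finset.univ.filter fun i : Fin d => cloneSign i = u).card = d / 2 := by
  have h1 : (Finset.univ.filter fun i : Fin d => (i : ℕ) < d / 2).card = d / 2 := by
    rw [Fin.card_filter_val_lt]
    omega
  have h2 : (Finset.univ.filter fun i : Fin d => ¬ (i : ℕ) < d / 2).card = d / 2 := by
    have := Finset.card_filter_add_card_filter_not (s := (Finset.univ : Finset (Fin d)))
      (fun i : Fin d => (i : ℕ) < d / 2)
    obtain ⟨r, rfl⟩ := hd
    simp only [Finset.card_univ, Fintype.card_fin] at this
    omega
  rcases Int.units_eq_one_or u with rfl | rfl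
  · rw [← h1]; congr 1; ext i
    by_cases h : (i : ℕ) < d / 2 <;> simp [cloneSign, h]
  · rw [← h2]; congr 1; ext i
    by_cases h : (i : ℕ) < d / 2 <;> simp [cloneSign]

theorem card_literalValue_pair (hd : Even d) (σ τ : Assignment n) (u u' : ℤˣ) :
    Fintype.card {v : Fin n × Fin d // (literalValue σ v, literalValue τ v) = (u, u')}
      = (Finset.univ.filter fun x => σ x * τ x = u * u').card * (d / 2) := by
  rw [Fintype.card_subtype]
  have h : (Finset.univ.filter fun v : Fin n × Fin d =>
      (literalValue σ v, literalValue τ v) = (u, u'))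
      = ((Finset.univ.filter fun x => σ x * τ x = u * u').sigma
          (fun x => Finset.univ.filter fun i : Fin d => cloneSign i = u * σ x)).map
            (Equiv.sigmaEquivProd (Fin n) (Fin d)).toEmbedding := by
    ext ⟨x, i⟩
    simp only [Finset.mem_filter, Finset.mem_univ, true_and, Prod.mk.injEq, literalValue_eq,
      Finset.mem_map_equiv, Finset.mem_sigma, Equiv.sigmaEquivProd_symm_apply]
    generalize cloneSign i = e
    generalize σ x = a
    generalize τ x = b
    revert e a b u u'
    decide
  rw [h, Finset.card_map, Finset.card_sigma, Finset.sum_congr rfl fun x _ =>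
    card_cloneSign_eq hd (u * σ x), Finset.sum_const, smul_eq_mul]

theorem card_literalValue (hd : Even d) (σ : Assignment n) (u : ℤˣ) :
    Fintype.card {v : Fin n × Fin d // literalValue σ v = u} = n * (d / 2) := by
  have h := card_literalValue_pair hd σ σ u u
  have h2 : (Finset.univ.filter fun x => σ x * σ x = u * u).card = n := by
    simp [Int.units_mul_self]
  rw [h2] at h
  rw [← h]
  refine Fintype.card_congr (Equiv.subtypeEquivRight fun v => ?_)
  simp

/-- The truth values of the literals of `Φ` under `σ`, listed clause by clause. -/
def pattern (σ : Assignment n) (Φ : Formula n d m k) : Fin m → Fin k → ℤˣ :=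
  fun a j => literalValue σ (Φ.symm (a, j))

/-- The contribution of a clause with the given truth values to the Gibbs weight. -/
noncomputable def clauseWeight (β : ℝ) (t : Fin k → ℤˣ) : ℝ :=
  if ∀ j, t j = -1 then Real.exp (-β) else 1

theorem clauseWeight_pos (β : ℝ) (t : Fin k → ℤˣ) : 0 < clauseWeight β t := by
  unfold clauseWeight
  split_ifs
  · exact Real.exp_pos _
  · exact one_pos

theorem weight_eq_prod (β : ℝ) (Φ : Formula n d m k) (σ : Assignment n) :
    weight β Φ σ = ∏ a, clauseWeight β (pattern σ Φ a) := by
  unfold weight energy clauseWeight pattern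
  rw [Finset.prod_ite, Finset.prod_const, Finset.prod_const_one, mul_one, ← Real.exp_nat_mul,
    mul_comm]

/-- The number of false literals in a clause. -/
def numFalse (t : Fin k → ℤˣ) : ℕ := (Finset.univ.filter fun j => t j = -1).card

/-- The patterns in which exactly half of the literals are false; these are the patterns of the
formulas. -/
def balanced (m k h : ℕ) : Finset (Fin m → Fin k → ℤˣ) :=
  Finset.univ.filter fun T => ∑ a, numFalse (T a) = h

theorem card_uncurry_eq_neg_one (T : Fin m → Fin k → ℤˣ) :
    Fintype.card {s : Fin m × Fin k // Function.uncurry T s = -1} = ∑ a, numFalse (T a) := by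
  rw [Fintype.card_subtype]
  simp only [numFalse, Finset.card_filter]
  rw [Fintype.sum_prod_type]
  rfl

theorem sum_pattern (hd : Even d) (hN : m * k = n * d) (σ : Assignment n)
    (H : (Fin m → Fin k → ℤˣ) → ℝ) :
    ∑ Φ : Formula n d m k, H (pattern σ Φ)
      = ((n * (d / 2)).factorial : ℝ) ^ 2 * ∑ T ∈ balanced m k (n * (d / 2)), H T := by
  have h := sum_equiv_comp_symm (V := Fin n × Fin d) (S := Fin m × Fin k) (literalValue σ)
    (fun T => H (Function.curry T))
  refine Eq.trans ?_ (h.trans ?_)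
  · rfl
  · have hfac : (∏ u : ℤˣ, (Fintype.card {v : Fin n × Fin d // literalValue σ v = u}).factorial)
        = (n * (d / 2)).factorial ^ 2 := by
      simp only [card_literalValue hd]
      rw [Finset.prod_const]
      rfl
    rw [hfac]
    push_cast
    congr 1
    refine Finset.sum_nbij' (fun T => Function.curry T) (fun T => Function.uncurry T) ?_ ?_ ?_ ?_ ?_
    · intro T hT
      rw [mem_image_comp_symm_iff] at hT
      have := hT (-1)
      rw [card_literalValue hd] at this
      refine Finset.mem_filter.2 ⟨Finset.mem_univ _, ?_⟩
      rw [← card_uncurry_eq_neg_one, this]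
      rfl
    · intro T hT
      have h1 := (Finset.mem_filter.1 hT).2
      rw [mem_image_comp_symm_iff]
      have hm1 : Fintype.card {s : Fin m × Fin k // Function.uncurry T s = -1} = n * (d / 2) := by
        rw [card_uncurry_eq_neg_one, h1]
      have hp1 : Fintype.card {s : Fin m × Fin k // Function.uncurry T s = 1} = n * (d / 2) := by
        have hsum := Fintype.card_subtype_compl (fun s : Fin m × Fin k => Function.uncurry T s = -1)
        rw [hm1, Fintype.card_prod, Fintype.card_fin, Fintype.card_fin, hN] at hsum
        have : Fintype.card {s : Fin m × Fin k // Function.uncurry T s = 1}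
            = Fintype.card {s : Fin m × Fin k // ¬ Function.uncurry T s = -1} := by
          refine Fintype.card_congr (Equiv.subtypeEquivRight fun s => ?_)
          rcases Int.units_eq_one_or (Function.uncurry T s) with h | h <;> simp [h]
        rw [this, hsum]
        obtain ⟨r, rfl⟩ := hd
        have : (r + r) / 2 = r := by omega
        rw [this, mul_add]; omega
      intro u
      rw [card_literalValue hd]
      rcases Int.units_eq_one_or u with rfl | rfl
      · exact hp1.symm
      · exact hm1.symm
    · intro T _; simp
    · intro T _; simp
    · intro T _; rfl

theorem card_formula (hN : m * k = n * d) :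
    Fintype.card (Formula n d m k) = (n * d).factorial := by
  have e : Fin n × Fin d ≃ Fin m × Fin k :=
    Fintype.equivOfCardEq (by simp [hN])
  rw [Fintype.card_equiv e]
  simp

end RegKSAT

/-! ### A local limit estimate -/

/-- Sums over the level sets of the number of coordinates equal to `u`: flipping one coordinate
moves from a level below the middle one to the next. -/
theorem mul_sum_level_le {S : Type*} [Fintype S] [DecidableEq S] (Q : (S → ℤˣ) → ℝ)
    (hQ : ∀ T, 0 ≤ Q T) {ρ : ℝ} (hρ : 0 ≤ ρ)
    (hflip : ∀ T s u, ρ * Q T ≤ Q (Function.update T s u)) (u : ℤˣ) (v : ℕ)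
    (hv : 2 * v + 1 ≤ Fintype.card S) :
    ρ * ∑ T with (Finset.univ.filter fun s => T s = u).card = v, Q T
      ≤ ∑ T with (Finset.univ.filter fun s => T s = u).card = v + 1, Q T := by
  classical
  set A : Finset (S → ℤˣ) :=
    Finset.univ.filter fun T => (Finset.univ.filter fun s => T s = u).card = v with hA
  set B : Finset (S → ℤˣ) :=
    Finset.univ.filter fun T => (Finset.univ.filter fun s => T s = u).card = v + 1 with hB
  have hne : ∀ w : ℤˣ, w ≠ u → w = -u := by clear * - u; revert u; decide
  have hnu : -u ≠ u := by clear * - u; revert u; decide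
  -- Both sides count pairs of a pattern and a distinguished coordinate.
  have h1 : ((Fintype.card S : ℝ) - v) * (ρ * ∑ T ∈ A, Q T)
      = ∑ p ∈ A.sigma fun T => Finset.univ.filter fun s => T s ≠ u, ρ * Q p.1 := by
    rw [Finset.sum_sigma, Finset.mul_sum, Finset.mul_sum]
    refine Finset.sum_congr rfl fun T hT => ?_
    simp only [Finset.sum_const, nsmul_eq_mul]
    congr 1
    have h2 := Finset.card_filter_add_card_filter_not (s := (Finset.univ : Finset S))
      (fun s => T s = u)
    rw [(Finset.mem_filter.1 hT).2, Finset.card_univ] at h2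
    rw [← h2]; push_cast; ring
  have h3 : ((v : ℝ) + 1) * ∑ T ∈ B, Q T
      = ∑ p ∈ B.sigma fun T => Finset.univ.filter fun s => T s = u, Q p.1 := by
    rw [Finset.sum_sigma, Finset.mul_sum]
    refine Finset.sum_congr rfl fun T hT => ?_
    simp only [Finset.sum_const, nsmul_eq_mul, (Finset.mem_filter.1 hT).2]
    push_cast; ring
  have h4 : ∑ p ∈ A.sigma fun T => Finset.univ.filter fun s => T s ≠ u, ρ * Q p.1
      ≤ ∑ p ∈ B.sigma fun T => Finset.univ.filter fun s => T s = u, Q p.1 := by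
    calc ∑ p ∈ A.sigma fun T => Finset.univ.filter fun s => T s ≠ u, ρ * Q p.1
        ≤ ∑ p ∈ A.sigma fun T => Finset.univ.filter fun s => T s ≠ u,
            Q (Function.update p.1 p.2 u) :=
          Finset.sum_le_sum fun p _ => hflip _ _ _
      _ = ∑ p ∈ B.sigma fun T => Finset.univ.filter fun s => T s = u, Q p.1 := by
          refine Finset.sum_nbij' (fun p => ⟨Function.update p.1 p.2 u, p.2⟩)
            (fun p => ⟨Function.update p.1 p.2 (-u), p.2⟩) ?_ ?_ ?_ ?_ ?_
          · rintro ⟨T, s⟩ hp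
            simp only [Finset.mem_sigma, Finset.mem_filter, Finset.mem_univ, true_and, hA, hB]
              at hp ⊢
            refine ⟨?_, by simp⟩
            have : (Finset.univ.filter fun x => Function.update T s u x = u)
                = insert s (Finset.univ.filter fun x => T x = u) := by
              ext x
              by_cases hx : x = s
              · subst hx; simp
              · simp [hx]
            rw [this, Finset.card_insert_of_notMem (by simp [hp.2]), hp.1]
          · rintro ⟨T, s⟩ hp
            simp only [Finset.mem_sigma, Finset.mem_filter, Finset.mem_univ, true_and, hA, hB]
              at hp ⊢
            refine ⟨?_, by simp [hnu]⟩
            have : (Finset.univ.filter fun x => Function.update T s (-u) x = u)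
                = (Finset.univ.filter fun x => T x = u).erase s := by
              ext x
              by_cases hx : x = s
              · subst hx; simp [hnu]
              · simp [hx]
            rw [this, Finset.card_erase_of_mem (by simp [hp.2]), hp.1]
            rfl
          · rintro ⟨T, s⟩ hp
            simp only [Finset.mem_sigma, Finset.mem_filter, Finset.mem_univ, true_and] at hp
            simp [← hne _ hp.2]
          · rintro ⟨T, s⟩ hp
            simp only [Finset.mem_sigma, Finset.mem_filter, Finset.mem_univ, true_and] at hp
            simp [← hp.2]
          · rintro ⟨T, s⟩ _
            rfl
  have h5 : ((v : ℝ) + 1) * (ρ * ∑ T ∈ A, Q T) ≤ ((v : ℝ) + 1) * ∑ T ∈ B, Q T := by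
    rw [h3]
    refine le_trans ?_ h4
    rw [← h1]
    refine mul_le_mul_of_nonneg_right ?_ (mul_nonneg hρ (Finset.sum_nonneg fun T _ => hQ T))
    have : ((2 * v + 1 : ℕ) : ℝ) ≤ Fintype.card S := by exact_mod_cast hv
    push_cast at this
    linarith
  exact le_of_mul_le_mul_left h5 (by positivity)

theorem pow_mul_sum_level_le {S : Type*} [Fintype S] [DecidableEq S] (Q : (S → ℤˣ) → ℝ)
    (hQ : ∀ T, 0 ≤ Q T) {ρ : ℝ} (hρ : 0 ≤ ρ)
    (hflip : ∀ T s u, ρ * Q T ≤ Q (Function.update T s u)) (u : ℤˣ) {h : ℕ}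
    (hh : Fintype.card S = 2 * h) (i : ℕ) (v : ℕ) (hv : v + i = h) :
    ρ ^ i * ∑ T with (Finset.univ.filter fun s => T s = u).card = v, Q T
      ≤ ∑ T with (Finset.univ.filter fun s => T s = u).card = h, Q T := by
  induction i generalizing v with
  | zero => subst hv; simp
  | succ i ih =>
    refine le_trans ?_ (ih (v + 1) (by omega))
    rw [pow_succ, mul_assoc]
    exact mul_le_mul_of_nonneg_left (mul_sum_level_le Q hQ hρ hflip u v (by omega))
      (pow_nonneg hρ i)

/-- The middle level carries at least a `ρ ^ L / (|S| + 1)` share of the mass of the `2 * L + 1`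
levels around it. -/
theorem pow_mul_sum_window_le {S : Type*} [Fintype S] [DecidableEq S] (Q : (S → ℤˣ) → ℝ)
    (hQ : ∀ T, 0 ≤ Q T) {ρ : ℝ} (hρ : 0 ≤ ρ) (hρ1 : ρ ≤ 1)
    (hflip : ∀ T s u, ρ * Q T ≤ Q (Function.update T s u)) {h : ℕ}
    (hh : Fintype.card S = 2 * h) (L : ℕ) :
    ρ ^ L * ∑ T with (Finset.univ.filter fun s => T s = -1).card ≤ h + L ∧
        h ≤ (Finset.univ.filter fun s => T s = -1).card + L, Q T
      ≤ (Fintype.card S + 1) *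
        ∑ T with (Finset.univ.filter fun s => T s = -1).card = h, Q T := by
  classical
  set cnt : (S → ℤˣ) → ℕ := fun T => (Finset.univ.filter fun s => T s = -1).card with hcnt
  set P : ℝ := ∑ T with cnt T = h, Q T with hP
  have hP0 : 0 ≤ P := Finset.sum_nonneg fun T _ => hQ T
  have hle : ∀ T, cnt T ≤ Fintype.card S := fun T => Finset.card_le_univ _
  have hcompl : ∀ T, (Finset.univ.filter fun s => T s = 1).card + cnt T = Fintype.card S := by
    intro T
    have h2 := Finset.card_filter_add_card_filter_not (s := (Finset.univ : Finset S))
      (fun s => T s = 1)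
    rw [Finset.card_univ] at h2
    have h3 : (Finset.univ.filter fun s => ¬ T s = 1) = Finset.univ.filter fun s => T s = -1 :=
      Finset.filter_congr fun s _ => by
        rcases Int.units_eq_one_or (T s) with h | h <;> simp [h]
    rw [← h2, h3]
  have hlevel : ∀ v, v ≤ h + L → h ≤ v + L → ρ ^ L * ∑ T with cnt T = v, Q T ≤ P := by
    intro v h1 h2
    have key : ∃ i ≤ L, ρ ^ i * ∑ T with cnt T = v, Q T ≤ P := by
      rcases le_total v h with hv | hv
      · exact ⟨h - v, by omega, pow_mul_sum_level_le Q hQ hρ hflip (-1) hh (h - v) v (by omega)⟩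
      · by_cases hv2 : v ≤ 2 * h
        · refine ⟨v - h, by omega, ?_⟩
          have := pow_mul_sum_level_le Q hQ hρ hflip 1 hh (v - h) (2 * h - v) (by omega)
          have e1 : (Finset.univ.filter fun T : S → ℤˣ =>
              (Finset.univ.filter fun s => T s = 1).card = 2 * h - v)
              = Finset.univ.filter fun T => cnt T = v := by
            refine Finset.filter_congr fun T _ => ?_
            have := hcompl T
            omega
          have e2 : (Finset.univ.filter fun T : S → ℤˣ =>
              (Finset.univ.filter fun s => T s = 1).card = h)
              = Finset.univ.filter fun T => cnt T = h := by
            refine Finset.filter_congr fun T _ => ?_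
            have := hcompl T
            omega
          rwa [e1, e2] at this
        · refine ⟨0, Nat.zero_le _, ?_⟩
          have : (Finset.univ.filter fun T : S → ℤˣ => cnt T = v) = ∅ := by
            refine Finset.filter_eq_empty_iff.2 fun T _ => ?_
            have := hle T
            omega
          rw [this]; simpa using hP0
    obtain ⟨i, hi, hk⟩ := key
    refine le_trans (mul_le_mul_of_nonneg_right (pow_le_pow_of_le_one hρ hρ1 hi) ?_) hk
    exact Finset.sum_nonneg fun T _ => hQ T
  calc ρ ^ L * ∑ T with cnt T ≤ h + L ∧ h ≤ cnt T + L, Q T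
      = ∑ v ∈ Finset.range (Fintype.card S + 1),
          ρ ^ L * ∑ T ∈ (Finset.univ.filter fun T => cnt T ≤ h + L ∧ h ≤ cnt T + L).filter
            (fun T => cnt T = v), Q T := by
        rw [← Finset.mul_sum, Finset.sum_fiberwise_of_maps_to]
        intro T _
        exact Finset.mem_range.2 (Nat.lt_succ_of_le (hle T))
    _ ≤ ∑ v ∈ Finset.range (Fintype.card S + 1), P := by
        refine Finset.sum_le_sum fun v _ => ?_
        by_cases hv : v ≤ h + L ∧ h ≤ v + L
        · refine le_trans (mul_le_mul_of_nonneg_left ?_ (pow_nonneg hρ L)) (hlevel v hv.1 hv.2)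
          refine Finset.sum_le_sum_of_subset_of_nonneg ?_ fun T _ _ => hQ T
          intro T hT
          simp only [Finset.mem_filter, Finset.mem_univ, true_and] at hT ⊢
          exact hT.2
        · have : ((Finset.univ.filter fun T => cnt T ≤ h + L ∧ h ≤ cnt T + L).filter
              (fun T => cnt T = v)) = ∅ := by
            refine Finset.filter_eq_empty_iff.2 fun T hT hTv => hv ?_
            subst hTv
            exact (Finset.mem_filter.1 hT).2
          rw [this]; simpa using hP0
    _ = (Fintype.card S + 1) * P := by
        rw [Finset.sum_const, Finset.card_range, nsmul_eq_mul]; push_cast; ring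

namespace RegKSAT

variable {n d m k : ℕ}

theorem sum_prod_pi {Ω : Type*} [Fintype Ω] (g : Ω → ℝ) (m : ℕ) :
    ∑ T : Fin m → Ω, ∏ a, g (T a) = (∑ t, g t) ^ m := by
  classical
  rw [← Fintype.piFinset_univ, Finset.sum_prod_piFinset]
  simp

theorem numFalse_le (t : Fin k → ℤˣ) : numFalse t ≤ k := by
  simpa [numFalse] using Finset.card_le_univ (Finset.univ.filter fun j => t j = -1)

/-- Chernoff bound for the total number of false literals under independent clauses whose expected
number of false literals is `k / 2`. -/
theorem sum_deviation_le (p : (Fin k → ℤˣ) → ℝ) (hp : ∀ t, 0 ≤ p t) (hs : ∑ t, p t = 1)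
    (hmean : ∑ t, p t * numFalse t = k / 2) (m : ℕ) (A : Finset (Fin m → Fin k → ℤˣ)) (θ x : ℝ)
    (hA : ∀ T ∈ A, x ≤ θ * ∑ a, ((numFalse (T a) : ℝ) - k / 2)) :
    ∑ T ∈ A, ∏ a, p (T a) ≤ Real.exp (m * ((θ * k) ^ 2 / 2) - x) := by
  have h1 : ∑ t, p t * Real.exp (θ * ((numFalse t : ℝ) - k / 2)) ≤ Real.exp ((θ * k) ^ 2 / 2) := by
    refine (sum_mul_exp_le_of_osc p (fun t => θ * ((numFalse t : ℝ) - k / 2)) hp hs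
      (c := |θ| * k) ?_).trans (le_of_eq ?_)
    · intro s t
      rw [← mul_sub, abs_mul]
      refine mul_le_mul_of_nonneg_left ?_ (abs_nonneg _)
      have a1 : (numFalse s : ℝ) ≤ k := by exact_mod_cast numFalse_le s
      have a2 : (numFalse t : ℝ) ≤ k := by exact_mod_cast numFalse_le t
      have b1 : (0 : ℝ) ≤ numFalse s := Nat.cast_nonneg _
      have b2 : (0 : ℝ) ≤ numFalse t := Nat.cast_nonneg _
      rw [abs_le]; constructor <;> linarith
    · congr 1
      have : ∑ t, p t * (θ * ((numFalse t : ℝ) - k / 2)) = 0 := by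
        have : ∀ t, p t * (θ * ((numFalse t : ℝ) - k / 2))
            = θ * (p t * numFalse t) - θ * (k / 2) * p t := fun t => by ring
        rw [Finset.sum_congr rfl fun t _ => this t, Finset.sum_sub_distrib, ← Finset.mul_sum,
          ← Finset.mul_sum, hmean, hs]
        ring
      rw [this, mul_pow, sq_abs, mul_pow]; ring
  have h2 : ∑ T : Fin m → Fin k → ℤˣ,
      ∏ a, p (T a) * Real.exp (θ * ((numFalse (T a) : ℝ) - k / 2))
        ≤ Real.exp (m * ((θ * k) ^ 2 / 2)) := by
    rw [sum_prod_pi (fun t => p t * Real.exp (θ * ((numFalse t : ℝ) - k / 2))) m,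
      Real.exp_nat_mul]
    exact pow_le_pow_left₀
      (Finset.sum_nonneg fun t _ => mul_nonneg (hp t) (Real.exp_pos _).le) h1 m
  rw [Real.exp_sub, le_div_iff₀ (Real.exp_pos _), Finset.sum_mul]
  refine le_trans (Finset.sum_le_sum (g := fun T : Fin m → Fin k → ℤˣ =>
    ∏ a, p (T a) * Real.exp (θ * ((numFalse (T a) : ℝ) - k / 2))) ?_)
    (le_trans (Finset.sum_le_univ_sum_of_nonneg fun T =>
      Finset.prod_nonneg fun a _ => mul_nonneg (hp _) (Real.exp_pos _).le) h2)
  intro T hT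
  rw [Finset.prod_mul_distrib, ← Real.exp_sum, ← Finset.mul_sum]
  exact mul_le_mul_of_nonneg_left (Real.exp_le_exp.2 (hA T hT))
    (Finset.prod_nonneg fun a _ => hp _)

/-- Independent clauses whose expected number of false literals is `k / 2` are exactly balanced with
a probability that is not exponentially small. -/
theorem eventually_exp_le_sum_balanced (p : (Fin k → ℤˣ) → ℝ) (hp : ∀ t, 0 < p t)
    (hs : ∑ t, p t = 1) (hmean : ∑ t, p t * numFalse t = k / 2) {η : ℝ} (hη : 0 < η) :
    ∀ᶠ m : ℕ in atTop, ∀ h : ℕ, m * k = 2 * h →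
      Real.exp (-η * m) ≤ ∑ T ∈ balanced m k h, ∏ a, p (T a) := by
  classical
  obtain ⟨t₀, ht₀⟩ := Finite.exists_min p
  set ρ := p t₀ with hρdef
  have hρ : 0 < ρ := hp t₀
  have hple : ∀ t, p t ≤ 1 := fun t => by
    rw [← hs]; exact Finset.single_le_sum (fun i _ => (hp i).le) (Finset.mem_univ t)
  have hρ1 : ρ ≤ 1 := hple t₀
  have hlog : 0 ≤ -Real.log ρ := by linarith [Real.log_nonpos hρ.le hρ1]
  set δ : ℝ := η / 2 / (-Real.log ρ + 1) with hδ
  have hδ0 : 0 < δ := by positivity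
  have hδlog : δ * (-Real.log ρ) ≤ η / 2 := by
    rw [hδ, div_mul_eq_mul_div, div_le_iff₀ (by positivity)]
    nlinarith
  set θ : ℝ := δ / (k ^ 2 + 1) with hθ
  have hθ0 : 0 < θ := by positivity
  set r : ℝ := θ * δ / 2 with hr
  have hr0 : 0 < r := by positivity
  have hexp : (θ * k) ^ 2 / 2 - θ * δ ≤ -r := by
    have h1 : θ * (k ^ 2 + 1) = δ := by rw [hθ]; field_simp
    have h2 : (θ * k) ^ 2 ≤ θ * δ := by
      rw [← h1]; nlinarith [sq_nonneg θ]
    rw [hr]; linarith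
  have ev1 : ∀ᶠ m : ℕ in atTop, Real.exp (-r * m) ≤ 1 / 4 := by
    have : Tendsto (fun m : ℕ => Real.exp (-r * m)) atTop (𝓝 0) := by
      refine Real.tendsto_exp_atBot.comp ?_
      exact tendsto_natCast_atTop_atTop.const_mul_atTop_of_neg (by linarith)
    exact this.eventually_le_const (by norm_num)
  have ev2 : ∀ᶠ m : ℕ in atTop, 2 * ((m : ℝ) * k + 1) ≤ Real.exp (η / 2 * m) := by
    have := (isLittleO_pow_exp_pos_mul_atTop (k := 1) (b := η / 2) (by positivity)).bound
      (c := (1 / (4 * ((k : ℝ) + 1)))) (by positivity)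
    have h2 := tendsto_natCast_atTop_atTop (R := ℝ) |>.eventually this
    have h3 : ∀ᶠ m : ℕ in atTop, 1 ≤ m := eventually_ge_atTop 1
    filter_upwards [h2, h3] with m hm hm1
    have hm1' : (1 : ℝ) ≤ m := by exact_mod_cast hm1
    rw [pow_one, Real.norm_of_nonneg (by positivity), Real.norm_of_nonneg (Real.exp_pos _).le,
      div_mul_eq_mul_div, one_mul, le_div_iff₀ (by positivity)] at hm
    have : (0 : ℝ) ≤ k := Nat.cast_nonneg k
    nlinarith
  filter_upwards [ev1, ev2] with m hm1 hm2 h hmk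
  set L : ℕ := ⌊δ * m⌋₊ with hL
  have hLle : (L : ℝ) ≤ δ * m := Nat.floor_le (by positivity)
  have hLlt : δ * m < L + 1 := Nat.lt_floor_add_one _
  -- the product weight as a function of the uncurried pattern
  set Q : (Fin m × Fin k → ℤˣ) → ℝ := fun T => ∏ a, p (Function.curry T a) with hQ
  have hQ0 : ∀ T, 0 ≤ Q T := fun T => Finset.prod_nonneg fun a _ => (hp _).le
  have hflip : ∀ T s u, ρ * Q T ≤ Q (Function.update T s u) := by
    intro T s u
    simp only [hQ]
    rw [← Finset.mul_prod_erase _ _ (Finset.mem_univ s.1),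
      ← Finset.mul_prod_erase _ (fun a => p (Function.curry (Function.update T s u) a))
        (Finset.mem_univ s.1)]
    have e : ∏ a ∈ Finset.univ.erase s.1, p (Function.curry (Function.update T s u) a)
        = ∏ a ∈ Finset.univ.erase s.1, p (Function.curry T a) := by
      refine Finset.prod_congr rfl fun a ha => ?_
      congr 1
      funext j
      have : (a, j) ≠ s := fun h => (Finset.mem_erase.1 ha).1 (by rw [← h])
      simp [Function.curry, Function.update_of_ne this]
    rw [e, ← mul_assoc]
    refine mul_le_mul_of_nonneg_right ?_ (Finset.prod_nonneg fun a _ => (hp _).le)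
    calc ρ * p (Function.curry T s.1) ≤ ρ * 1 := mul_le_mul_of_nonneg_left (hple _) hρ.le
      _ ≤ _ := by rw [mul_one]; exact ht₀ _
  have hcard : Fintype.card (Fin m × Fin k) = 2 * h := by simp [hmk]
  have hwin := pow_mul_sum_window_le Q hQ0 hρ.le hρ1 hflip hcard L
  have hcnt : ∀ T : Fin m → Fin k → ℤˣ,
      (Finset.univ.filter fun s => Function.uncurry T s = -1).card = ∑ a, numFalse (T a) := by
    intro T
    rw [← card_uncurry_eq_neg_one, Fintype.card_subtype]
  have htrans : ∀ R : ℕ → Prop, ∀ [DecidablePred R],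
      ∑ T with R (Finset.univ.filter fun s : Fin m × Fin k => T s = -1).card, Q T
        = ∑ T : Fin m → Fin k → ℤˣ with R (∑ a, numFalse (T a)), ∏ a, p (T a) := by
    intro R _
    refine Finset.sum_nbij' (fun T => Function.curry T) (fun T => Function.uncurry T)
      ?_ ?_ ?_ ?_ ?_
    · intro T hT
      have := (Finset.mem_filter.1 hT).2
      refine Finset.mem_filter.2 ⟨Finset.mem_univ _, ?_⟩
      rw [← hcnt]
      exact this
    · intro T hT
      have := (Finset.mem_filter.1 hT).2
      refine Finset.mem_filter.2 ⟨Finset.mem_univ _, ?_⟩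
      rwa [hcnt]
    · intro T _; simp
    · intro T _; simp
    · intro T _; rfl
  rw [htrans (fun v => v ≤ h + L ∧ h ≤ v + L), htrans (fun v => v = h)] at hwin
  set W := ∑ T : Fin m → Fin k → ℤˣ with
    (∑ a, numFalse (T a)) ≤ h + L ∧ h ≤ (∑ a, numFalse (T a)) + L, ∏ a, p (T a) with hW
  set P := ∑ T ∈ balanced m k h, ∏ a, p (T a) with hP
  change ρ ^ L * W ≤ (Fintype.card (Fin m × Fin k) + 1) * P at hwin
  have hcent : ∀ T : Fin m → Fin k → ℤˣ,
      ∑ a, ((numFalse (T a) : ℝ) - k / 2) = ((∑ a, numFalse (T a) : ℕ) : ℝ) - h := by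
    intro T
    rw [Finset.sum_sub_distrib, Finset.sum_const, Finset.card_univ, Fintype.card_fin]
    push_cast
    have : (m : ℝ) * k = 2 * h := by exact_mod_cast hmk
    rw [nsmul_eq_mul]; linarith
  have hbound : Real.exp (m * ((θ * k) ^ 2 / 2) - θ * δ * m) ≤ 1 / 4 := by
    refine le_trans (Real.exp_le_exp.2 ?_) hm1
    have : (0 : ℝ) ≤ m := Nat.cast_nonneg m
    nlinarith
  have hup := sum_deviation_le p (fun t => (hp t).le) hs hmean m
    (Finset.univ.filter fun T => h + L < ∑ a, numFalse (T a)) θ (θ * δ * m) (by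
      intro T hT
      have h1 : ((h + L + 1 : ℕ) : ℝ) ≤ ((∑ a, numFalse (T a) : ℕ) : ℝ) := by
        exact_mod_cast (Finset.mem_filter.1 hT).2
      push_cast at h1
      rw [hcent, mul_assoc]
      refine mul_le_mul_of_nonneg_left ?_ hθ0.le
      push_cast
      linarith)
  have hdown := sum_deviation_le p (fun t => (hp t).le) hs hmean m
    (Finset.univ.filter fun T => (∑ a, numFalse (T a)) + L < h) (-θ) (θ * δ * m) (by
      intro T hT
      have h1 : (((∑ a, numFalse (T a)) + L + 1 : ℕ) : ℝ) ≤ h := by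
        exact_mod_cast (Finset.mem_filter.1 hT).2
      push_cast at h1
      rw [hcent, mul_assoc, neg_mul, ← mul_neg]
      refine mul_le_mul_of_nonneg_left ?_ hθ0.le
      push_cast
      linarith)
  have htot : ∑ T : Fin m → Fin k → ℤˣ, ∏ a, p (T a) = 1 := by rw [sum_prod_pi, hs, one_pow]
  have hQnn : ∀ T : Fin m → Fin k → ℤˣ, 0 ≤ ∏ a, p (T a) := fun T =>
    Finset.prod_nonneg fun a _ => (hp _).le
  have hhalf : 1 / 2 ≤ W := by
    have hsplit : (1 : ℝ) ≤ W
        + (∑ T ∈ Finset.univ.filter (fun T : Fin m → Fin k → ℤˣ =>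
            h + L < ∑ a, numFalse (T a)), ∏ a, p (T a)
        + ∑ T ∈ Finset.univ.filter (fun T : Fin m → Fin k → ℤˣ =>
            (∑ a, numFalse (T a)) + L < h), ∏ a, p (T a)) := by
      rw [← htot, hW, Finset.sum_filter, Finset.sum_filter, Finset.sum_filter,
        ← Finset.sum_add_distrib, ← Finset.sum_add_distrib]
      refine Finset.sum_le_sum fun T _ => ?_
      have := hQnn T
      split_ifs <;> first | linarith | omega
    have e2 : (-θ * (k : ℝ)) ^ 2 = (θ * k) ^ 2 := by ring
    rw [e2] at hdown
    linarith
  have hNp : (0 : ℝ) < (m : ℝ) * k + 1 := by positivity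
  have hρL : Real.exp (-(η / 2) * m) ≤ ρ ^ L := by
    rw [← Real.exp_log hρ, ← Real.exp_nat_mul]
    refine Real.exp_le_exp.2 ?_
    have h1 : (L : ℝ) * (-Real.log ρ) ≤ δ * m * (-Real.log ρ) :=
      mul_le_mul_of_nonneg_right hLle hlog
    have h2 : δ * (-Real.log ρ) * m ≤ η / 2 * m :=
      mul_le_mul_of_nonneg_right hδlog (Nat.cast_nonneg m)
    linarith
  have hfin : Real.exp (-(η / 2) * m) ≤ 2 * ((m : ℝ) * k + 1) * P := by
    have h1 : (((Fintype.card (Fin m × Fin k) : ℕ) : ℝ) + 1) = (m : ℝ) * k + 1 := by simp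
    rw [h1] at hwin
    have h2 : ρ ^ L * (1 / 2) ≤ ρ ^ L * W := mul_le_mul_of_nonneg_left hhalf (by positivity)
    linarith
  have hP0 : 0 ≤ P := Finset.sum_nonneg fun T _ => hQnn T
  have h3 : Real.exp (-(η / 2) * m) ≤ Real.exp (η / 2 * m) * P :=
    hfin.trans (mul_le_mul_of_nonneg_right hm2 hP0)
  have e3 : Real.exp (-η * m) = Real.exp (-(η / 2) * m) * Real.exp (-(η / 2) * m) := by
    rw [← Real.exp_add]; congr 1; ring
  have e4 : Real.exp (η / 2 * m) * Real.exp (-(η / 2) * m) = 1 := by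
    rw [← Real.exp_add]; simp
  calc Real.exp (-η * m) = Real.exp (-(η / 2) * m) * Real.exp (-(η / 2) * m) := e3
    _ ≤ Real.exp (η / 2 * m) * P * Real.exp (-(η / 2) * m) :=
        mul_le_mul_of_nonneg_right h3 (Real.exp_pos _).le
    _ = P := by rw [mul_right_comm, e4, one_mul]

/-! ### The annealed free energy -/

theorem sum_units (y : ℤˣ → ℝ) : ∑ u, y u = y 1 + y (-1) := by
  rw [UnitsInt.univ, Finset.sum_pair (by decide)]

theorem sum_prod_mul_clauseWeight (β : ℝ) (y : ℤˣ → ℝ) :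
    ∑ t : Fin k → ℤˣ, (∏ j, y (t j)) * clauseWeight β t
      = (y 1 + y (-1)) ^ k - (1 - Real.exp (-β)) * y (-1) ^ k := by
  have h1 : ∀ t : Fin k → ℤˣ, (∏ j, y (t j)) * clauseWeight β t
      = (∏ j, y (t j)) - (1 - Real.exp (-β)) * ∏ j, (if t j = -1 then y (t j) else 0) := by
    intro t
    unfold clauseWeight
    split_ifs with h
    · rw [Finset.prod_congr rfl (g := fun j => y (t j))
        (f := fun j => if t j = -1 then y (t j) else 0) (fun j _ => if_pos (h j))]
      ring
    · push Not at h
      obtain ⟨j, hj⟩ := h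
      rw [Finset.prod_eq_zero (i := j) (f := fun j => if t j = -1 then y (t j) else 0)
        (Finset.mem_univ j) (by rw [if_neg hj])]
      ring
  rw [Finset.sum_congr rfl fun t _ => h1 t, Finset.sum_sub_distrib, ← Finset.mul_sum,
    sum_prod_pi y k, sum_prod_pi (fun u => if u = -1 then y u else 0) k, sum_units, sum_units]
  simp

theorem sum_prod_mul_numFalse (y : ℤˣ → ℝ) (hy : y 1 + y (-1) = 1) :
    ∑ t : Fin k → ℤˣ, (∏ j, y (t j)) * numFalse t = k * y (-1) := by
  classical
  have h1 : ∀ t : Fin k → ℤˣ, (∏ j, y (t j)) * (numFalse t : ℝ)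
      = ∑ i, ∏ j, (if j = i then (if t j = -1 then y (t j) else 0) else y (t j)) := by
    intro t
    rw [numFalse, Finset.card_filter]
    push_cast
    rw [Finset.mul_sum]
    refine Finset.sum_congr rfl fun i _ => ?_
    rw [← Finset.mul_prod_erase _ _ (Finset.mem_univ i),
      ← Finset.mul_prod_erase _ (fun j => if j = i then (if t j = -1 then y (t j) else 0)
        else y (t j)) (Finset.mem_univ i)]
    rw [Finset.prod_congr rfl (g := fun j => y (t j)) (s₁ := Finset.univ.erase i)
      (f := fun j => if j = i then (if t j = -1 then y (t j) else 0) else y (t j))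
      (fun j hj => by rw [if_neg (Finset.ne_of_mem_erase hj)])]
    simp only [if_true]
    split_ifs <;> ring
  rw [Finset.sum_congr rfl fun t _ => h1 t, Finset.sum_comm]
  have h2 : ∀ i : Fin k, ∑ t : Fin k → ℤˣ,
      ∏ j, (if j = i then (if t j = -1 then y (t j) else 0) else y (t j)) = y (-1) := by
    intro i
    have := Finset.prod_univ_sum (fun _ : Fin k => (Finset.univ : Finset ℤˣ))
      (fun j u => if j = i then (if u = -1 then y u else 0) else y u)
    rw [Fintype.piFinset_univ] at this
    rw [← this, ← Finset.mul_prod_erase _ _ (Finset.mem_univ i)]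
    rw [Finset.prod_congr rfl (g := fun _ => (1 : ℝ)) (s₁ := Finset.univ.erase i)]
    · simp
    · intro j hj
      simp only [if_neg (Finset.ne_of_mem_erase hj), sum_units, hy]
  rw [Finset.sum_congr rfl fun i _ => h2 i]
  simp

/-- The law of a single literal that is false with probability `(1 + ε) / 2`. -/
noncomputable def slotWeight (ε : ℝ) (u : ℤˣ) : ℝ := if u = -1 then (1 + ε) / 2 else (1 - ε) / 2

/-- The law of a clause with independent literals of law `slotWeight ε`, reweighted by the Gibbs
weight.  It is normalised, with mean number of false literals `k / 2`, if `ε` solves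
`ε = (1 - exp (-β)) * ((1 + ε) / 2) ^ k`. -/
noncomputable def tiltedLaw (β ε : ℝ) (t : Fin k → ℤˣ) : ℝ :=
  (∏ j, slotWeight ε (t j)) * clauseWeight β t / (1 - ε)

/-- The probability that `m` independent clauses of law `tiltedLaw β ε` are balanced. -/
noncomputable def balancedMass (β ε : ℝ) (m k h : ℕ) : ℝ :=
  ∑ T ∈ balanced m k h, ∏ a, tiltedLaw β ε (T a)

theorem slotWeight_pos {ε : ℝ} (h0 : 0 ≤ ε) (h1 : ε < 1) (u : ℤˣ) : 0 < slotWeight ε u := by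
  unfold slotWeight; split_ifs <;> linarith

theorem slotWeight_add (ε : ℝ) : slotWeight ε 1 + slotWeight ε (-1) = 1 := by
  simp [slotWeight, show (1 : ℤˣ) ≠ -1 by decide]; ring

theorem slotWeight_neg_one (ε : ℝ) : slotWeight ε (-1) = (1 + ε) / 2 := by simp [slotWeight]

theorem tiltedLaw_pos (β : ℝ) {ε : ℝ} (h0 : 0 ≤ ε) (h1 : ε < 1) (t : Fin k → ℤˣ) :
    0 < tiltedLaw β ε t :=
  div_pos (mul_pos (Finset.prod_pos fun j _ => slotWeight_pos h0 h1 _) (clauseWeight_pos β t))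
    (by linarith)

theorem sum_tiltedLaw {β ε : ℝ} (h1 : ε < 1)
    (hfix : ε = (1 - Real.exp (-β)) * ((1 + ε) / 2) ^ k) :
    ∑ t : Fin k → ℤˣ, tiltedLaw β ε t = 1 := by
  unfold tiltedLaw
  rw [← Finset.sum_div, sum_prod_mul_clauseWeight, slotWeight_add, slotWeight_neg_one, ← hfix,
    one_pow, div_self (by linarith)]

/-- The fixed point equation for `ε` makes the tilted clauses balanced on average. -/
theorem sum_tiltedLaw_mul_numFalse {β ε : ℝ} (h1 : ε < 1)
    (hfix : ε = (1 - Real.exp (-β)) * ((1 + ε) / 2) ^ k) :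
    ∑ t : Fin k → ℤˣ, tiltedLaw β ε t * numFalse t = k / 2 := by
  have e1 : ∀ t : Fin k → ℤˣ, tiltedLaw β ε t * numFalse t
      = ((∏ j, slotWeight ε (t j)) * numFalse t
        - k * ((∏ j, slotWeight ε (t j)) - (∏ j, slotWeight ε (t j)) * clauseWeight β t))
          / (1 - ε) := by
    intro t
    unfold tiltedLaw
    by_cases h : ∀ j, t j = -1
    · have : numFalse t = k := by simp [numFalse, h]
      rw [this]; ring
    · have : clauseWeight β t = 1 := by simp only [clauseWeight, if_neg h]
      rw [this]; ring
  rw [Finset.sum_congr rfl fun t _ => e1 t, ← Finset.sum_div, Finset.sum_sub_distrib,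
    ← Finset.mul_sum, Finset.sum_sub_distrib, sum_prod_mul_numFalse _ (slotWeight_add ε),
    sum_prod_mul_clauseWeight, sum_prod_pi (slotWeight ε) k, sum_units, slotWeight_add,
    slotWeight_neg_one, ← hfix]
  have : (1 - ε) ≠ 0 := by linarith
  field_simp
  ring

theorem balancedMass_le_one {β ε : ℝ} (h0 : 0 ≤ ε) (h1 : ε < 1)
    (hfix : ε = (1 - Real.exp (-β)) * ((1 + ε) / 2) ^ k) (m h : ℕ) :
    balancedMass β ε m k h ≤ 1 := by
  refine (Finset.sum_le_univ_sum_of_nonneg fun T =>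
    Finset.prod_nonneg fun a _ => (tiltedLaw_pos β h0 h1 _).le).trans ?_
  rw [sum_prod_pi, sum_tiltedLaw h1 hfix, one_pow]

theorem eventually_exp_le_balancedMass {β ε : ℝ} (h0 : 0 ≤ ε) (h1 : ε < 1) (hk : 0 < k)
    (hd : Even d) (hfix : ε = (1 - Real.exp (-β)) * ((1 + ε) / 2) ^ k) {η : ℝ} (hη : 0 < η) :
    ∀ᶠ n : ℕ in nLimit d k,
      Real.exp (-η * n) ≤ balancedMass β ε (d * n / k) k (n * (d / 2)) := by
  unfold nLimit
  rw [eventually_inf_principal]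
  obtain ⟨r, rfl⟩ := hd
  have hr2 : (r + r) / 2 = r := by omega
  rcases Nat.eq_zero_or_pos r with rfl | hr
  · refine Eventually.of_forall fun n _ => ?_
    have : balancedMass β ε ((0 + 0) * n / k) k (n * ((0 + 0) / 2)) = 1 := by
      have e : (0 + 0) * n / k = 0 := by simp
      rw [e]
      simp [balancedMass, balanced]
    rw [this]
    refine Real.exp_le_one_iff.2 ?_
    have : (0 : ℝ) ≤ n := Nat.cast_nonneg n
    nlinarith
  · have hev := eventually_exp_le_sum_balanced (k := k) (tiltedLaw β ε)
      (tiltedLaw_pos β h0 h1) (sum_tiltedLaw h1 hfix) (sum_tiltedLaw_mul_numFalse h1 hfix)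
      (η := η / (r + r)) (by positivity)
    have htend : Tendsto (fun n : ℕ => (r + r) * n / k) atTop atTop := by
      refine tendsto_atTop.2 fun b => ?_
      filter_upwards [eventually_ge_atTop (b * k)] with n hn
      rw [Nat.le_div_iff_mul_le hk]
      nlinarith
    filter_upwards [htend.eventually hev] with n hn hdvd
    obtain ⟨c, hc⟩ := hdvd
    have hm : (r + r) * n / k = c := by rw [hc, Nat.mul_div_cancel_left _ hk]
    rw [hm] at hn ⊢
    have h2 := hn (n * ((r + r) / 2)) (by rw [hr2, mul_comm c k, ← hc]; ring)
    refine le_trans (Real.exp_le_exp.2 ?_) h2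
    have hcn : c ≤ (r + r) * n := by rw [hc]; exact Nat.le_mul_of_pos_left _ hk
    have hcn' : (c : ℝ) ≤ (r + r) * n := by exact_mod_cast hcn
    have hrr : (0 : ℝ) < r + r := by positivity
    have : η / (r + r) * c ≤ η * n := by
      rw [div_mul_eq_mul_div, div_le_iff₀ hrr]
      nlinarith
    linarith

/-- On balanced patterns the literal weights are constant, so that the tilted law is proportional to
the Gibbs weight. -/
theorem prod_tiltedLaw_of_mem_balanced (β ε : ℝ) {h : ℕ} (hmk : m * k = 2 * h)
    {T : Fin m → Fin k → ℤˣ} (hT : T ∈ balanced m k h) :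
    ∏ a, tiltedLaw β ε (T a)
      = ((1 - ε ^ 2) / 4) ^ h * (∏ a, clauseWeight β (T a)) / (1 - ε) ^ m := by
  have hclause : ∀ t : Fin k → ℤˣ, ∏ j, slotWeight ε (t j)
      = ((1 + ε) / 2) ^ numFalse t * ((1 - ε) / 2) ^ (k - numFalse t) := by
    intro t
    unfold slotWeight
    rw [Finset.prod_ite, Finset.prod_const, Finset.prod_const]
    have := Finset.card_filter_add_card_filter_not (s := (Finset.univ : Finset (Fin k)))
      (fun j => t j = -1)
    rw [Finset.card_univ, Fintype.card_fin] at this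
    have e : (Finset.univ.filter fun j => ¬ t j = -1).card = k - numFalse t := by
      unfold numFalse; omega
    rw [e]; rfl
  have hsum := (Finset.mem_filter.1 hT).2
  have hsum' : ∑ a, (k - numFalse (T a)) = h := by
    have : ∑ a, (k - numFalse (T a)) + ∑ a, numFalse (T a) = m * k := by
      rw [← Finset.sum_add_distrib, Finset.sum_congr rfl (g := fun _ => k)
        (fun a _ => Nat.sub_add_cancel (numFalse_le _))]
      simp
    omega
  unfold tiltedLaw
  rw [Finset.prod_div_distrib, Finset.prod_mul_distrib, Finset.prod_const, Finset.card_univ,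
    Fintype.card_fin, Finset.prod_congr rfl (fun a _ => hclause (T a)), Finset.prod_mul_distrib,
    Finset.prod_pow_eq_pow_sum, Finset.prod_pow_eq_pow_sum, hsum, hsum', ← mul_pow]
  congr 3
  ring

theorem two_mul_half (hd : Even d) (hN : m * k = n * d) : m * k = 2 * (n * (d / 2)) := by
  obtain ⟨r, rfl⟩ := hd
  have : (r + r) / 2 = r := by omega
  rw [hN, this]; ring

/-- Sums over formulas as averages over the tilted law conditioned on being balanced. -/
theorem sum_weight_mul_pattern (hd : Even d) (hN : m * k = n * d) {β ε : ℝ} (h0 : 0 ≤ ε)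
    (h1 : ε < 1) (σ : Assignment n) (H : (Fin m → Fin k → ℤˣ) → ℝ) :
    ∑ Φ : Formula n d m k, weight β Φ σ * H (pattern σ Φ)
      = ((n * (d / 2)).factorial : ℝ) ^ 2 * ((1 - ε) ^ m / ((1 - ε ^ 2) / 4) ^ (n * (d / 2))) *
        ∑ T ∈ balanced m k (n * (d / 2)), (∏ a, tiltedLaw β ε (T a)) * H T := by
  have hpos : 0 < (1 - ε ^ 2) / 4 := by nlinarith
  have hpos2 : 0 < 1 - ε := by linarith
  simp only [weight_eq_prod]
  rw [sum_pattern hd hN σ (fun T => (∏ a, clauseWeight β (T a)) * H T), mul_assoc, Finset.mul_sum,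
    Finset.mul_sum, Finset.mul_sum]
  refine Finset.sum_congr rfl fun T hT => ?_
  rw [prod_tiltedLaw_of_mem_balanced β ε (two_mul_half hd hN) hT]
  field_simp

theorem sum_weight (hd : Even d) (hN : m * k = n * d) {β ε : ℝ} (h0 : 0 ≤ ε)
    (h1 : ε < 1) (σ : Assignment n) :
    ∑ Φ : Formula n d m k, weight β Φ σ
      = ((n * (d / 2)).factorial : ℝ) ^ 2 * ((1 - ε) ^ m / ((1 - ε ^ 2) / 4) ^ (n * (d / 2))) *
        balancedMass β ε m k (n * (d / 2)) := by
  have := sum_weight_mul_pattern hd hN (β := β) h0 h1 σ (fun _ => 1)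
  simpa [balancedMass] using this

theorem expect_weight (hd : Even d) (hN : m * k = n * d) {β ε : ℝ} (h0 : 0 ≤ ε)
    (h1 : ε < 1) (σ : Assignment n) :
    expect (fun Φ : Formula n d m k => weight β Φ σ)
      = (4 ^ (n * (d / 2)) / ((n * (d / 2)).centralBinom : ℝ)) *
        ((1 - ε) ^ m / (1 - ε ^ 2) ^ (n * (d / 2))) * balancedMass β ε m k (n * (d / 2)) := by
  unfold expect
  have h2 : n * d = 2 * (n * (d / 2)) := by rw [← two_mul_half hd hN, hN]
  rw [sum_weight hd hN h0 h1, card_formula hN, h2]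
  set h := n * (d / 2)
  have hc : ((2 * h).factorial : ℝ) = h.centralBinom * (h.factorial : ℝ) ^ 2 := by
    have := Nat.choose_mul_factorial_mul_factorial (n := 2 * h) (k := h) (by omega)
    have e : 2 * h - h = h := by omega
    rw [e, ← Nat.centralBinom_eq_two_mul_choose] at this
    rw [← this]; push_cast; ring
  have hf : (h.factorial : ℝ) ≠ 0 := by exact_mod_cast h.factorial_ne_zero
  have hcb : (h.centralBinom : ℝ) ≠ 0 := by exact_mod_cast h.centralBinom_ne_zero
  have hpos : 0 < (1 - ε ^ 2) := by nlinarith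
  rw [hc, div_pow]
  field_simp

theorem four_pow_div_centralBinom (h : ℕ) :
    1 ≤ (4 : ℝ) ^ h / h.centralBinom ∧ (4 : ℝ) ^ h / h.centralBinom ≤ 2 * h + 1 := by
  have hcb : (0 : ℝ) < h.centralBinom := by exact_mod_cast h.centralBinom_pos
  constructor
  · rw [le_div_iff₀ hcb, one_mul]
    exact_mod_cast h.centralBinom_le_four_pow
  · rw [div_le_iff₀ hcb]
    rcases Nat.eq_zero_or_pos h with rfl | hh
    · simp
    · have := Nat.four_pow_le_two_mul_self_mul_centralBinom h hh
      have : (4 : ℝ) ^ h ≤ 2 * h * h.centralBinom := by exact_mod_cast this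
      linarith

theorem expect_partitionFunction (β : ℝ) :
    expect (fun Φ : Formula n d m k => partitionFunction β Φ)
      = ∑ σ : Assignment n, expect (fun Φ : Formula n d m k => weight β Φ σ) := by
  unfold expect partitionFunction
  rw [Finset.sum_comm, Finset.sum_div]

/-- The value of the annealed free energy, in terms of the fixed point `ε`. -/
noncomputable def annealedValue (d k : ℕ) (ε : ℝ) : ℝ :=
  Real.log 2 + (d : ℝ) / k * Real.log (1 - ε) - (d : ℝ) / 2 * Real.log (1 - ε ^ 2)

theorem exp_annealedValue (hk : 0 < k) (hd : Even d) (hN : m * k = n * d) {ε : ℝ}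
    (h0 : 0 ≤ ε) (h1 : ε < 1) :
    Real.exp (annealedValue d k ε * n)
      = 2 ^ n * ((1 - ε) ^ m / (1 - ε ^ 2) ^ (n * (d / 2))) := by
  have hk' : (k : ℝ) ≠ 0 := by positivity
  have hN' : (m : ℝ) * k = n * d := by exact_mod_cast hN
  have hm : (d : ℝ) / k * n = m := by field_simp; linarith
  have hh : (d : ℝ) / 2 * n = (n * (d / 2) : ℕ) := by
    obtain ⟨r, rfl⟩ := hd
    have : (r + r) / 2 = r := by omega
    rw [this]; push_cast; ring
  have hpos : 0 < (1 - ε ^ 2) := by nlinarith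
  have e : annealedValue d k ε * n = n * Real.log 2 + m * Real.log (1 - ε)
      - (n * (d / 2) : ℕ) * Real.log (1 - ε ^ 2) := by
    unfold annealedValue
    rw [← hm, ← hh]; ring
  rw [e, Real.exp_sub, Real.exp_add, Real.exp_nat_mul, Real.exp_nat_mul, Real.exp_nat_mul,
    Real.exp_log two_pos, Real.exp_log (by linarith), Real.exp_log hpos, mul_div_assoc]

theorem balancedMass_nonneg (β : ℝ) {ε : ℝ} (h0 : 0 ≤ ε) (h1 : ε < 1) (m k h : ℕ) :
    0 ≤ balancedMass β ε m k h :=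
  Finset.sum_nonneg fun _ _ => Finset.prod_nonneg fun _ _ => (tiltedLaw_pos β h0 h1 _).le

theorem expect_partitionFunction_eq (hk : 0 < k) (hd : Even d) (hN : m * k = n * d) {β ε : ℝ}
    (h0 : 0 ≤ ε) (h1 : ε < 1) :
    expect (fun Φ : Formula n d m k => partitionFunction β Φ)
      = (4 ^ (n * (d / 2)) / ((n * (d / 2)).centralBinom : ℝ)) *
        Real.exp (annealedValue d k ε * n) * balancedMass β ε m k (n * (d / 2)) := by
  rw [expect_partitionFunction, Finset.sum_congr rfl fun σ _ => expect_weight hd hN h0 h1 σ,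
    Finset.sum_const, exp_annealedValue hk hd hN h0 h1, nsmul_eq_mul, Finset.card_univ]
  have : (Fintype.card (Assignment n) : ℝ) = 2 ^ n := by simp
  rw [this]; ring

theorem le_expect_partitionFunction (hk : 0 < k) (hd : Even d) (hN : m * k = n * d) {β ε : ℝ}
    (h0 : 0 ≤ ε) (h1 : ε < 1) :
    Real.exp (annealedValue d k ε * n) * balancedMass β ε m k (n * (d / 2))
      ≤ expect (fun Φ : Formula n d m k => partitionFunction β Φ) := by
  rw [expect_partitionFunction_eq hk hd hN h0 h1, mul_assoc]
  exact le_mul_of_one_le_left (mul_nonneg (Real.exp_pos _).le (balancedMass_nonneg β h0 h1 _ _ _))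
    (four_pow_div_centralBinom _).1

theorem expect_partitionFunction_le (hk : 0 < k) (hd : Even d) (hN : m * k = n * d) {β ε : ℝ}
    (h0 : 0 ≤ ε) (h1 : ε < 1) (hfix : ε = (1 - Real.exp (-β)) * ((1 + ε) / 2) ^ k) :
    expect (fun Φ : Formula n d m k => partitionFunction β Φ)
      ≤ (n * d + 1) * Real.exp (annealedValue d k ε * n) := by
  rw [expect_partitionFunction_eq hk hd hN h0 h1]
  have h2 := (four_pow_div_centralBinom (n * (d / 2))).2
  have e : (2 : ℝ) * (n * (d / 2) : ℕ) = n * d := by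
    exact_mod_cast (two_mul_half hd hN).symm.trans hN
  rw [e] at h2
  have h3 := balancedMass_le_one h0 h1 hfix m (n * (d / 2))
  calc _ ≤ (4 ^ (n * (d / 2)) / ((n * (d / 2)).centralBinom : ℝ)) *
        Real.exp (annealedValue d k ε * n) * 1 := by
        refine mul_le_mul_of_nonneg_left h3 (by positivity)
    _ ≤ _ := by
        rw [mul_one]
        exact mul_le_mul_of_nonneg_right h2 (Real.exp_pos _).le

theorem eventually_poly_le_exp (A : ℝ) (p : ℕ) {η : ℝ} (hη : 0 < η) :
    ∀ᶠ n : ℕ in atTop, (A * (n + 1)) ^ p ≤ Real.exp (η * n) := by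
  have := (isLittleO_pow_exp_pos_mul_atTop (k := p) (b := η) hη).bound
    (c := (1 / (2 * |A| + 1) ^ p)) (by positivity)
  have h2 := tendsto_natCast_atTop_atTop (R := ℝ) |>.eventually this
  filter_upwards [h2, eventually_ge_atTop 1] with n hn hn1
  have hn1' : (1 : ℝ) ≤ n := by exact_mod_cast hn1
  rw [Real.norm_of_nonneg (by positivity), Real.norm_of_nonneg (Real.exp_pos _).le,
    div_mul_eq_mul_div, one_mul, le_div_iff₀ (by positivity), ← mul_pow] at hn
  refine le_trans ?_ hn
  refine (le_abs_self _).trans ?_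
  rw [abs_pow]
  refine pow_le_pow_left₀ (abs_nonneg _) ?_ p
  rw [abs_mul, abs_of_nonneg (by positivity : (0 : ℝ) ≤ n + 1)]
  have := abs_nonneg A
  nlinarith

theorem mul_eq_of_dvd (hdvd : k ∣ d * n) : d * n / k * k = n * d := by
  rw [Nat.div_mul_cancel hdvd, mul_comm]

theorem eventually_nLimit {P : ℕ → Prop} (h : ∀ᶠ n in atTop, P n) :
    ∀ᶠ n in nLimit d k, P n := h.filter_mono inf_le_left

theorem eventually_dvd : ∀ᶠ n in nLimit d k, k ∣ d * n :=
  (mem_inf_of_right (mem_principal_self _) : {n | k ∣ d * n} ∈ nLimit d k)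

theorem nLimit_neBot (hk : 0 < k) : (nLimit d k).NeBot := by
  unfold nLimit
  rw [← frequently_mem_iff_neBot, frequently_atTop]
  intro a
  exact ⟨k * (a + 1), by nlinarith, Dvd.intro_left (d * (a + 1)) (by ring)⟩

theorem tendsto_annealedRate (hk : 0 < k) (hd : Even d) {β ε : ℝ} (h0 : 0 ≤ ε) (h1 : ε < 1)
    (hfix : ε = (1 - Real.exp (-β)) * ((1 + ε) / 2) ^ k) :
    Tendsto (annealedRate d k β) (nLimit d k) (𝓝 (annealedValue d k ε)) := by
  set a := annealedValue d k ε with ha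
  rw [Metric.tendsto_nhds]
  intro η hη
  have hpoly := eventually_nLimit (d := d) (k := k)
    (eventually_poly_le_exp (d + 1) 1 (half_pos hη))
  filter_upwards [eventually_exp_le_balancedMass h0 h1 hk hd hfix (half_pos hη), hpoly,
    eventually_dvd, eventually_nLimit (eventually_ge_atTop 1)] with n hmass hpol hdvd hn1
  have hN := mul_eq_of_dvd hdvd
  have hn : (1 : ℝ) ≤ n := by exact_mod_cast hn1
  have hlow := le_expect_partitionFunction hk hd hN (β := β) h0 h1
  have hupp := expect_partitionFunction_le hk hd hN h0 h1 hfix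
  rw [← ha] at hlow hupp
  set X := expect (fun Φ : Formula n d (d * n / k) k => partitionFunction β Φ) with hX
  have hlow' : Real.exp ((a - η / 2) * n) ≤ X := by
    refine le_trans ?_ hlow
    have : (a - η / 2) * n = a * n + -(η / 2) * n := by ring
    rw [this, Real.exp_add]
    exact mul_le_mul_of_nonneg_left hmass (Real.exp_pos _).le
  have hupp' : X ≤ Real.exp ((a + η / 2) * n) := by
    refine hupp.trans ?_
    have : (a + η / 2) * n = η / 2 * n + a * n := by ring
    rw [this, Real.exp_add]
    refine mul_le_mul_of_nonneg_right ?_ (Real.exp_pos _).le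
    refine le_trans ?_ hpol
    rw [pow_one]
    have : (0 : ℝ) ≤ d := Nat.cast_nonneg d
    nlinarith
  have hXpos : 0 < X := (Real.exp_pos _).trans_le hlow'
  have l1 : (a - η / 2) * n ≤ Real.log X := (Real.le_log_iff_exp_le hXpos).2 hlow'
  have l2 : Real.log X ≤ (a + η / 2) * n := (Real.log_le_iff_le_exp hXpos).2 hupp'
  have e : annealedRate d k β n = Real.log X / n := rfl
  rw [e, Real.dist_eq]
  have hn0 : (0 : ℝ) < n := by linarith
  have b1 : a - η / 2 ≤ Real.log X / n := by rw [le_div_iff₀ hn0]; exact l1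
  have b2 : Real.log X / n ≤ a + η / 2 := by rw [div_le_iff₀ hn0]; exact l2
  rw [abs_lt]; constructor <;> linarith

end RegKSAT

/-! ### Concentration for random bijections -/

section Bijections

variable {V S : Type*} [DecidableEq V]

/-- The average of `f` over the bijections obtained from `Φ` by permuting the points of `V` that
satisfy `p`. -/
noncomputable def permAverage [Fintype V] (p : V → Prop) [DecidablePred p]
    (f : (V ≃ S) → ℝ) (Φ : V ≃ S) : ℝ :=
  (∑ g : Equiv.Perm {v // p v}, f ((Equiv.Perm.ofSubtype g).trans Φ))
    / (Fintype.card {v // p v}).factorial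

theorem swap_trans_equiv [DecidableEq S] (Φ : V ≃ S) (g : Equiv.Perm V) (x y : V) :
    (Equiv.swap x y * g).trans Φ = (g.trans Φ).trans (Equiv.swap (Φ x) (Φ y)) := by
  ext v
  simp only [Equiv.trans_apply, Equiv.Perm.mul_apply]
  exact Φ.injective.map_swap _ _ _

theorem permAverage_lipschitz [Fintype V] [DecidableEq S] (p : V → Prop)
    [DecidablePred p] {f : (V ≃ S) → ℝ} {c : ℝ}
    (hf : ∀ Φ x y, |f (Φ.trans (Equiv.swap x y)) - f Φ| ≤ c) (Φ : V ≃ S) (x y : S) :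
    |permAverage p f (Φ.trans (Equiv.swap x y)) - permAverage p f Φ| ≤ c := by
  have hpos : (0 : ℝ) < ((Fintype.card {v // p v}).factorial : ℕ) := by
    exact_mod_cast Nat.factorial_pos _
  unfold permAverage
  rw [← sub_div, ← Finset.sum_sub_distrib, abs_div, Nat.abs_cast, div_le_iff₀ hpos]
  refine (Finset.abs_sum_le_sum_abs _ _).trans ?_
  calc _ ≤ ∑ _g : Equiv.Perm {v // p v}, c :=
        Finset.sum_le_sum fun g _ => hf ((Equiv.Perm.ofSubtype g).trans Φ) x y
    _ = _ := by rw [Finset.sum_const, Finset.card_univ, Fintype.card_perm, nsmul_eq_mul, mul_comm]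

theorem exp_permAverage_le [Fintype V] [DecidableEq S] (p : V → Prop)
    [DecidablePred p] {f : (V ≃ S) → ℝ} {c : ℝ}
    (hf : ∀ Φ x y, |f (Φ.trans (Equiv.swap x y)) - f Φ| ≤ c) (Φ : V ≃ S) :
    permAverage p (fun Ψ => Real.exp (f Ψ)) Φ
      ≤ Real.exp (2 * Fintype.card V * c ^ 2) * Real.exp (permAverage p f Φ) := by
  have hpos : (0 : ℝ) < ((Fintype.card {v // p v}).factorial : ℕ) := by
    exact_mod_cast Nat.factorial_pos _
  have h := sum_perm_exp_le {v // p v} (c := c)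
    (fun g => f ((Equiv.Perm.ofSubtype g).trans Φ)) (by
      intro x y π
      rw [map_mul, Equiv.Perm.ofSubtype_swap_eq, swap_trans_equiv]
      exact hf _ _ _)
  unfold permAverage
  rw [div_le_iff₀ hpos, ← Real.exp_add]
  refine h.trans ?_
  rw [mul_comm]
  refine mul_le_mul_of_nonneg_right (Real.exp_le_exp.2 ?_) hpos.le
  rw [add_comm]
  have h1 : ((Fintype.card {v // p v} : ℕ) : ℝ) ≤ Fintype.card V := by
    exact_mod_cast Fintype.card_subtype_le _
  have := mul_le_mul_of_nonneg_right h1 (sq_nonneg c)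
  linarith

theorem sum_mul_permAverage [Fintype V] [Fintype S] [DecidableEq S] (p : V → Prop)
    [DecidablePred p] (w f : (V ≃ S) → ℝ)
    (hw : ∀ (g : Equiv.Perm {v // p v}) Φ, w ((Equiv.Perm.ofSubtype g).trans Φ) = w Φ) :
    ∑ Φ, w Φ * permAverage p f Φ = ∑ Φ, w Φ * f Φ := by
  have hpos : ((Fintype.card {v // p v}).factorial : ℝ) ≠ 0 := by
    exact_mod_cast Nat.factorial_ne_zero _
  have h1 : ∀ g : Equiv.Perm {v // p v},
      ∑ Φ, w Φ * f ((Equiv.Perm.ofSubtype g).trans Φ) = ∑ Φ, w Φ * f Φ := by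
    intro g
    refine Fintype.sum_equiv
      ((Equiv.equivCongr (Equiv.Perm.ofSubtype g).symm (Equiv.refl S))) _ _ fun Φ => ?_
    rw [← hw g Φ]
    rfl
  unfold permAverage
  simp only [mul_div_assoc', Finset.mul_sum]
  rw [← Finset.sum_div, Finset.sum_comm, Finset.sum_congr rfl fun g _ => h1 g, Finset.sum_const,
    Finset.card_univ, Fintype.card_perm, nsmul_eq_mul]
  field_simp

theorem sum_mul_exp_le_permAverage [Fintype V] [Fintype S] [DecidableEq S] (p : V → Prop)
    [DecidablePred p] {w f : (V ≃ S) → ℝ} {c : ℝ}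
    (hw0 : ∀ Φ, 0 ≤ w Φ)
    (hw : ∀ (g : Equiv.Perm {v // p v}) Φ, w ((Equiv.Perm.ofSubtype g).trans Φ) = w Φ)
    (hf : ∀ Φ x y, |f (Φ.trans (Equiv.swap x y)) - f Φ| ≤ c) :
    ∑ Φ, w Φ * Real.exp (f Φ)
      ≤ Real.exp (2 * Fintype.card V * c ^ 2) * ∑ Φ, w Φ * Real.exp (permAverage p f Φ) := by
  rw [← sum_mul_permAverage p w (fun Φ => Real.exp (f Φ)) hw, Finset.mul_sum]
  refine Finset.sum_le_sum fun Φ _ => ?_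
  rw [mul_left_comm]
  exact mul_le_mul_of_nonneg_left (exp_permAverage_le p hf Φ) (hw0 Φ)

theorem permAverage_ofSubtype_trans [Fintype V] (p : V → Prop) [DecidablePred p] (f : (V ≃ S) → ℝ)
    (g : Equiv.Perm {v // p v}) (Φ : V ≃ S) :
    permAverage p f ((Equiv.Perm.ofSubtype g).trans Φ) = permAverage p f Φ := by
  unfold permAverage
  congr 1
  refine Fintype.sum_equiv (Equiv.mulLeft g) _ _ fun h => ?_
  rw [Equiv.coe_mulLeft, map_mul]
  rfl

/-- Averaging over the permutations of a set and over those of its complement yields a function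
that is invariant under all permutations preserving the set. -/
theorem permAverage_permAverage_trans [Fintype V] (p : V → Prop) [DecidablePred p] (f : (V ≃ S) → ℝ)
    (h : Equiv.Perm V) (hp : ∀ v, p (h v) ↔ p v) (Φ : V ≃ S) :
    permAverage p (permAverage (fun v => ¬ p v) f) (h.trans Φ)
      = permAverage p (permAverage (fun v => ¬ p v) f) Φ := by
  set F := permAverage (fun v => ¬ p v) f with hF
  set h1 : Equiv.Perm {v // p v} := h.subtypePerm hp with hh1
  set h2 : Equiv.Perm {v // ¬ p v} := h.subtypePerm (fun v => not_congr (hp v)) with hh2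
  have hdec : h = Equiv.Perm.ofSubtype h2 * Equiv.Perm.ofSubtype h1 := by
    ext v
    by_cases hv : p v
    · rw [Equiv.Perm.mul_apply, Equiv.Perm.ofSubtype_apply_of_mem h1 hv]
      rw [Equiv.Perm.ofSubtype_apply_of_not_mem]
      · rfl
      · exact not_not.2 ((hp v).2 hv)
    · rw [Equiv.Perm.mul_apply, Equiv.Perm.ofSubtype_apply_of_not_mem h1 hv,
        Equiv.Perm.ofSubtype_apply_of_mem h2 hv]
      rfl
  have hcomm : ∀ g : Equiv.Perm {v // p v}, Equiv.Perm.ofSubtype h2 * Equiv.Perm.ofSubtype g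
      = Equiv.Perm.ofSubtype g * Equiv.Perm.ofSubtype h2 := by
    intro g
    refine Equiv.Perm.Disjoint.commute fun v => ?_
    by_cases hv : p v
    · exact Or.inl (Equiv.Perm.ofSubtype_apply_of_not_mem h2 (not_not.2 hv))
    · exact Or.inr (Equiv.Perm.ofSubtype_apply_of_not_mem g hv)
  unfold permAverage
  congr 1
  refine Fintype.sum_equiv (Equiv.mulLeft h1) _ _ fun g => ?_
  change F ((h * Equiv.Perm.ofSubtype g).trans Φ) = F ((Equiv.Perm.ofSubtype (h1 * g)).trans Φ)
  rw [hdec, mul_assoc, ← map_mul, hcomm]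
  exact permAverage_ofSubtype_trans (fun v => ¬ p v) f h2 ((Equiv.Perm.ofSubtype (h1 * g)).trans Φ)

end Bijections

/-- A function of bijections that is Lipschitz under transpositions and depends on the induced
colouring only is Lipschitz for the Hamming distance of colourings. -/
theorem le_add_hamming {V S : Type*} [Fintype V] [Fintype S] [DecidableEq S] {Γ : Type*}
    [DecidableEq Γ] (col : V → Γ) {F : (V ≃ S) → ℝ} {c : ℝ}
    (hF : ∀ Φ x y, |F (Φ.trans (Equiv.swap x y)) - F Φ| ≤ c)
    (hinv : ∀ h : Equiv.Perm V, (∀ v, col (h v) = col v) → ∀ Φ, F (h.trans Φ) = F Φ)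
    (hc : 0 ≤ c) (Φ Φ' : V ≃ S) :
    F Φ ≤ F Φ' + c * (Finset.univ.filter fun s => col (Φ.symm s) ≠ col (Φ'.symm s)).card := by
  induction hN : (Finset.univ.filter fun s => col (Φ.symm s) ≠ col (Φ'.symm s)).card
    using Nat.strong_induction_on generalizing Φ with
  | _ N ih =>
    by_cases hz : ∀ s, col (Φ.symm s) = col (Φ'.symm s)
    · have h1 := hinv (Φ.trans Φ'.symm) (fun v => by
        have := hz (Φ v)
        simpa using this.symm) Φ'
      have h2 : (Φ.trans Φ'.symm).trans Φ' = Φ := by ext v; simp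
      rw [h2] at h1
      rw [h1]
      have : 0 ≤ c * (N : ℝ) := by positivity
      linarith
    · push Not at hz
      obtain ⟨s, hs⟩ := hz
      obtain ⟨s', hs1, hs2⟩ : ∃ s', col (Φ'.symm s') = col (Φ.symm s) ∧
          col (Φ.symm s') ≠ col (Φ.symm s) := by
        by_contra hcon
        push Not at hcon
        have hsub : (Finset.univ.filter fun x => col (Φ'.symm x) = col (Φ.symm s))
            ⊆ Finset.univ.filter fun x => col (Φ.symm x) = col (Φ.symm s) := by
          intro x hx
          simp only [Finset.mem_filter, Finset.mem_univ, true_and] at hx ⊢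
          exact hcon x hx
        have hcard : ∀ Ψ : V ≃ S, (Finset.univ.filter fun x => col (Ψ.symm x) = col (Φ.symm s)).card
            = (Finset.univ.filter fun v => col v = col (Φ.symm s)).card := fun Ψ =>
          Finset.card_equiv Ψ.symm fun x => by simp
        have heq := Finset.eq_of_subset_of_card_le hsub (by rw [hcard, hcard])
        have hmem : s ∈ Finset.univ.filter fun x => col (Φ'.symm x) = col (Φ.symm s) := by
          rw [heq]; simp
        exact hs (Finset.mem_filter.1 hmem).2.symm
      set Ψ := Φ.trans (Equiv.swap s s') with hΨ
      have hΨs : ∀ x, Ψ.symm x = Φ.symm (Equiv.swap s s' x) := fun x => by simp [hΨ]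
      have hlt : (Finset.univ.filter fun x => col (Ψ.symm x) ≠ col (Φ'.symm x)).card < N := by
        rw [← hN]
        refine Finset.card_lt_card ⟨?_, ?_⟩
        · intro x hx
          simp only [Finset.mem_filter, Finset.mem_univ, true_and, hΨs] at hx ⊢
          by_cases h1 : x = s
          · subst h1; exact hs
          by_cases h2 : x = s'
          · subst h2; rw [Equiv.swap_apply_right] at hx; exact absurd hs1.symm hx
          rwa [Equiv.swap_apply_of_ne_of_ne h1 h2] at hx
        · intro hsub
          have h1 : s' ∈ Finset.univ.filter fun x => col (Φ.symm x) ≠ col (Φ'.symm x) := by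
            simp only [Finset.mem_filter, Finset.mem_univ, true_and, hs1]
            exact hs2
          have h2 := (Finset.mem_filter.1 (hsub h1)).2
          rw [hΨs, Equiv.swap_apply_right] at h2
          exact h2 hs1.symm
      have h1 := ih _ hlt Ψ rfl
      have h2 := (abs_le.1 (hF Φ s s')).1
      have h3 : ((Finset.univ.filter fun x => col (Ψ.symm x) ≠ col (Φ'.symm x)).card : ℝ) + 1
          ≤ N := by exact_mod_cast hlt
      have h4 := mul_le_mul_of_nonneg_left h3 hc
      rw [← hΨ] at h2
      linarith

namespace RegKSAT

variable {n d m k : ℕ}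

/-- Exponential moment of a function of the uniformly random formula that changes by at most `c`
when two clause clones are exchanged. -/
theorem expect_exp_le (hN : m * k = n * d) {f : Formula n d m k → ℝ} {c : ℝ}
    (hf : ∀ Φ x y, |f (Φ.trans (Equiv.swap x y)) - f Φ| ≤ c) :
    expect (fun Φ => Real.exp (f Φ)) ≤ Real.exp (expect f + 2 * (n * d) * c ^ 2) := by
  have Φ₀ : Formula n d m k := Fintype.equivOfCardEq (by simp [hN])
  have h := sum_perm_exp_le (Fin m × Fin k) (c := c) (fun π => f (Φ₀.trans π))
    (fun x y π => hf (Φ₀.trans π) x y)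
  have hsum : ∀ g : Formula n d m k → ℝ, ∑ π : Equiv.Perm (Fin m × Fin k), g (Φ₀.trans π)
      = ∑ Φ, g Φ := by
    intro g
    exact Fintype.sum_equiv (Equiv.equivCongr Φ₀.symm (Equiv.refl _)) _ _ fun π => rfl
  rw [hsum (fun Φ => Real.exp (f Φ)), hsum f] at h
  have hc : Fintype.card (Fin m × Fin k) = n * d := by simp [hN]
  rw [hc] at h
  have hpos : (0 : ℝ) < ((n * d).factorial : ℕ) := by exact_mod_cast Nat.factorial_pos _
  unfold expect
  rw [card_formula hN, div_le_iff₀ hpos]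
  refine h.trans (le_of_eq ?_)
  push_cast
  ring

/-- Exponential moment of a Lipschitz function in the planted model with planted assignment `σ`.
Averaging over the bijections with a given pattern leaves a function of the pattern, which is
extended from the balanced patterns to a Lipschitz function of all patterns; there the clauses are
independent, and the conditioning on balanced patterns costs a factor `balancedMass` twice. -/
theorem sum_weight_mul_exp_le (hd : Even d) (hN : m * k = n * d) {β ε : ℝ} (h0 : 0 ≤ ε)
    (h1 : ε < 1) (hfix : ε = (1 - Real.exp (-β)) * ((1 + ε) / 2) ^ k) (σ : Assignment n)
    {f : Formula n d m k → ℝ} {c : ℝ} (hc : 0 ≤ c)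
    (hf : ∀ Φ x y, |f (Φ.trans (Equiv.swap x y)) - f Φ| ≤ c)
    (hP : 0 < balancedMass β ε m k (n * (d / 2))) :
    balancedMass β ε m k (n * (d / 2)) ^ 2 * ∑ Φ, weight β Φ σ * Real.exp (f Φ)
      ≤ (∑ Φ : Formula n d m k, weight β Φ σ) *
        Real.exp ((∑ Φ, weight β Φ σ * f Φ) / (∑ Φ : Formula n d m k, weight β Φ σ)
          + (n * d) * (4 + k) * c ^ 2) := by
  classical
  have Φ₀ : Formula n d m k := Fintype.equivOfCardEq (by simp [hN])
  set P := balancedMass β ε m k (n * (d / 2)) with hPdef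
  set W := ∑ Φ : Formula n d m k, weight β Φ σ with hW
  have hW0 : 0 < W := Finset.sum_pos (fun Φ _ => Real.exp_pos _) ⟨Φ₀, Finset.mem_univ _⟩
  set p : Fin n × Fin d → Prop := fun v => literalValue σ v = -1 with hp
  have hwpat : ∀ Φ Ψ : Formula n d m k, pattern σ Φ = pattern σ Ψ →
      weight β Φ σ = weight β Ψ σ := fun Φ Ψ h => by rw [weight_eq_prod, weight_eq_prod, h]
  have hlit : ∀ (h : Equiv.Perm (Fin n × Fin d)), (∀ v, p (h v) ↔ p v) → ∀ v,
      literalValue σ (h v) = literalValue σ v := by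
    intro h hh v
    have := hh v
    simp only [hp] at this
    rcases Int.units_eq_one_or (literalValue σ (h v)) with e | e <;>
      rcases Int.units_eq_one_or (literalValue σ v) with e' | e' <;>
      rw [e, e'] at this ⊢ <;> simp at this
  have hpattrans : ∀ (h : Equiv.Perm (Fin n × Fin d)), (∀ v, p (h v) ↔ p v) →
      ∀ Φ : Formula n d m k, pattern σ (h.trans Φ) = pattern σ Φ := by
    intro h hh Φ
    funext a j
    have := hlit h hh (h.symm (Φ.symm (a, j)))
    rw [Equiv.apply_symm_apply] at this
    exact this.symm
  have hof : ∀ (q : Fin n × Fin d → Prop) [DecidablePred q], (q = p ∨ q = fun v => ¬ p v) →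
      ∀ (g : Equiv.Perm {v // q v}) v, p (Equiv.Perm.ofSubtype g v) ↔ p v := by
    intro q _ hq g v
    by_cases hv : q v
    · have h2 : q (Equiv.Perm.ofSubtype g v) := by
        rw [Equiv.Perm.ofSubtype_apply_of_mem g hv]; exact (g ⟨v, hv⟩).2
      rcases hq with rfl | rfl
      · exact iff_of_true h2 hv
      · exact iff_of_false h2 hv
    · rw [Equiv.Perm.ofSubtype_apply_of_not_mem g hv]
  set F1 := permAverage (fun v => ¬ p v) f with hF1
  set F := permAverage p F1 with hFdef
  have hF1lip := permAverage_lipschitz (fun v => ¬ p v) hf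
  have hFlip : ∀ Φ x y, |F (Φ.trans (Equiv.swap x y)) - F Φ| ≤ c :=
    permAverage_lipschitz p hF1lip
  have hw2 : ∀ (g : Equiv.Perm {v // ¬ p v}) (Φ : Formula n d m k),
      weight β ((Equiv.Perm.ofSubtype g).trans Φ) σ = weight β Φ σ := fun g Φ =>
    hwpat _ _ (hpattrans _ (hof (fun v => ¬ p v) (Or.inr rfl) g) Φ)
  have hw1 : ∀ (g : Equiv.Perm {v // p v}) (Φ : Formula n d m k),
      weight β ((Equiv.Perm.ofSubtype g).trans Φ) σ = weight β Φ σ := fun g Φ =>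
    hwpat _ _ (hpattrans _ (hof p (Or.inl rfl) g) Φ)
  have hw0 : ∀ Φ : Formula n d m k, 0 ≤ weight β Φ σ := fun Φ => (Real.exp_pos _).le
  have hcardV : (Fintype.card (Fin n × Fin d) : ℝ) = n * d := by simp
  have hstep1 : ∑ Φ : Formula n d m k, weight β Φ σ * Real.exp (f Φ)
      ≤ Real.exp (4 * (n * d) * c ^ 2) * ∑ Φ, weight β Φ σ * Real.exp (F Φ) := by
    have a1 := sum_mul_exp_le_permAverage (fun v => ¬ p v) hw0 hw2 hf
    have a2 := sum_mul_exp_le_permAverage p hw0 hw1 hF1lip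
    rw [hcardV] at a1 a2
    refine a1.trans ((mul_le_mul_of_nonneg_left a2 (Real.exp_pos _).le).trans (le_of_eq ?_))
    rw [← mul_assoc, ← Real.exp_add]
    congr 2
    ring
  have hmean : ∑ Φ : Formula n d m k, weight β Φ σ * F Φ = ∑ Φ, weight β Φ σ * f Φ := by
    rw [hFdef, sum_mul_permAverage p _ _ hw1, hF1, sum_mul_permAverage (fun v => ¬ p v) _ _ hw2]
  -- the McShane extension of `F` to all patterns
  set D : Formula n d m k → (Fin m → Fin k → ℤˣ) → ℝ := fun Φ T =>
    ∑ a, ((Finset.univ.filter fun j => pattern σ Φ a j ≠ T a j).card : ℝ) with hD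
  set G : (Fin m → Fin k → ℤˣ) → ℝ := fun T =>
    Finset.univ.inf' ⟨Φ₀, Finset.mem_univ _⟩ fun Φ => F Φ + c * D Φ T with hG
  have hFG : ∀ Φ, G (pattern σ Φ) = F Φ := by
    intro Φ
    refine le_antisymm ?_ ?_
    · refine (Finset.inf'_le _ (Finset.mem_univ Φ)).trans (le_of_eq ?_)
      simp [hD]
    · refine Finset.le_inf' _ _ fun Ψ _ => ?_
      have := le_add_hamming (literalValue σ) hFlip (fun h hh Φ =>
        permAverage_permAverage_trans p f h (fun v => by simp only [hp, hh v]) Φ) hc Φ Ψ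
      refine this.trans (le_of_eq ?_)
      congr 2
      simp only [hD, Finset.card_filter]
      push_cast
      rw [Fintype.sum_prod_type]
      refine Finset.sum_congr rfl fun a _ => Finset.sum_congr rfl fun j _ => ?_
      simp only [pattern, ne_comm]
  have hGle : ∀ (a : Fin m) (T T' : Fin m → Fin k → ℤˣ), (∀ b, b ≠ a → T b = T' b) →
      G T ≤ G T' + c * k := by
    intro a T T' h
    rw [← sub_le_iff_le_add]
    refine Finset.le_inf' _ _ fun Φ _ => ?_
    rw [sub_le_iff_le_add]
    refine (Finset.inf'_le _ (Finset.mem_univ Φ)).trans ?_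
    have : D Φ T ≤ D Φ T' + k := by
      simp only [hD]
      rw [← Finset.add_sum_erase _ _ (Finset.mem_univ a),
        ← Finset.add_sum_erase _ (fun a => ((Finset.univ.filter fun j =>
          pattern σ Φ a j ≠ T' a j).card : ℝ)) (Finset.mem_univ a)]
      rw [Finset.sum_congr rfl (g := fun a => ((Finset.univ.filter fun j =>
          pattern σ Φ a j ≠ T' a j).card : ℝ)) (s₁ := Finset.univ.erase a) (fun b hb => by
            rw [h b (Finset.ne_of_mem_erase hb)])]
      have h1 : ((Finset.univ.filter fun j => pattern σ Φ a j ≠ T a j).card : ℝ) ≤ k := by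
        exact_mod_cast (Finset.card_le_univ _).trans (by simp)
      have h2 : (0 : ℝ) ≤ ((Finset.univ.filter fun j => pattern σ Φ a j ≠ T' a j).card : ℝ) :=
        Nat.cast_nonneg _
      linarith
    have := mul_le_mul_of_nonneg_left this hc
    linarith
  have hGlip : ∀ (a : Fin m) (T T' : Fin m → Fin k → ℤˣ), (∀ b, b ≠ a → T b = T' b) →
      |G T - G T'| ≤ c * k := by
    intro a T T' h
    have a1 := hGle a T T' h
    have a2 := hGle a T' T fun b hb => (h b hb).symm
    rw [abs_le]; constructor <;> linarith
  -- exponential moments under independent clauses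
  set Q : (Fin m → Fin k → ℤˣ) → ℝ := fun T => ∏ a, tiltedLaw β ε (T a) with hQ
  have hQ0 : ∀ T, 0 ≤ Q T := fun T => Finset.prod_nonneg fun a _ => (tiltedLaw_pos β h0 h1 _).le
  set M := ∑ T, Q T * G T with hM
  set B := balanced m k (n * (d / 2)) with hB
  set V : ℝ := m * ((c * k) ^ 2 / 2) with hV
  have hup : ∑ T ∈ B, Q T * Real.exp (G T) ≤ Real.exp (M + V) :=
    (Finset.sum_le_univ_sum_of_nonneg fun T => mul_nonneg (hQ0 T) (Real.exp_pos _).le).trans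
      (sum_pi_mul_exp_le (tiltedLaw β ε) (fun t => (tiltedLaw_pos β h0 h1 t).le)
        (sum_tiltedLaw h1 hfix) m G hGlip)
  have hdown : ∑ T ∈ B, Q T * Real.exp (-G T) ≤ Real.exp (-M + V) := by
    refine (Finset.sum_le_univ_sum_of_nonneg fun T =>
      mul_nonneg (hQ0 T) (Real.exp_pos _).le).trans ?_
    have := sum_pi_mul_exp_le (tiltedLaw β ε) (fun t => (tiltedLaw_pos β h0 h1 t).le)
        (sum_tiltedLaw h1 hfix) m (fun T => -G T) (c := c * k) (fun a T T' h => by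
          rw [neg_sub_neg, abs_sub_comm]; exact hGlip a T T' h)
    refine this.trans (le_of_eq ?_)
    congr 2
    rw [hM, ← Finset.sum_neg_distrib]
    exact Finset.sum_congr rfl fun T _ => by simp only [hQ]; ring
  set A : ℝ := ((n * (d / 2)).factorial : ℝ) ^ 2 *
    ((1 - ε) ^ m / ((1 - ε ^ 2) / 4) ^ (n * (d / 2))) with hA
  have hWA : W = A * P := sum_weight hd hN h0 h1 σ
  have hA0 : 0 < A := by
    have := hW0; rw [hWA] at this; exact (pos_iff_pos_of_mul_pos this).2 hP
  have htr : ∀ H : (Fin m → Fin k → ℤˣ) → ℝ,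
      ∑ Φ : Formula n d m k, weight β Φ σ * H (pattern σ Φ) = A * ∑ T ∈ B, Q T * H T :=
    fun H => sum_weight_mul_pattern hd hN h0 h1 σ H
  set μ : ℝ := (∑ Φ : Formula n d m k, weight β Φ σ * f Φ) / W with hμ
  have hμ2 : μ = ∑ T ∈ B, Q T / P * G T := by
    rw [hμ, ← hmean, Finset.sum_congr rfl (fun Φ _ => by rw [← hFG Φ]), htr G, hWA,
      mul_div_mul_left _ _ hA0.ne', Finset.sum_div]
    exact Finset.sum_congr rfl fun T _ => by ring
  have hjen : P * Real.exp (-μ) ≤ Real.exp (-M + V) := by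
    refine le_trans ?_ hdown
    have := convexOn_exp.map_sum_le (t := B) (w := fun T => Q T / P) (p := fun T => -G T)
      (fun T _ => div_nonneg (hQ0 T) hP.le)
      (by rw [← Finset.sum_div]; exact div_self hP.ne') (fun _ _ => Set.mem_univ _)
    simp only [smul_eq_mul, mul_neg, Finset.sum_neg_distrib] at this
    rw [← hμ2] at this
    refine (mul_le_mul_of_nonneg_left this hP.le).trans (le_of_eq ?_)
    rw [Finset.mul_sum]
    refine Finset.sum_congr rfl fun T _ => ?_
    field_simp
  have hMle : P * Real.exp M ≤ Real.exp (μ + V) := by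
    have := mul_le_mul_of_nonneg_right hjen (Real.exp_pos (M + μ)).le
    rw [mul_assoc, ← Real.exp_add, ← Real.exp_add] at this
    have e1 : -μ + (M + μ) = M := by ring
    have e2 : -M + V + (M + μ) = μ + V := by ring
    rwa [e1, e2] at this
  have hmk : (m : ℝ) * k = n * d := by exact_mod_cast hN
  calc P ^ 2 * ∑ Φ, weight β Φ σ * Real.exp (f Φ)
      ≤ P ^ 2 * (Real.exp (4 * (n * d) * c ^ 2) * (A * Real.exp (M + V))) := by
        refine mul_le_mul_of_nonneg_left (hstep1.trans ?_) (by positivity)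
        refine mul_le_mul_of_nonneg_left ?_ (Real.exp_pos _).le
        rw [Finset.sum_congr rfl (fun Φ _ => by rw [← hFG Φ]), htr (fun T => Real.exp (G T))]
        exact mul_le_mul_of_nonneg_left hup hA0.le
    _ = W * (P * Real.exp M) * (Real.exp V * Real.exp (4 * (n * d) * c ^ 2)) := by
        rw [hWA, Real.exp_add]; ring
    _ ≤ W * Real.exp (μ + V) * (Real.exp V * Real.exp (4 * (n * d) * c ^ 2)) := by
        refine mul_le_mul_of_nonneg_right (mul_le_mul_of_nonneg_left hMle hW0.le) (by positivity)
    _ = _ := by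
        rw [mul_assoc, ← Real.exp_add, ← Real.exp_add]
        congr 2
        have : V + V = (n * d) * k * c ^ 2 := by rw [hV, ← hmk]; ring
        linear_combination this

/-! ### Exchanging clause clones and flipping variables -/

theorem energy_swap_le (Φ : Formula n d m k) (τ : Assignment n) (x y : Fin m × Fin k) :
    energy (Φ.trans (Equiv.swap x y)) τ ≤ energy Φ τ + 2 := by
  unfold energy
  have hsub : (Finset.univ.filter fun a : Fin m =>
      ∀ j : Fin k, literalValue τ ((Φ.trans (Equiv.swap x y)).symm (a, j)) = -1)
      ⊆ (Finset.univ.filter fun a : Fin m =>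
        ∀ j : Fin k, literalValue τ (Φ.symm (a, j)) = -1) ∪ {x.1, y.1} := by
    intro a ha
    simp only [Finset.mem_union, Finset.mem_filter, Finset.mem_univ, true_and,
      Finset.mem_insert, Finset.mem_singleton] at ha ⊢
    by_cases hx : a = x.1
    · exact Or.inr (Or.inl hx)
    by_cases hy : a = y.1
    · exact Or.inr (Or.inr hy)
    refine Or.inl fun j => ?_
    have := ha j
    rw [Equiv.symm_trans_apply, Equiv.symm_swap, Equiv.swap_apply_of_ne_of_ne
      (fun h => hx (by rw [← h])) (fun h => hy (by rw [← h]))] at this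
    exact this
  refine (Finset.card_le_card hsub).trans ((Finset.card_union_le _ _).trans ?_)
  exact Nat.add_le_add_left Finset.card_le_two _

theorem weight_le_swap {β : ℝ} (hβ : 0 ≤ β) (Φ : Formula n d m k) (τ : Assignment n)
    (x y : Fin m × Fin k) :
    weight β Φ τ ≤ Real.exp (2 * β) * weight β (Φ.trans (Equiv.swap x y)) τ := by
  unfold weight
  rw [← Real.exp_add]
  refine Real.exp_le_exp.2 ?_
  have h : (energy (Φ.trans (Equiv.swap x y)) τ : ℝ) ≤ energy Φ τ + 2 := by
    exact_mod_cast energy_swap_le Φ τ x y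
  nlinarith

theorem abs_log_sum_weight_swap_le {β : ℝ} (hβ : 0 ≤ β) {A : Finset (Assignment n)}
    (hA : A.Nonempty) (Φ : Formula n d m k) (x y : Fin m × Fin k) :
    |Real.log (∑ τ ∈ A, weight β (Φ.trans (Equiv.swap x y)) τ)
      - Real.log (∑ τ ∈ A, weight β Φ τ)| ≤ 2 * β := by
  have hpos : ∀ Ψ : Formula n d m k, 0 < ∑ τ ∈ A, weight β Ψ τ := fun Ψ =>
    Finset.sum_pos (fun τ _ => Real.exp_pos _) hA
  have hle : ∀ Ψ : Formula n d m k, Real.log (∑ τ ∈ A, weight β Ψ τ)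
      ≤ 2 * β + Real.log (∑ τ ∈ A, weight β (Ψ.trans (Equiv.swap x y)) τ) := by
    intro Ψ
    rw [← Real.log_exp (2 * β), ← Real.log_mul (Real.exp_pos _).ne' (hpos _).ne']
    refine Real.log_le_log (hpos _) ?_
    rw [Finset.mul_sum]
    exact Finset.sum_le_sum fun τ _ => weight_le_swap hβ Ψ τ x y
  have h1 := hle Φ
  have h2 := hle (Φ.trans (Equiv.swap x y))
  have e : (Φ.trans (Equiv.swap x y)).trans (Equiv.swap x y) = Φ := by
    rw [Equiv.trans_assoc, Equiv.swap_swap, Equiv.trans_refl]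
  rw [e] at h2
  rw [abs_le]; constructor <;> linarith

/-- The assignments in the cluster of `τ`. -/
noncomputable def cluster (k : ℕ) (τ : Assignment n) : Finset (Assignment n) :=
  Finset.univ.filter fun σ => (n : ℝ) * (1 - (2 : ℝ) ^ (-(k : ℝ) / 10)) < (overlap σ τ : ℝ)

theorem clusterSize_eq_sum (β : ℝ) (Φ : Formula n d m k) (τ : Assignment n) :
    clusterSize β Φ τ = ∑ σ ∈ cluster k τ, weight β Φ σ := by
  unfold clusterSize cluster
  rw [Finset.sum_filter]

theorem overlap_self (τ : Assignment n) : overlap τ τ = n := by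
  unfold overlap
  have : ∀ x, ((τ x : ℤ)) * (τ x : ℤ) = 1 := fun x => by
    rw [← Units.val_mul, Int.units_mul_self]; rfl
  simp [this]

theorem mem_cluster_self (hn : 0 < n) (τ : Assignment n) : τ ∈ cluster k τ := by
  refine Finset.mem_filter.2 ⟨Finset.mem_univ _, ?_⟩
  rw [overlap_self]
  have h1 : (0 : ℝ) < n := by exact_mod_cast hn
  have h2 : (0 : ℝ) < (2 : ℝ) ^ (-(k : ℝ) / 10) := by positivity
  push_cast
  nlinarith

theorem clusterSize_pos (hn : 0 < n) (β : ℝ) (Φ : Formula n d m k) (τ : Assignment n) :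
    0 < clusterSize β Φ τ := by
  rw [clusterSize_eq_sum]
  exact Finset.sum_pos (fun τ _ => Real.exp_pos _) ⟨τ, mem_cluster_self hn τ⟩

theorem weight_le_clusterSize (hn : 0 < n) (β : ℝ) (Φ : Formula n d m k) (τ : Assignment n) :
    weight β Φ τ ≤ clusterSize β Φ τ := by
  rw [clusterSize_eq_sum]
  exact Finset.single_le_sum (f := fun σ => weight β Φ σ) (fun τ _ => (Real.exp_pos _).le)
    (mem_cluster_self hn τ)

theorem clusterSize_le_partitionFunction (β : ℝ) (Φ : Formula n d m k) (τ : Assignment n) :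
    clusterSize β Φ τ ≤ partitionFunction β Φ := by
  rw [clusterSize_eq_sum]
  exact Finset.sum_le_univ_sum_of_nonneg fun _ => (Real.exp_pos _).le

theorem partitionFunction_pos (β : ℝ) (Φ : Formula n d m k) : 0 < partitionFunction β Φ :=
  Finset.sum_pos (fun _ _ => Real.exp_pos _) Finset.univ_nonempty

theorem exists_flip (hd : Even d) :
    ∃ e : Equiv.Perm (Fin d), ∀ i, cloneSign (e i) = -cloneSign i := by
  have h : ∀ u : ℤˣ, Fintype.card {i : Fin d // -cloneSign i = u}
      = Fintype.card {i : Fin d // cloneSign i = u} := by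
    intro u
    rw [Fintype.card_subtype, Fintype.card_subtype, card_cloneSign_eq hd,
      ← card_cloneSign_eq hd (-u)]
    congr 1
    ext i
    simp only [Finset.mem_filter, Finset.mem_univ, true_and, neg_eq_iff_eq_neg]
  exact ⟨Equiv.ofFiberEquiv (f := fun i : Fin d => -cloneSign i) (g := cloneSign)
    fun u => Fintype.equivOfCardEq (h u), fun i => Equiv.ofFiberEquiv_map _ i⟩

/-- Exchanging the positive and the negative clones of the variables where `ρ` is `-1` has the same
effect as multiplying the assignment by `ρ`. -/
theorem exists_gauge (hd : Even d) (ρ : Assignment n) :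
    ∃ θ : Equiv.Perm (Fin n × Fin d), ∀ (τ : Assignment n) v,
      literalValue (ρ * τ) v = literalValue τ (θ v) := by
  obtain ⟨e, he⟩ := exists_flip (d := d) hd
  refine ⟨Equiv.prodShear (Equiv.refl _) (fun x => if ρ x = 1 then Equiv.refl _ else e), ?_⟩
  rintro τ ⟨x, i⟩
  rw [literalValue_eq, literalValue_eq]
  rcases Int.units_eq_one_or (ρ x) with h | h
  · simp [h]
  · have h' : ρ x ≠ 1 := by rw [h]; decide
    simp [h, he]

theorem sum_weight_mul_clusterSize (hd : Even d) (β : ℝ) (ρ : Assignment n) (u : ℝ → ℝ) :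
    ∑ Φ : Formula n d m k, weight β Φ ρ * u (clusterSize β Φ ρ)
      = ∑ Φ : Formula n d m k, weight β Φ 1 * u (clusterSize β Φ 1) := by
  obtain ⟨θ, hθ⟩ := exists_gauge (d := d) hd ρ
  have hw : ∀ (Φ : Formula n d m k) τ, weight β (θ.trans Φ) (ρ * τ) = weight β Φ τ := by
    intro Φ τ
    rw [weight_eq_prod, weight_eq_prod]
    have : pattern (ρ * τ) (θ.trans Φ) = pattern τ Φ := by
      funext a j
      simp [pattern, hθ]
    rw [this]
  have hov : ∀ σ τ : Assignment n, overlap (ρ * σ) (ρ * τ) = overlap σ τ := by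
    intro σ τ
    unfold overlap
    refine Finset.sum_congr rfl fun x _ => ?_
    rw [← Units.val_mul, ← Units.val_mul, Pi.mul_apply, Pi.mul_apply, mul_mul_mul_comm,
      Int.units_mul_self, one_mul]
  have hC : ∀ (Φ : Formula n d m k) τ,
      clusterSize β (θ.trans Φ) (ρ * τ) = clusterSize β Φ τ := by
    intro Φ τ
    unfold clusterSize
    refine (Fintype.sum_equiv (Equiv.mulLeft ρ) _ _ fun σ => ?_).symm
    rw [Equiv.coe_mulLeft, hw, hov]
  refine (Fintype.sum_equiv (Equiv.equivCongr θ.symm (Equiv.refl _)) _ _ fun Φ => ?_).symm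
  have e1 : (Equiv.equivCongr θ.symm (Equiv.refl _)) Φ = θ.trans Φ := rfl
  rw [e1]
  have h1 := hw Φ 1
  have h2 := hC Φ 1
  rw [mul_one] at h1 h2
  rw [h1, h2]

/-! ### An annealed free energy bounds the planted cluster size -/

theorem expect_mono {X Y : Formula n d m k → ℝ} (h : ∀ Φ, X Φ ≤ Y Φ) : expect X ≤ expect Y :=
  div_le_div_of_nonneg_right (Finset.sum_le_sum fun Φ _ => h Φ) (Nat.cast_nonneg _)

theorem exp_expect_le (hN : m * k = n * d) (X : Formula n d m k → ℝ) :
    Real.exp (expect X) ≤ expect fun Φ => Real.exp (X Φ) := by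
  have hpos : (0 : ℝ) < Fintype.card (Formula n d m k) := by
    rw [card_formula hN]; exact_mod_cast Nat.factorial_pos _
  have := convexOn_exp.map_sum_le (t := (Finset.univ : Finset (Formula n d m k)))
    (w := fun _ => 1 / (Fintype.card (Formula n d m k) : ℝ)) (p := X)
    (fun _ _ => by positivity) (by simp [hpos.ne']) (fun _ _ => Set.mem_univ _)
  simp only [smul_eq_mul, ← Finset.mul_sum] at this
  unfold expect
  rw [div_eq_inv_mul, div_eq_inv_mul]
  simpa using this

theorem expect_partitionFunction_pos (hN : m * k = n * d) (β : ℝ) :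
    0 < expect (fun Φ : Formula n d m k => partitionFunction β Φ) := by
  have Φ₀ : Formula n d m k := Fintype.equivOfCardEq (by simp [hN])
  exact div_pos (Finset.sum_pos (fun Φ _ => partitionFunction_pos β Φ) ⟨Φ₀, Finset.mem_univ _⟩)
    (by rw [card_formula hN]; exact_mod_cast Nat.factorial_pos _)

/-- The comparison rests on `Ê[Z ^ (-lam)] ≤ Ê[C ^ (-lam)]`: by Jensen's inequality the left side is
at least `exp ((1 - lam) * E[log Z]) / E[Z]`, and by concentration in the planted model the right
side is about `exp (-lam * Ê[log C])`. -/
theorem mul_plantedExpect_log_clusterSize_le (hd : Even d) (hN : m * k = n * d) (hn : 0 < n)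
    {β ε : ℝ} (hβ : 0 ≤ β) (h0 : 0 ≤ ε) (h1 : ε < 1)
    (hfix : ε = (1 - Real.exp (-β)) * ((1 + ε) / 2) ^ k)
    (hP : 0 < balancedMass β ε m k (n * (d / 2))) {lam : ℝ} (hl : 0 ≤ lam) :
    lam * plantedExpect β (fun (Φ : Formula n d m k) σ => Real.log (clusterSize β Φ σ))
      ≤ Real.log (expect fun Φ : Formula n d m k => partitionFunction β Φ)
        - (1 - lam) * expect (fun Φ : Formula n d m k => Real.log (partitionFunction β Φ))
        + (n * d) * (4 + k) * (2 * β * lam) ^ 2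
        - 2 * Real.log (balancedMass β ε m k (n * (d / 2))) := by
  have Φ₀ : Formula n d m k := Fintype.equivOfCardEq (by simp [hN])
  set P := balancedMass β ε m k (n * (d / 2)) with hPdef
  set W := ∑ Φ : Formula n d m k, weight β Φ 1 with hW
  set K : ℝ := (Fintype.card (Formula n d m k) : ℝ) with hK
  have hK0 : 0 < K := by rw [hK, card_formula hN]; exact_mod_cast Nat.factorial_pos _
  have hW0 : 0 < W := Finset.sum_pos (fun Φ _ => Real.exp_pos _) ⟨Φ₀, Finset.mem_univ _⟩
  set Ln := plantedExpect β (fun (Φ : Formula n d m k) σ => Real.log (clusterSize β Φ σ)) with hLn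
  set EL := expect (fun Φ : Formula n d m k => Real.log (partitionFunction β Φ)) with hEL
  set EZ := expect (fun Φ : Formula n d m k => partitionFunction β Φ) with hEZ
  have hcardA : (Fintype.card (Assignment n) : ℝ) ≠ 0 := by
    exact_mod_cast Fintype.card_ne_zero
  have hsymm : ∀ u : ℝ → ℝ, ∑ Φ : Formula n d m k, ∑ σ, weight β Φ σ * u (clusterSize β Φ σ)
      = Fintype.card (Assignment n) *
        ∑ Φ : Formula n d m k, weight β Φ 1 * u (clusterSize β Φ 1) := by
    intro u
    rw [Finset.sum_comm, Finset.sum_congr rfl fun σ _ => sum_weight_mul_clusterSize hd β σ u,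
      Finset.sum_const, nsmul_eq_mul, Finset.card_univ]
  have hZW : ∑ Φ : Formula n d m k, partitionFunction β Φ = Fintype.card (Assignment n) * W := by
    have := hsymm fun _ => 1
    simpa [partitionFunction] using this
  have hLn2 : Ln = (∑ Φ : Formula n d m k, weight β Φ 1 * Real.log (clusterSize β Φ 1)) / W := by
    rw [hLn]
    unfold plantedExpect
    rw [hZW, hsymm Real.log, mul_div_mul_left _ _ hcardA]
  set f : Formula n d m k → ℝ := fun Φ => -lam * Real.log (clusterSize β Φ 1) with hf
  have hflip : ∀ Φ x y, |f (Φ.trans (Equiv.swap x y)) - f Φ| ≤ 2 * β * lam := by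
    intro Φ x y
    have := abs_log_sum_weight_swap_le hβ ⟨1, mem_cluster_self (k := k) hn 1⟩ Φ x y
    rw [← clusterSize_eq_sum, ← clusterSize_eq_sum] at this
    simp only [hf]
    rw [← mul_sub, abs_mul, abs_neg, abs_of_nonneg hl, mul_comm (2 * β)]
    exact mul_le_mul_of_nonneg_left this hl
  have hmgf := sum_weight_mul_exp_le hd hN h0 h1 hfix 1 (c := 2 * β * lam) (by positivity) hflip hP
  have hmean : (∑ Φ : Formula n d m k, weight β Φ 1 * f Φ) / W = -lam * Ln := by
    rw [hLn2, mul_div_assoc', Finset.mul_sum]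
    congr 1
    exact Finset.sum_congr rfl fun Φ _ => by simp only [hf]; ring
  rw [← hW, hmean] at hmgf
  have hjensen : Real.exp ((1 - lam) * EL) ≤
      (∑ Φ : Formula n d m k, ∑ σ, weight β Φ σ
        * Real.exp (-lam * Real.log (clusterSize β Φ σ))) / K := by
    have a1 := exp_expect_le hN
      (fun Φ : Formula n d m k => (1 - lam) * Real.log (partitionFunction β Φ))
    have e1 : expect (fun Φ : Formula n d m k => (1 - lam) * Real.log (partitionFunction β Φ))
        = (1 - lam) * EL := by
      rw [hEL]; unfold expect; rw [← Finset.mul_sum, mul_div_assoc]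
    rw [e1] at a1
    refine a1.trans ?_
    unfold expect
    refine div_le_div_of_nonneg_right (Finset.sum_le_sum fun Φ _ => ?_) hK0.le
    have hZ := partitionFunction_pos β Φ
    have e2 : Real.exp ((1 - lam) * Real.log (partitionFunction β Φ))
        = ∑ σ, weight β Φ σ * Real.exp (-lam * Real.log (partitionFunction β Φ)) := by
      rw [← Finset.sum_mul, sub_mul, one_mul, sub_eq_add_neg, Real.exp_add, Real.exp_log hZ,
        neg_mul]
      rfl
    rw [e2]
    refine Finset.sum_le_sum fun σ _ => mul_le_mul_of_nonneg_left ?_ (Real.exp_pos _).le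
    refine Real.exp_le_exp.2 ?_
    have := Real.log_le_log (clusterSize_pos hn β Φ σ) (clusterSize_le_partitionFunction β Φ σ)
    nlinarith
  rw [hsymm fun c => Real.exp (-lam * Real.log c)] at hjensen
  have hEZW : EZ = Fintype.card (Assignment n) * W / K := by
    rw [hEZ]; unfold expect; rw [hZW]
  have hmain : P ^ 2 * Real.exp ((1 - lam) * EL)
      ≤ EZ * Real.exp (-lam * Ln + (n * d) * (4 + k) * (2 * β * lam) ^ 2) := by
    calc P ^ 2 * Real.exp ((1 - lam) * EL)
        ≤ P ^ 2 * ((Fintype.card (Assignment n) *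
            ∑ Φ : Formula n d m k, weight β Φ 1 * Real.exp (f Φ)) / K) :=
          mul_le_mul_of_nonneg_left hjensen (by positivity)
      _ = (Fintype.card (Assignment n) / K) *
            (P ^ 2 * ∑ Φ : Formula n d m k, weight β Φ 1 * Real.exp (f Φ)) := by ring
      _ ≤ (Fintype.card (Assignment n) / K) * (W *
            Real.exp (-lam * Ln + (n * d) * (4 + k) * (2 * β * lam) ^ 2)) :=
          mul_le_mul_of_nonneg_left hmgf (by positivity)
      _ = _ := by rw [hEZW]; ring
  have hEZ0 : 0 < EZ := expect_partitionFunction_pos hN β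
  have hlog := Real.log_le_log (by positivity) hmain
  rw [Real.log_mul (by positivity) (Real.exp_pos _).ne', Real.log_mul hEZ0.ne'
    (Real.exp_pos _).ne', Real.log_exp, Real.log_exp, Real.log_pow] at hlog
  push_cast at hlog
  linarith

theorem eventually_clusterRate_le (hk : 0 < k) (hd : Even d) {β ε : ℝ} (hβ : 0 ≤ β) (h0 : 0 ≤ ε)
    (h1 : ε < 1) (hfix : ε = (1 - Real.exp (-β)) * ((1 + ε) / 2) ^ k) {a : ℝ}
    (ha : Tendsto (annealedRate d k β) (nLimit d k) (𝓝 a))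
    (hq : Tendsto (quenchedRate d k β) (nLimit d k) (𝓝 a)) {η : ℝ} (hη : 0 < η) :
    ∀ᶠ n in nLimit d k, clusterRate d k β n ≤ a + η := by
  set K : ℝ := d * (4 + k) * (2 * β) ^ 2 + 4 with hK
  have hK0 : 0 < K := by positivity
  set lam : ℝ := min 1 (η / K) with hlam
  have hl0 : 0 < lam := by positivity
  have hl1 : lam ≤ 1 := min_le_left _ _
  have hlK : K * lam ≤ η := by
    have : lam ≤ η / K := min_le_right _ _
    rw [le_div_iff₀ hK0] at this
    linarith
  have hl2 : 0 < lam ^ 2 := by positivity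
  filter_upwards [eventually_exp_le_balancedMass h0 h1 hk hd hfix hl2,
    ha.eventually (gt_mem_nhds (by linarith : a < a + lam ^ 2)),
    hq.eventually (lt_mem_nhds (by linarith : a - lam ^ 2 < a)),
    eventually_dvd, eventually_nLimit (eventually_ge_atTop 1)] with n hmass hann hque hdvd hn1
  have hN := mul_eq_of_dvd hdvd
  have hn : (0 : ℝ) < n := by exact_mod_cast hn1
  have hP := (Real.exp_pos _).trans_le hmass
  have hmain := mul_plantedExpect_log_clusterSize_le hd hN hn1 hβ h0 h1 hfix hP hl0.le
  have hlogP : -(lam ^ 2) * n ≤ Real.log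
      (balancedMass β ε (d * n / k) k (n * (d / 2))) := (Real.le_log_iff_exp_le hP).2 hmass
  have e1 : Real.log (expect fun Φ : Formula n d (d * n / k) k => partitionFunction β Φ)
      = annealedRate d k β n * n := by unfold annealedRate; field_simp
  have e2 : expect (fun Φ : Formula n d (d * n / k) k => Real.log (partitionFunction β Φ))
      = quenchedRate d k β n * n := by unfold quenchedRate; field_simp
  have e3 : plantedExpect β
      (fun (Φ : Formula n d (d * n / k) k) σ => Real.log (clusterSize β Φ σ))
      = clusterRate d k β n * n := by unfold clusterRate; field_simp
  rw [e1, e2, e3] at hmain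
  have h2 : (lam * clusterRate d k β n) * n ≤ (lam * (a + K * lam)) * n := by
    have b1 : annealedRate d k β n * n ≤ (a + lam ^ 2) * n :=
      mul_le_mul_of_nonneg_right hann.le hn.le
    have b2 : (1 - lam) * (a - lam ^ 2) ≤ (1 - lam) * quenchedRate d k β n :=
      mul_le_mul_of_nonneg_left hque.le (by linarith)
    have b3 := mul_le_mul_of_nonneg_right b2 hn.le
    have b4 : 0 ≤ lam * lam ^ 2 * n := by positivity
    have e4 : lam * (a + K * lam) * n = (a + lam ^ 2) * n - (1 - lam) * (a - lam ^ 2) * n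
        + (n * d) * (4 + k) * (2 * β * lam) ^ 2 + 2 * (lam ^ 2 * n) + lam * lam ^ 2 * n := by
      rw [hK]; ring
    rw [e4]
    linarith
  have h3 := le_of_mul_le_mul_left (le_of_mul_le_mul_right h2 hn) hl0
  linarith

end RegKSAT

/-! ### Elementary Stirling bounds -/

theorem self_pow_le_exp_mul_factorial (n : ℕ) : (n : ℝ) ^ n ≤ Real.exp n * n.factorial := by
  have h := Real.pow_div_factorial_le_exp (n : ℝ) (Nat.cast_nonneg n) n
  rwa [div_le_iff₀ (by exact_mod_cast n.factorial_pos)] at h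

theorem exp_mul_factorial_le (n : ℕ) :
    Real.exp n * n.factorial ≤ Real.exp 1 * (n + 1) * (n : ℝ) ^ n := by
  have key : ∀ n : ℕ, Real.exp (n + 1 : ℕ) * (n + 1).factorial
      ≤ Real.exp 1 * (n + 1 : ℕ) * ((n + 1 : ℕ) : ℝ) ^ (n + 1) := by
    intro n
    induction n with
    | zero => simp
    | succ n ih =>
      have h1 : Real.exp 1 * ((n + 1 : ℕ) : ℝ) ^ (n + 2) ≤ ((n + 2 : ℕ) : ℝ) ^ (n + 2) := by
        have hp : (0 : ℝ) < (n + 2 : ℕ) := by positivity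
        have h2 : ((n + 1 : ℕ) : ℝ) / (n + 2 : ℕ) ≤ Real.exp (-(1 / (n + 2 : ℕ))) := by
          refine le_trans (le_of_eq ?_) (Real.one_sub_le_exp_neg _)
          field_simp
          push_cast; ring
        have h3 := pow_le_pow_left₀ (by positivity) h2 (n + 2)
        rw [← Real.exp_nat_mul, div_pow, div_le_iff₀ (by positivity)] at h3
        have e : ((n + 2 : ℕ) : ℝ) * -(1 / (n + 2 : ℕ)) = -1 := by field_simp
        rw [e] at h3
        calc Real.exp 1 * ((n + 1 : ℕ) : ℝ) ^ (n + 2)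
            ≤ Real.exp 1 * (Real.exp (-1) * ((n + 2 : ℕ) : ℝ) ^ (n + 2)) :=
              mul_le_mul_of_nonneg_left h3 (Real.exp_pos _).le
          _ = _ := by rw [← mul_assoc, ← Real.exp_add]; simp
      have e1 : Real.exp (n + 1 + 1 : ℕ) = Real.exp 1 * Real.exp (n + 1 : ℕ) := by
        rw [← Real.exp_add]; congr 1; push_cast; ring
      have e2 : ((n + 1 + 1).factorial : ℝ) = (n + 2 : ℕ) * (n + 1).factorial := by
        rw [Nat.factorial_succ]; push_cast; ring
      rw [e1, e2]
      calc Real.exp 1 * Real.exp (n + 1 : ℕ) * ((n + 2 : ℕ) * (n + 1).factorial)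
          = Real.exp 1 * (n + 2 : ℕ) * (Real.exp (n + 1 : ℕ) * (n + 1).factorial) := by ring
        _ ≤ Real.exp 1 * (n + 2 : ℕ) *
              (Real.exp 1 * (n + 1 : ℕ) * ((n + 1 : ℕ) : ℝ) ^ (n + 1)) :=
            mul_le_mul_of_nonneg_left ih (by positivity)
        _ = Real.exp 1 * (n + 2 : ℕ) * (Real.exp 1 * ((n + 1 : ℕ) : ℝ) ^ (n + 2)) := by ring
        _ ≤ Real.exp 1 * (n + 2 : ℕ) * ((n + 2 : ℕ) : ℝ) ^ (n + 2) :=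
            mul_le_mul_of_nonneg_left h1 (by positivity)
  rcases n with _ | n
  · simp
  · refine (key n).trans (mul_le_mul_of_nonneg_right ?_ (by positivity))
    refine mul_le_mul_of_nonneg_left ?_ (Real.exp_pos _).le
    linarith

namespace RegKSAT

variable {n d m k : ℕ}

/-! ### Second moments of the Gibbs weights -/

/-- The number of variables on which two assignments agree. -/
def agreement (σ τ : Assignment n) : ℕ := (Finset.univ.filter fun x => σ x * τ x = 1).card

theorem agreement_le (σ τ : Assignment n) : agreement σ τ ≤ n := by
  simpa [agreement] using Finset.card_le_univ (Finset.univ.filter fun x => σ x * τ x = 1)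

theorem card_disagreement (σ τ : Assignment n) :
    (Finset.univ.filter fun x => σ x * τ x = -1).card = n - agreement σ τ := by
  have h := Finset.card_filter_add_card_filter_not (s := (Finset.univ : Finset (Fin n)))
    (fun x => σ x * τ x = 1)
  have e : (Finset.univ.filter fun x => ¬ σ x * τ x = 1)
      = Finset.univ.filter fun x => σ x * τ x = -1 :=
    Finset.filter_congr fun x _ => by
      rcases Int.units_eq_one_or (σ x * τ x) with h | h <;> simp [h]
  rw [e] at h
  simp only [Finset.card_univ, Fintype.card_fin] at h
  unfold agreement
  omega

theorem overlap_eq_agreement (σ τ : Assignment n) :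
    (overlap σ τ : ℝ) = 2 * agreement σ τ - n := by
  have h1 : ∀ x, ((σ x : ℤ) * (τ x : ℤ) : ℤ)
      = 2 * (if σ x * τ x = 1 then 1 else 0) - 1 := by
    intro x
    rw [← Units.val_mul]
    rcases Int.units_eq_one_or (σ x * τ x) with h | h <;> simp [h]
  unfold overlap agreement
  rw [Finset.sum_congr rfl fun x _ => h1 x, Finset.sum_sub_distrib, ← Finset.mul_sum,
    Finset.card_filter]
  push_cast
  simp

theorem sum_pow_agreement (σ : Assignment n) (y z : ℝ) :
    ∑ τ : Assignment n, y ^ agreement σ τ * z ^ (n - agreement σ τ) = (y + z) ^ n := by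
  have h1 : ∀ τ : Assignment n, y ^ agreement σ τ * z ^ (n - agreement σ τ)
      = ∏ x, (if (σ * τ) x = 1 then y else z) := by
    intro τ
    rw [Finset.prod_ite, Finset.prod_const, Finset.prod_const, ← card_disagreement]
    congr 3
    refine Finset.filter_congr fun x _ => ?_
    rw [Pi.mul_apply]
    rcases Int.units_eq_one_or (σ x * τ x) with h | h <;> simp [h]
  have h2 : ∑ τ : Assignment n, ∏ x, (if (σ * τ) x = 1 then y else z)
      = ∑ τ : Assignment n, ∏ x, (if τ x = 1 then y else z) :=
    Equiv.sum_comp (Equiv.mulLeft σ) (fun τ : Assignment n => ∏ x, (if τ x = 1 then y else z))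
  rw [Finset.sum_congr rfl fun τ _ => h1 τ, h2,
    sum_prod_pi (fun u : ℤˣ => if u = 1 then y else z) n, sum_units]
  simp

theorem card_agreement_mul_le (σ : Assignment n) {y z : ℝ} (hy : 0 ≤ y) (hz : 0 ≤ z) (j : ℕ) :
    ((Finset.univ.filter fun τ : Assignment n => agreement σ τ = j).card : ℝ)
      * (y ^ j * z ^ (n - j)) ≤ (y + z) ^ n := by
  rw [← sum_pow_agreement σ y z, ← nsmul_eq_mul, ← Finset.sum_const]
  refine le_trans (le_of_eq ?_) (Finset.sum_le_univ_sum_of_nonneg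
    (s := Finset.univ.filter fun τ : Assignment n => agreement σ τ = j)
    fun τ => by positivity)
  refine Finset.sum_congr rfl fun τ hτ => ?_
  rw [(Finset.mem_filter.1 hτ).2]

/-- Up to normalisation, the probability generating function of a clause for two assignments of
overlap `α * n`. -/
noncomputable def pairFactor (k : ℕ) (ε α : ℝ) : ℝ :=
  (1 + α * ε ^ 2) ^ k - 2 * ε * (1 + α * ε) ^ k + ε ^ 2 * (1 + α) ^ k

/-- The weights of the pairs of truth values of a literal under two assignments of overlap `α * n`,
tilted as in `slotWeight` in both coordinates. -/
noncomputable def pairWeight (ε α : ℝ) (u : ℤˣ × ℤˣ) : ℝ :=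
  2 * slotWeight ε u.1 * (2 * slotWeight ε u.2) * (if u.1 = u.2 then (1 + α) / 4 else (1 - α) / 4)

theorem sum_prod_pairWeight {β ε : ℝ} (α : ℝ)
    (hfix : ε = (1 - Real.exp (-β)) * ((1 + ε) / 2) ^ k) :
    ∑ t : Fin k → ℤˣ × ℤˣ, (∏ j, pairWeight ε α (t j)) *
      (clauseWeight β (fun j => (t j).1) * clauseWeight β (fun j => (t j).2))
        = pairFactor k ε α := by
  set q := 1 - Real.exp (-β) with hq
  have h1 : ∀ t : Fin k → ℤˣ × ℤˣ, (∏ j, pairWeight ε α (t j)) *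
      (clauseWeight β (fun j => (t j).1) * clauseWeight β (fun j => (t j).2))
      = ∏ j, pairWeight ε α (t j)
        - q * (∏ j, if (t j).1 = -1 then pairWeight ε α (t j) else 0)
        - q * (∏ j, if (t j).2 = -1 then pairWeight ε α (t j) else 0)
        + q ^ 2 * ∏ j, if (t j).1 = -1 ∧ (t j).2 = -1 then pairWeight ε α (t j) else 0 := by
    intro t
    have hprod : ∀ (R : ℤˣ × ℤˣ → Prop) [DecidablePred R],
        (∏ j, if R (t j) then pairWeight ε α (t j) else 0)
          = if ∀ j, R (t j) then ∏ j, pairWeight ε α (t j) else 0 := by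
      intro R _
      split_ifs with h
      · exact Finset.prod_congr rfl fun j _ => if_pos (h j)
      · push Not at h
        obtain ⟨j, hj⟩ := h
        exact Finset.prod_eq_zero (Finset.mem_univ j) (if_neg hj)
    rw [hprod (fun u => u.1 = -1), hprod (fun u => u.2 = -1),
      hprod (fun u => u.1 = -1 ∧ u.2 = -1)]
    unfold clauseWeight
    have hand : (∀ j, (t j).1 = -1 ∧ (t j).2 = -1) ↔
        (∀ j, (t j).1 = -1) ∧ ∀ j, (t j).2 = -1 := forall_and
    rw [if_congr hand rfl rfl]
    split_ifs with ha hb hc <;> first | (exfalso; tauto) | (simp only [hq]; ring)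
  have s1 : ∑ u, pairWeight ε α u = 1 + α * ε ^ 2 := by
    simp only [Fintype.sum_prod_type, sum_units, pairWeight, slotWeight,
      show (1 : ℤˣ) ≠ -1 by decide, show (-1 : ℤˣ) ≠ 1 by decide, if_true, if_false]
    ring
  have s2 : ∑ u : ℤˣ × ℤˣ, (if u.1 = -1 then pairWeight ε α u else 0)
      = (1 + ε) / 2 * (1 + α * ε) := by
    simp only [Fintype.sum_prod_type, sum_units, pairWeight, slotWeight,
      show (1 : ℤˣ) ≠ -1 by decide, show (-1 : ℤˣ) ≠ 1 by decide, if_true, if_false]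
    ring
  have s3 : ∑ u : ℤˣ × ℤˣ, (if u.2 = -1 then pairWeight ε α u else 0)
      = (1 + ε) / 2 * (1 + α * ε) := by
    simp only [Fintype.sum_prod_type, sum_units, pairWeight, slotWeight,
      show (1 : ℤˣ) ≠ -1 by decide, if_true, if_false]
    ring
  have s4 : ∑ u : ℤˣ × ℤˣ, (if u.1 = -1 ∧ u.2 = -1 then pairWeight ε α u else 0)
      = (1 + ε) / 2 * ((1 + ε) / 2) * (1 + α) := by
    simp only [Fintype.sum_prod_type, sum_units, pairWeight, slotWeight,
      show (1 : ℤˣ) ≠ -1 by decide, if_true, if_false, and_true, and_false]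
    ring
  have e1 : q * ((1 + ε) / 2 * (1 + α * ε)) ^ k = ε * (1 + α * ε) ^ k := by
    rw [mul_pow, ← mul_assoc, ← hfix]
  have e2 : q ^ 2 * (((1 + ε) / 2) * ((1 + ε) / 2) * (1 + α)) ^ k = ε ^ 2 * (1 + α) ^ k := by
    rw [mul_pow, mul_pow]
    calc _ = (q * ((1 + ε) / 2) ^ k) ^ 2 * (1 + α) ^ k := by ring
      _ = _ := by rw [← hfix]
  rw [Finset.sum_congr rfl fun t _ => h1 t, Finset.sum_add_distrib, Finset.sum_sub_distrib,
    Finset.sum_sub_distrib, ← Finset.mul_sum, ← Finset.mul_sum, ← Finset.mul_sum,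
    sum_prod_pi (pairWeight ε α) k,
    sum_prod_pi (fun u : ℤˣ × ℤˣ => if u.1 = -1 then pairWeight ε α u else 0) k,
    sum_prod_pi (fun u : ℤˣ × ℤˣ => if u.2 = -1 then pairWeight ε α u else 0) k,
    sum_prod_pi (fun u : ℤˣ × ℤˣ => if u.1 = -1 ∧ u.2 = -1 then pairWeight ε α u else 0) k,
    s1, s2, s3, s4, e1, e2]
  unfold pairFactor
  ring

theorem prod_units_prod (g : ℤˣ × ℤˣ → ℝ) :
    ∏ u, g u = g (1, 1) * g (1, -1) * (g (-1, 1) * g (-1, -1)) := by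
  rw [Fintype.prod_prod_type, UnitsInt.univ, Finset.prod_pair (by decide),
    Finset.prod_pair (by decide), Finset.prod_pair (by decide)]

/-- The second moment of the Gibbs weights of two assignments of overlap `α * n`, up to a polynomial
factor. -/
theorem expect_weight_mul_weight_le (hn : 0 < n) (hd : Even d) (hN : m * k = n * d) {β ε : ℝ}
    (h0 : 0 ≤ ε) (h1 : ε < 1) (hfix : ε = (1 - Real.exp (-β)) * ((1 + ε) / 2) ^ k)
    (σ τ : Assignment n) :
    expect (fun Φ : Formula n d m k => weight β Φ σ * weight β Φ τ) * (1 - ε ^ 2) ^ (n * d)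
      ≤ (Real.exp 1 * (n * d + 1)) ^ 4 *
        pairFactor k ε ((2 * agreement σ τ - n : ℝ) / n) ^ m := by
  set A := agreement σ τ with hA
  have hAn : A ≤ n := agreement_le σ τ
  have hn0 : (0 : ℝ) < n := by exact_mod_cast hn
  have hAn' : (A : ℝ) ≤ n := by exact_mod_cast hAn
  set α : ℝ := (2 * A - n : ℝ) / n with hα
  have hα1 : (1 + α) / 4 = A / (2 * n) := by rw [hα]; field_simp; ring
  have hα2 : (1 - α) / 4 = (n - A) / (2 * n) := by rw [hα]; field_simp; ring
  have hα1p : 0 ≤ (1 + α) / 4 := by rw [hα1]; positivity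
  have hα2p : 0 ≤ (1 - α) / 4 := by
    rw [hα2]; exact div_nonneg (by linarith) (by positivity)
  set col : Fin n × Fin d → ℤˣ × ℤˣ := fun v => (literalValue σ v, literalValue τ v) with hcol
  have hy : ∀ u, 0 ≤ pairWeight ε α u := by
    intro u
    have a1 := (slotWeight_pos h0 h1 u.1).le
    have a2 := (slotWeight_pos h0 h1 u.2).le
    unfold pairWeight
    split_ifs <;> positivity
  set x := A * (d / 2) with hx
  set y := (n - A) * (d / 2) with hyd
  have hxy : 2 * (x + y) = n * d := by
    obtain ⟨r, rfl⟩ := hd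
    have : (r + r) / 2 = r := by omega
    rw [hx, hyd, this, ← add_mul, Nat.add_sub_cancel' hAn]; ring
  have hcnt : ∀ u u' : ℤˣ, Fintype.card {v : Fin n × Fin d // col v = (u, u')}
      = if u = u' then x else y := by
    intro u u'
    have := card_literalValue_pair hd σ τ u u'
    rw [hcol, this]
    split_ifs with h
    · subst h; rw [Int.units_mul_self]; rfl
    · have : u * u' = -1 := by clear * - h; revert u u'; decide
      rw [this, card_disagreement]
  set H : (Fin m × Fin k → ℤˣ × ℤˣ) → ℝ := fun T =>
    ∏ a, clauseWeight β (fun j => (T (a, j)).1) * clauseWeight β (fun j => (T (a, j)).2) with hH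
  have hkey := sum_equiv_mul_prod_le (V := Fin n × Fin d) (S := Fin m × Fin k) col
    (pairWeight ε α) hy H (fun T => Finset.prod_nonneg fun a _ =>
      mul_nonneg (clauseWeight_pos _ _).le (clauseWeight_pos _ _).le)
  have hS : ∑ T : Fin m × Fin k → ℤˣ × ℤˣ, (∏ s, pairWeight ε α (T s)) * H T
      = pairFactor k ε α ^ m := by
    rw [← sum_prod_pairWeight α hfix, ← sum_prod_pi]
    refine Fintype.sum_equiv (Equiv.curry (Fin m) (Fin k) (ℤˣ × ℤˣ)) _ _ fun T => ?_
    rw [Fintype.prod_prod_type, ← Finset.prod_mul_distrib]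
    rfl
  have hL : ∑ Φ : Formula n d m k, H (col ∘ Φ.symm)
      = ∑ Φ : Formula n d m k, weight β Φ σ * weight β Φ τ := by
    refine Finset.sum_congr rfl fun Φ _ => ?_
    rw [weight_eq_prod, weight_eq_prod, ← Finset.prod_mul_distrib]
    rfl
  have h11 : Fintype.card {v : Fin n × Fin d // col v = (1, 1)} = x := hcnt 1 1
  have h12 : Fintype.card {v : Fin n × Fin d // col v = (1, -1)} = y := by
    rw [hcnt, if_neg (by decide)]
  have h21 : Fintype.card {v : Fin n × Fin d // col v = (-1, 1)} = y := by
    rw [hcnt, if_neg (by decide)]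
  have h22 : Fintype.card {v : Fin n × Fin d // col v = (-1, -1)} = x := by
    rw [hcnt, if_pos rfl]
  rw [hL, hS, Nat.cast_prod, prod_units_prod, prod_units_prod, h11, h12, h21, h22] at hkey
  set E := ∑ Φ : Formula n d m k, weight β Φ σ * weight β Φ τ with hE
  have hE0 : 0 ≤ E := Finset.sum_nonneg fun Φ _ =>
    mul_nonneg (Real.exp_pos _).le (Real.exp_pos _).le
  set KM := pairFactor k ε α ^ m with hKM
  have hKM0 : 0 ≤ KM := by
    rw [← hS]
    exact Finset.sum_nonneg fun T _ => mul_nonneg (Finset.prod_nonneg fun s _ => hy _)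
      (Finset.prod_nonneg fun a _ => mul_nonneg (clauseWeight_pos _ _).le (clauseWeight_pos _ _).le)
  -- the counts of the pairs of truth values are `x, y, y, x`
  set N : ℕ := n * d with hNd
  have hNN : (N : ℝ) * ((1 + α) / 4) = x := by
    rw [hα1]
    have h2 : (2 : ℝ) * ((d / 2 : ℕ) : ℝ) = d := by
      exact_mod_cast Nat.two_mul_div_two_of_even hd
    rw [hNd, hx]; push_cast
    rw [← h2]; field_simp
  have hNN' : (N : ℝ) * ((1 - α) / 4) = y := by
    rw [hα2]
    have h2 : (2 : ℝ) * ((d / 2 : ℕ) : ℝ) = d := by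
      exact_mod_cast Nat.two_mul_div_two_of_even hd
    rw [hNd, hyd]; push_cast [Nat.cast_sub hAn]
    rw [← h2]; field_simp
  have hw : (N : ℝ) ^ N * (pairWeight ε α (1, 1) ^ x * pairWeight ε α (1, -1) ^ y *
      (pairWeight ε α (-1, 1) ^ y * pairWeight ε α (-1, -1) ^ x))
      = (1 - ε ^ 2) ^ N * ((x : ℝ) ^ x * (y : ℝ) ^ y) ^ 2 := by
    have hpow : ∀ z : ℝ, z ^ N = (z ^ x * z ^ y) ^ 2 := by
      intro z
      rw [← pow_add, ← pow_mul, mul_comm (x + y) 2, hxy]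
    have w1 : (N : ℝ) * pairWeight ε α (1, 1) = (1 - ε) * (1 - ε) * x := by
      rw [← hNN]
      simp only [pairWeight, slotWeight, show (1 : ℤˣ) ≠ -1 by decide, if_true, if_false]
      ring
    have w2 : (N : ℝ) * pairWeight ε α (1, -1) = (1 - ε) * (1 + ε) * y := by
      rw [← hNN']
      simp only [pairWeight, slotWeight, show (1 : ℤˣ) ≠ -1 by decide, if_true, if_false]
      ring
    have w3 : (N : ℝ) * pairWeight ε α (-1, 1) = (1 - ε) * (1 + ε) * y := by
      rw [← hNN']
      simp only [pairWeight, slotWeight, show (1 : ℤˣ) ≠ -1 by decide,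
        show (-1 : ℤˣ) ≠ 1 by decide, if_true, if_false]
      ring
    have w4 : (N : ℝ) * pairWeight ε α (-1, -1) = (1 + ε) * (1 + ε) * x := by
      rw [← hNN]
      simp only [pairWeight, slotWeight, if_true]
      ring
    have hs : (1 : ℝ) - ε ^ 2 = (1 - ε) * (1 + ε) := by ring
    rw [hpow N, hpow (1 - ε ^ 2), hs]
    calc _ = ((N : ℝ) * pairWeight ε α (1, 1)) ^ x * ((N : ℝ) * pairWeight ε α (1, -1)) ^ y *
        (((N : ℝ) * pairWeight ε α (-1, 1)) ^ y * ((N : ℝ) * pairWeight ε α (-1, -1)) ^ x) := by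
          simp only [mul_pow]; ring
      _ = _ := by
          rw [w1, w2, w3, w4]
          simp only [mul_pow]; ring
  have hmul := mul_le_mul_of_nonneg_left hkey (by positivity : (0 : ℝ) ≤ (N : ℝ) ^ N)
  have hstx := exp_mul_factorial_le x
  have hsty := exp_mul_factorial_le y
  have hstN := self_pow_le_exp_mul_factorial N
  have hself : ∀ z : ℕ, (0 : ℝ) < (z : ℝ) ^ z := by
    intro z
    rcases Nat.eq_zero_or_pos z with rfl | hz
    · simp
    · positivity
  have hxN : (x : ℝ) ≤ N := by exact_mod_cast (by omega : x ≤ N)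
  have hyN : (y : ℝ) ≤ N := by exact_mod_cast (by omega : y ≤ N)
  have hexpN : Real.exp N = (Real.exp x * Real.exp y) ^ 2 := by
    rw [← Real.exp_add, ← Real.exp_nat_mul]
    congr 1
    rw [← hxy]; push_cast; ring
  set Y : ℝ := ((x : ℝ) ^ x * (y : ℝ) ^ y) ^ 2 with hY
  have hY0 : 0 < Y := by have := hself x; have := hself y; positivity
  have hfac : Real.exp N * ((x.factorial : ℝ) * y.factorial * (y.factorial * x.factorial))
      ≤ (Real.exp 1 * (N + 1)) ^ 4 * Y := by
    have ex : Real.exp x * x.factorial ≤ Real.exp 1 * (N + 1) * (x : ℝ) ^ x :=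
      hstx.trans (mul_le_mul_of_nonneg_right (mul_le_mul_of_nonneg_left (by linarith)
        (Real.exp_pos _).le) (hself x).le)
    have ey : Real.exp y * y.factorial ≤ Real.exp 1 * (N + 1) * (y : ℝ) ^ y :=
      hsty.trans (mul_le_mul_of_nonneg_right (mul_le_mul_of_nonneg_left (by linarith)
        (Real.exp_pos _).le) (hself y).le)
    have exy := mul_le_mul ex ey (by positivity) (by positivity)
    have exy2 := pow_le_pow_left₀ (by positivity) exy 2
    calc _ = (Real.exp x * x.factorial * (Real.exp y * y.factorial)) ^ 2 := by
          rw [hexpN]; ring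
      _ ≤ _ := exy2
      _ = _ := by rw [hY]; ring
  have hfin : (E * (1 - ε ^ 2) ^ N) * Y ≤ ((N.factorial : ℝ) *
      ((Real.exp 1 * (N + 1)) ^ 4 * KM)) * Y := by
    calc (E * (1 - ε ^ 2) ^ N) * Y
        = (N : ℝ) ^ N * (E * (pairWeight ε α (1, 1) ^ x * pairWeight ε α (1, -1) ^ y *
          (pairWeight ε α (-1, 1) ^ y * pairWeight ε α (-1, -1) ^ x))) := by
          rw [mul_left_comm, hw]; ring
      _ ≤ (N : ℝ) ^ N * ((x.factorial : ℝ) * y.factorial * (y.factorial * x.factorial) * KM) :=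
          hmul
      _ ≤ (Real.exp N * N.factorial) *
            ((x.factorial : ℝ) * y.factorial * (y.factorial * x.factorial) * KM) :=
          mul_le_mul_of_nonneg_right hstN (by positivity)
      _ = N.factorial * KM * (Real.exp N *
            ((x.factorial : ℝ) * y.factorial * (y.factorial * x.factorial))) := by ring
      _ ≤ N.factorial * KM * ((Real.exp 1 * (N + 1)) ^ 4 * Y) :=
          mul_le_mul_of_nonneg_left hfac (by positivity)
      _ = _ := by ring
  have hfin2 := le_of_mul_le_mul_right hfin hY0
  have hfpos : (0 : ℝ) < N.factorial := by exact_mod_cast N.factorial_pos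
  unfold expect
  rw [card_formula hN, div_mul_eq_mul_div, div_le_iff₀ hfpos]
  refine hfin2.trans (le_of_eq ?_)
  rw [hNd]; push_cast; ring

/-! ### The second moment function away from overlap one -/

theorem one_add_pow_le_quadratic {t : ℝ} (h1 : -1 ≤ t) (h2 : |k * t| ≤ 1) :
    (1 + t) ^ k ≤ 1 + k * t + (k * t) ^ 2 := by
  have a1 : (1 + t) ^ k ≤ Real.exp (k * t) := by
    rw [Real.exp_nat_mul]
    exact pow_le_pow_left₀ (by linarith) (by linarith [Real.add_one_le_exp t]) k
  have a2 := (abs_le.1 (Real.abs_exp_sub_one_sub_id_le h2)).2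
  linarith

theorem one_add_pow_le_quadratic_of_nonpos {t : ℝ} (h1 : -1 ≤ t) (h2 : t ≤ 0) :
    (1 + t) ^ k ≤ 1 + k * t + (k * t) ^ 2 := by
  by_cases h : |(k : ℝ) * t| ≤ 1
  · exact one_add_pow_le_quadratic h1 h
  · have h3 : (k : ℝ) * t ≤ 0 := mul_nonpos_of_nonneg_of_nonpos (Nat.cast_nonneg k) h2
    rw [abs_of_nonpos h3] at h
    have h4 : (1 + t) ^ k ≤ 1 := pow_le_one₀ (by linarith) (by linarith)
    nlinarith

theorem one_add_pow_sub_le (k : ℕ) {t : ℝ} (ht : 0 ≤ t) :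
    (1 + t) ^ k - 1 - k * t ≤ k ^ 2 * t ^ 2 * (1 + t) ^ k := by
  have h1 : ∀ k : ℕ, (1 + t) ^ k - 1 ≤ k * t * (1 + t) ^ k := by
    intro k
    induction k with
    | zero => simp
    | succ k ih =>
      have hp : 0 ≤ (1 + t) ^ k := by positivity
      have : 0 ≤ (k : ℝ) * t * t * (1 + t) ^ k := by positivity
      have : 0 ≤ t * t * (1 + t) ^ k := by positivity
      rw [pow_succ]; push_cast
      nlinarith
  induction k with
  | zero => simp
  | succ k ih =>
    have h2 := mul_le_mul_of_nonneg_left (h1 k) ht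
    have hp : 0 ≤ (1 + t) ^ k := by positivity
    have a1 : 0 ≤ (k : ℝ) * t ^ 2 * (1 + t) ^ k := by positivity
    have a2 : 0 ≤ t ^ 2 * (1 + t) ^ k := by positivity
    have a3 : 0 ≤ ((k : ℝ) + 1) ^ 2 * t ^ 2 * t * (1 + t) ^ k := by positivity
    rw [pow_succ]; push_cast
    nlinarith

/-- The linear terms in `α` cancel: this is what the fixed point equation for `ε` achieves. -/
theorem pairFactor_sub_le {ε α : ℝ} (h0 : 0 ≤ ε) (hkε : k * ε ≤ 1) (hε : ε ≤ 1)
    (hα : -1 ≤ α) (hα1 : α ≤ 1) :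
    pairFactor k ε α - (1 - ε) ^ 2
      ≤ ε ^ 2 * ((1 + α) ^ k - 1 - k * α + k ^ 2 * α ^ 2 * ε ^ 2) := by
  have habs : |α| ≤ 1 := abs_le.2 ⟨hα, hα1⟩
  have hε2 : ε ^ 2 ≤ 1 := by nlinarith
  have a1 : (1 + α * ε ^ 2) ^ k ≤ 1 + k * (α * ε ^ 2) + (k * (α * ε ^ 2)) ^ 2 := by
    refine one_add_pow_le_quadratic ?_ ?_
    · nlinarith [sq_nonneg ε]
    · rw [abs_mul, abs_mul, Nat.abs_cast, abs_of_nonneg (sq_nonneg ε)]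
      calc (k : ℝ) * (|α| * ε ^ 2) ≤ k * (1 * ε ^ 2) := by gcongr
        _ = (k * ε) * ε := by ring
        _ ≤ 1 * 1 := mul_le_mul hkε hε h0 zero_le_one
        _ = 1 := one_mul 1
  have a2 : 1 + k * (α * ε) ≤ (1 + α * ε) ^ k := by
    refine one_add_mul_le_pow ?_ k
    nlinarith
  have a3 := mul_le_mul_of_nonneg_left a2 (by linarith : (0 : ℝ) ≤ 2 * ε)
  unfold pairFactor
  nlinarith

/-- The fixed point `ε` exceeds `2 ^ (-k)` by so little that the coefficient of `(1 + α) ^ k` in the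
growth rate exceeds `log 2 / 2 ^ k` only by a factor `1 + O(k / 2 ^ k)`. -/
theorem prefactor_le {U ε D w : ℝ} (hU : 0 < U) (hw0 : 0 ≤ w) (hw1 : w ≤ 1 / 1000)
    (hwU : 1 ≤ w * U) (h0 : 0 ≤ ε) (hεU : ε * U ≤ 1 + 4 * w) (hεw : ε ≤ w)
    (hD : D ≤ U * Real.log 2 + 2) :
    D * ε ^ 2 / (1 - ε) ^ 2 * U ≤ Real.log 2 * (1 + 100 * w) := by
  have hl2 : 0.6931471803 < Real.log 2 := Real.log_two_gt_d9
  have h1ε : 0 < (1 - ε) ^ 2 := by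
    have : 0 < 1 - ε := by linarith
    positivity
  rw [div_mul_eq_mul_div, div_le_iff₀ h1ε]
  have b1 : D * ε ^ 2 * U ≤ (Real.log 2 + 2 * w) * (1 + 4 * w) ^ 2 := by
    have c1 : D ≤ (Real.log 2 + 2 * w) * U := by linarith
    have c2 : (ε * U) ^ 2 ≤ (1 + 4 * w) ^ 2 := pow_le_pow_left₀ (by positivity) hεU 2
    have c3 : D * ε ^ 2 * U * U ≤ (Real.log 2 + 2 * w) * (1 + 4 * w) ^ 2 * U := by
      calc D * ε ^ 2 * U * U = D * (ε * U) ^ 2 := by ring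
        _ ≤ ((Real.log 2 + 2 * w) * U) * (1 + 4 * w) ^ 2 :=
            mul_le_mul c1 c2 (by positivity) (by positivity)
        _ = _ := by ring
    exact le_of_mul_le_mul_right c3 hU
  have b2 : 1 - 2 * w ≤ (1 - ε) ^ 2 := by nlinarith
  have b3 : (Real.log 2 + 2 * w) * (1 + 4 * w) ^ 2
      ≤ Real.log 2 * (1 + 100 * w) * (1 - 2 * w) := by
    have d1 : (1 + 4 * w) ^ 2 ≤ 1 + 9 * w := by nlinarith
    have d2 : (Real.log 2 + 2 * w) ≤ Real.log 2 * (1 + 3 * w) := by nlinarith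
    have d3 : (1 + 3 * w) * (1 + 9 * w) ≤ (1 + 100 * w) * (1 - 2 * w) := by nlinarith
    calc (Real.log 2 + 2 * w) * (1 + 4 * w) ^ 2
        ≤ (Real.log 2 * (1 + 3 * w)) * (1 + 9 * w) :=
          mul_le_mul d2 d1 (by positivity) (by positivity)
      _ = Real.log 2 * ((1 + 3 * w) * (1 + 9 * w)) := by ring
      _ ≤ Real.log 2 * ((1 + 100 * w) * (1 - 2 * w)) :=
          mul_le_mul_of_nonneg_left d3 (by linarith)
      _ = _ := by ring
  refine b1.trans (b3.trans ?_)
  exact mul_le_mul_of_nonneg_left b2 (by positivity)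

theorem exp_neg_le_one_div_seven {x : ℝ} (hx : 2 ≤ x) : Real.exp (-x) ≤ 1 / 7 := by
  refine (Real.exp_le_exp.2 (neg_le_neg hx)).trans ?_
  rw [Real.exp_neg, inv_eq_one_div]
  refine one_div_le_one_div_of_le (by norm_num) ?_
  have := Real.exp_one_gt_d9
  have e2 : Real.exp 2 = Real.exp 1 * Real.exp 1 := by rw [← Real.exp_add]; norm_num
  rw [e2]; nlinarith

theorem exp_neg_le_one_sub_div_three {x : ℝ} (hx0 : 0 ≤ x) (hx : x ≤ 2) :
    Real.exp (-x) ≤ 1 - x / 3 := by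
  rw [Real.exp_neg]
  have a1 : 1 + x ≤ Real.exp x := by linarith [Real.add_one_le_exp x]
  rw [inv_le_comm₀ (Real.exp_pos _) (by linarith)]
  refine le_trans ?_ a1
  rw [inv_le_iff_one_le_mul₀ (by linarith)]
  nlinarith

set_option maxHeartbeats 400000 in
/-- If there are at most (about) `2 ^ k * log 2` clauses per variable, then the exponential growth
rate of the pair weights at overlap `α` is at most the loss of entropy, which is bounded below
either by `α ^ 2 / 2` or, near overlap one, by `log 2 - δ + δ * log δ` where `δ` is the fraction of
disagreements. -/
theorem excess_le {ε D α : ℝ} (hk : 20 ≤ k) (hku : 1000 * (k : ℝ) ≤ 2 ^ k)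
    (hk2 : 8 * (k : ℝ) ^ 2 ≤ 2 ^ k) (hk34 : 8 * (k : ℝ) ^ 2 * (3 / 2) ^ k ≤ 2 ^ k)
    (hk10 : 200 * (k : ℝ) ≤ (2 : ℝ) ^ k * (2 : ℝ) ^ (-(k : ℝ) / 10))
    (h0 : 0 ≤ ε) (hε : ε * 2 ^ k ≤ 1 + 4 * k / 2 ^ k) (hD0 : 0 ≤ D)
    (hD : D ≤ 2 ^ k * Real.log 2 + 2) (hα : -1 ≤ α)
    (hα1 : α ≤ 1 - (2 : ℝ) ^ (-(k : ℝ) / 10)) :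
    D * (pairFactor k ε α / (1 - ε) ^ 2 - 1) ≤ α ^ 2 / 2 ∨
      (0 < (1 - α) / 2 ∧ D * (pairFactor k ε α / (1 - ε) ^ 2 - 1)
        ≤ Real.log 2 - (1 - α) / 2 + (1 - α) / 2 * Real.log ((1 - α) / 2)) := by
  have hl1 : Real.log 2 < 0.6931471808 := Real.log_two_lt_d9
  have hl2 : 0.6931471803 < Real.log 2 := Real.log_two_gt_d9
  have hkR : (20 : ℝ) ≤ k := by exact_mod_cast hk
  set U : ℝ := 2 ^ k with hU
  have hU0 : 0 < U := by positivity
  have hU20 : 20000 ≤ U := by linarith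
  set w : ℝ := k / U with hw
  have hw0 : 0 ≤ w := by positivity
  have hw1 : w ≤ 1 / 1000 := by rw [hw, div_le_iff₀ hU0]; linarith
  have hw2 : k * w ≤ 1 / 8 := by
    rw [hw, mul_div_assoc', div_le_iff₀ hU0]; linarith
  have hwU : w * U = k := by rw [hw]; field_simp
  have hεU : ε * U ≤ 1 + 4 * w := by rw [hw, mul_div_assoc']; exact hε
  have hε1 : ε * U ≤ 1.004 := by linarith
  have hεs : ε ≤ 1 / 1000 := by
    have h1 := mul_le_mul_of_nonneg_left hU20 h0
    linarith
  have hεw : ε ≤ w := by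
    have : ε * U ≤ w * U := by rw [hwU]; linarith
    exact le_of_mul_le_mul_right this hU0
  have hkε : k * ε ≤ 1 := by
    have := mul_le_mul_of_nonneg_left hεw (by linarith : (0 : ℝ) ≤ k)
    linarith
  have h1ε : 0 < (1 - ε) ^ 2 := by
    have : 0 < 1 - ε := by linarith
    positivity
  -- the prefactor `X` of the excess
  set X : ℝ := D * ε ^ 2 / (1 - ε) ^ 2 with hX
  have hX0 : 0 ≤ X := by positivity
  have hXU : X * U ≤ Real.log 2 * (1 + 100 * w) :=
    prefactor_le hU0 hw0 hw1 (by rw [hwU]; linarith) h0 hεU hεw hD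
  have hl100 : Real.log 2 * (1 + 100 * w) ≤ 0.7 * 1.1 :=
    mul_le_mul (by linarith) (by linarith) (by positivity) (by norm_num)
  have hXle : X * U ≤ 1 := by linarith
  have hrp : 0 < (2 : ℝ) ^ (-(k : ℝ) / 10) := by positivity
  have hα1' : α ≤ 1 := by linarith
  have hex : ∀ R : ℝ, (1 + α) ^ k - 1 - k * α + k ^ 2 * α ^ 2 * ε ^ 2 ≤ R →
      D * (pairFactor k ε α / (1 - ε) ^ 2 - 1) ≤ X * R := by
    intro R hR
    have a1 := pairFactor_sub_le h0 hkε (by linarith) hα hα1'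
    have a2 : pairFactor k ε α / (1 - ε) ^ 2 - 1 = (pairFactor k ε α - (1 - ε) ^ 2)
        / (1 - ε) ^ 2 := by rw [sub_div, div_self h1ε.ne']
    have a3 : X * R = D * (ε ^ 2 * R / (1 - ε) ^ 2) := by rw [hX]; ring
    rw [a2, a3]
    refine mul_le_mul_of_nonneg_left ?_ hD0
    refine div_le_div_of_nonneg_right (a1.trans ?_) h1ε.le
    exact mul_le_mul_of_nonneg_left hR (sq_nonneg ε)
  have hε21 : ε ^ 2 ≤ 1 := pow_le_one₀ h0 (by linarith)
  have hk2α : 0 ≤ (k : ℝ) ^ 2 * α ^ 2 := by positivity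
  rcases le_total α (1 / 2) with hhalf | hhalf
  · left
    -- for `α ≤ 1 / 2` the excess is quadratic in `α`, with a small coefficient
    have hR : (1 + α) ^ k - 1 - k * α + k ^ 2 * α ^ 2 * ε ^ 2
        ≤ k ^ 2 * α ^ 2 * ((3 / 2) ^ k + 1) := by
      have e1 : (k : ℝ) ^ 2 * α ^ 2 * ε ^ 2 ≤ k ^ 2 * α ^ 2 :=
        mul_le_of_le_one_right hk2α hε21
      have e2 : (1 : ℝ) ≤ (3 / 2) ^ k := one_le_pow₀ (by norm_num)
      rcases le_total α 0 with hneg | hpos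
      · have := one_add_pow_le_quadratic_of_nonpos (k := k) hα hneg
        have e3 := le_mul_of_one_le_right hk2α e2
        rw [mul_pow] at this
        linarith
      · have b1 := one_add_pow_sub_le k hpos
        have b2 : (1 + α) ^ k ≤ (3 / 2) ^ k := pow_le_pow_left₀ (by linarith) (by linarith) k
        have b3 := mul_le_mul_of_nonneg_left b2 hk2α
        linarith
    refine (hex _ hR).trans ?_
    have e3 : (k : ℝ) ^ 2 * ((3 / 2) ^ k + 1) ≤ U / 2 := by
      rw [mul_add]; linarith
    have e4 : X * ((k : ℝ) ^ 2 * ((3 / 2) ^ k + 1)) ≤ 1 / 2 := by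
      have := mul_le_mul_of_nonneg_left e3 hX0
      linarith
    have := mul_le_mul_of_nonneg_right e4 (sq_nonneg α)
    linarith
  · set δ : ℝ := (1 - α) / 2 with hδ
    have hδpos : (2 : ℝ) ^ (-(k : ℝ) / 10) / 2 ≤ δ := by rw [hδ]; linarith
    have hδ0 : 0 < δ := by linarith
    have hR : (1 + α) ^ k - 1 - k * α + k ^ 2 * α ^ 2 * ε ^ 2 ≤ U * Real.exp (-(k * δ)) := by
      have e1 : (1 + α) ^ k ≤ U * Real.exp (-(k * δ)) := by
        have : 1 + α = 2 * (1 - δ) := by rw [hδ]; ring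
        rw [this, mul_pow, ← mul_neg, Real.exp_nat_mul]
        refine mul_le_mul_of_nonneg_left ?_ hU0.le
        exact pow_le_pow_left₀ (by rw [hδ]; linarith) (Real.one_sub_le_exp_neg δ) k
      have e2 : (k : ℝ) ^ 2 * α ^ 2 * ε ^ 2 ≤ 1 := by
        have : (k : ℝ) ^ 2 * α ^ 2 * ε ^ 2 = (k * ε * α) ^ 2 := by ring
        rw [this]
        have h3 : 0 ≤ k * ε * α := by positivity
        have h4 : k * ε * α ≤ 1 := by
          calc k * ε * α ≤ 1 * 1 := mul_le_mul hkε hα1' (by linarith) zero_le_one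
            _ = 1 := one_mul 1
        exact pow_le_one₀ h3 h4
      have e3 : 0 ≤ (k : ℝ) * α := by positivity
      linarith
    have hmain := hex _ hR
    have hmain2 : X * (U * Real.exp (-(k * δ)))
        ≤ Real.log 2 * (1 + 100 * w) * Real.exp (-(k * δ)) := by
      rw [← mul_assoc]
      exact mul_le_mul_of_nonneg_right hXU (Real.exp_pos _).le
    rcases le_total 2 (k * δ) with hfar | hnear
    · left
      -- the excess is at most `log 2 / 7 * 1.1 < 1 / 8 ≤ α ^ 2 / 2`
      refine hmain.trans (hmain2.trans ?_)
      have e1 : Real.exp (-(k * δ)) ≤ 1 / 7 := exp_neg_le_one_div_seven hfar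
      have e3 := mul_le_mul hl100 e1 (Real.exp_pos _).le (by norm_num)
      have e4 : (1 / 2 : ℝ) * (1 / 2) ≤ α * α := mul_le_mul hhalf hhalf (by norm_num) (by linarith)
      rw [pow_two]
      linarith
    · right
      -- here `exp (-k * δ)` falls short of one by at least `k * δ / 3`, which beats
      -- `δ * log (1 / δ)` as `δ ≥ 2 ^ (-k / 10) / 2`
      refine ⟨hδ0, hmain.trans (hmain2.trans ?_)⟩
      have hx0 : 0 ≤ k * δ := by positivity
      have e1 : Real.exp (-(k * δ)) ≤ 1 - k * δ / 3 := exp_neg_le_one_sub_div_three hx0 hnear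
      have e1' : Real.exp (-(k * δ)) ≤ 1 := by linarith
      have e2 : 100 * w ≤ δ := by
        refine le_trans ?_ hδpos
        rw [hw, mul_div_assoc', div_le_iff₀ hU0]
        linarith
      have e3 : -Real.log δ ≤ Real.log 2 * (1 + k / 10) := by
        have h1 := Real.log_le_log (by positivity) hδpos
        rw [Real.log_div hrp.ne' two_ne_zero, Real.log_rpow two_pos] at h1
        linarith
      have e4 : Real.log 2 * (1 + 100 * w) * Real.exp (-(k * δ))
          ≤ Real.log 2 * (1 - k * δ / 3) + Real.log 2 * δ := by
        have b1 := mul_le_mul_of_nonneg_left e1 (by linarith : 0 ≤ Real.log 2)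
        have b2 : Real.log 2 * (100 * w) * Real.exp (-(k * δ)) ≤ Real.log 2 * δ * 1 :=
          mul_le_mul (mul_le_mul_of_nonneg_left e2 (by linarith)) e1' (Real.exp_pos _).le
            (by positivity)
        linarith
      have e5 := mul_le_mul_of_nonneg_left e3 hδ0.le
      have e6 : δ * (1 + Real.log 2 * 2 + Real.log 2 * (k / 10)) ≤ δ * (Real.log 2 * (k / 3)) := by
        refine mul_le_mul_of_nonneg_left ?_ hδ0.le
        have := mul_le_mul_of_nonneg_right hl2.le (by linarith : (0 : ℝ) ≤ k)
        linarith
      linarith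

/-! ### The fixed point -/

/-- The fixed point exceeds `2 ^ (-k)` at most by a factor `1 + O(k / 2 ^ k)`. -/
theorem exists_fixedPoint (hk : 0 < k) (hku : 1000 * (k : ℝ) ≤ 2 ^ k) {β : ℝ} (hβ : 0 < β) :
    ∃ ε : ℝ, 0 ≤ ε ∧ ε < 1 ∧ ε = (1 - Real.exp (-β)) * ((1 + ε) / 2) ^ k ∧
      ε * 2 ^ k ≤ 1 + 4 * k / 2 ^ k := by
  have hk1 : (1 : ℝ) ≤ k := by exact_mod_cast hk
  set U : ℝ := 2 ^ k with hU
  have hU0 : 0 < U := by positivity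
  set q := 1 - Real.exp (-β) with hq
  have hq0 : 0 ≤ q := by
    have : Real.exp (-β) ≤ 1 := Real.exp_le_one_iff.2 (by linarith)
    linarith
  have hq1 : q ≤ 1 := by linarith [Real.exp_pos (-β)]
  have hpow : ∀ ε : ℝ, 0 ≤ ε → ε ≤ 2 / U → q * (1 + ε) ^ k ≤ 1 + 4 * k / U := by
    intro ε h0 hε
    have hkε : k * ε ≤ 2 * k / U := by
      calc k * ε ≤ k * (2 / U) := mul_le_mul_of_nonneg_left hε (by linarith)
        _ = 2 * k / U := by ring
    have hsmall : 2 * k / U ≤ 1 := by rw [div_le_one hU0]; linarith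
    have hkε0 : 0 ≤ k * ε := by positivity
    have h1 := one_add_pow_le_quadratic (k := k) (t := ε) (by linarith)
      (by rw [abs_of_nonneg hkε0]; linarith)
    have h2 : (k * ε) ^ 2 ≤ k * ε := by nlinarith
    have h3 : 4 * k / U = 2 * (2 * k / U) := by ring
    have h4 : q * (1 + ε) ^ k ≤ (1 + ε) ^ k := mul_le_of_le_one_left (by positivity) hq1
    linarith
  have hcont : ContinuousOn (fun ε : ℝ => ε - q * ((1 + ε) / 2) ^ k) (Set.Icc 0 (2 / U)) := by
    fun_prop
  have hdiv : ∀ ε : ℝ, q * ((1 + ε) / 2) ^ k = q * (1 + ε) ^ k / U := by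
    intro ε; rw [div_pow, mul_div_assoc]
  have hmem : (0 : ℝ) ∈ Set.Icc ((0 : ℝ) - q * ((1 + 0) / 2) ^ k)
      (2 / U - q * ((1 + 2 / U) / 2) ^ k) := by
    constructor
    · have : 0 ≤ q * ((1 + (0 : ℝ)) / 2) ^ k := by positivity
      linarith
    · rw [hdiv, ← sub_div]
      refine div_nonneg ?_ hU0.le
      have := hpow (2 / U) (by positivity) le_rfl
      have h4 : 4 * k / U ≤ 1 := by rw [div_le_one hU0]; linarith
      linarith
  obtain ⟨ε, ⟨h0, hε⟩, hroot⟩ := intermediate_value_Icc (by positivity) hcont hmem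
  have hfix : ε = q * ((1 + ε) / 2) ^ k := by
    have : ε - q * ((1 + ε) / 2) ^ k = 0 := hroot
    linarith
  refine ⟨ε, h0, ?_, hfix, ?_⟩
  · refine hε.trans_lt ?_
    rw [div_lt_one hU0]; linarith
  · have h1 := hpow ε h0 hε
    have h2 : ε * U = q * (1 + ε) ^ k := by
      rw [hdiv, eq_div_iff hU0.ne'] at hfix
      exact hfix
    rw [h2]; exact h1

/-! ### The first moment bound on the satisfiability threshold -/

theorem expect_weight_le (hd : Even d) (hN : m * k = n * d) (β : ℝ) (σ : Assignment n) :
    expect (fun Φ : Formula n d m k => weight β Φ σ)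
      ≤ (n * d + 1) * (1 - (1 - Real.exp (-β)) / 2 ^ k) ^ m := by
  rw [expect_weight hd hN (β := β) le_rfl one_pos]
  have h2 := (four_pow_div_centralBinom (n * (d / 2))).2
  have e : (2 : ℝ) * (n * (d / 2) : ℕ) = n * d := by
    exact_mod_cast (two_mul_half hd hN).symm.trans hN
  rw [e] at h2
  have h3 : balancedMass β 0 m k (n * (d / 2)) ≤ (1 - (1 - Real.exp (-β)) / 2 ^ k) ^ m := by
    refine (Finset.sum_le_univ_sum_of_nonneg fun T =>
      Finset.prod_nonneg fun a _ => (tiltedLaw_pos β le_rfl one_pos _).le).trans (le_of_eq ?_)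
    rw [sum_prod_pi]
    congr 1
    unfold tiltedLaw
    rw [← Finset.sum_div, sum_prod_mul_clauseWeight, slotWeight_add, slotWeight_neg_one]
    simp [div_eq_mul_inv]
  simp only [sub_zero, one_pow, ne_eq, OfNat.ofNat_ne_zero, not_false_eq_true, zero_pow, div_one,
    mul_one]
  exact mul_le_mul h2 h3 (balancedMass_nonneg β le_rfl one_pos _ _ _) (by positivity)

theorem satProb_nonneg : 0 ≤ satProb n d m k := by
  unfold satProb expect
  refine div_nonneg (Finset.sum_nonneg fun Φ _ => ?_) (Nat.cast_nonneg _)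
  split_ifs <;> norm_num

theorem satProb_le (hd : Even d) (hN : m * k = n * d) (β : ℝ) :
    satProb n d m k ≤ 2 ^ n * ((n * d + 1) * (1 - (1 - Real.exp (-β)) / 2 ^ k) ^ m) := by
  have h1 : satProb n d m k ≤ expect (fun Φ : Formula n d m k => partitionFunction β Φ) := by
    unfold satProb
    refine expect_mono fun Φ => ?_
    split_ifs with h
    · obtain ⟨σ, hσ⟩ := h
      have hw : weight β Φ σ = 1 := by simp [weight, hσ]
      rw [← hw]
      exact Finset.single_le_sum (f := fun σ => weight β Φ σ) (fun τ _ => (Real.exp_pos _).le)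
        (Finset.mem_univ σ)
    · exact (partitionFunction_pos β Φ).le
  refine h1.trans ?_
  rw [expect_partitionFunction]
  refine (Finset.sum_le_sum fun σ _ => expect_weight_le hd hN β σ).trans (le_of_eq ?_)
  rw [Finset.sum_const, nsmul_eq_mul, Finset.card_univ]
  simp

theorem tendsto_satProb_zero (hk : 0 < k) (hd : Even d) (hdk : k * 2 ^ k * Real.log 2 < d) :
    Tendsto (fun n : ℕ => satProb n d (d * n / k) k) (nLimit d k) (𝓝 0) := by
  have hk0 : (0 : ℝ) < k := by exact_mod_cast hk
  have hl2 := Real.log_pos one_lt_two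
  have hd0 : (0 : ℝ) < d := lt_of_le_of_lt (by positivity) hdk
  obtain ⟨q, hq, hq1⟩ := exists_between ((div_lt_one hd0).2 hdk)
  have hq0 : 0 < q := lt_of_le_of_lt (by positivity) hq
  rw [div_lt_iff₀ hd0] at hq
  -- the inverse temperature at which a violated clause has weight `1 - q`
  set β := -Real.log (1 - q) with hβ
  have hβq : 1 - Real.exp (-β) = q := by
    rw [hβ, neg_neg, Real.exp_log (by linarith)]; ring
  set c : ℝ := q * d / (k * 2 ^ k) - Real.log 2 with hc
  have hc0 : 0 < c := by
    rw [hc, sub_pos, lt_div_iff₀ (by positivity)]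
    linarith
  have hlim : Tendsto (fun n : ℕ => Real.exp (-(c / 2 * n))) (nLimit d k) (𝓝 0) := by
    refine Real.tendsto_exp_neg_atTop_nhds_zero.comp ?_
    refine Tendsto.mono_left ?_ (inf_le_left : nLimit d k ≤ atTop)
    exact tendsto_natCast_atTop_atTop.const_mul_atTop (half_pos hc0)
  refine squeeze_zero' (Eventually.of_forall fun n => satProb_nonneg) ?_ hlim
  filter_upwards [eventually_dvd, eventually_nLimit
    (eventually_poly_le_exp (d + 1) 1 (half_pos hc0))] with n hdvd hpoly
  have hN := mul_eq_of_dvd hdvd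
  have hN' : ((d * n / k : ℕ) : ℝ) * k = n * d := by exact_mod_cast hN
  have hm : ((d * n / k : ℕ) : ℝ) = n * d / k := by rw [eq_div_iff hk0.ne', hN']
  have h1 := satProb_le hd hN β
  rw [hβq] at h1
  have h2 : (1 - q / 2 ^ k : ℝ) ^ (d * n / k) ≤ Real.exp (-(c + Real.log 2) * n) := by
    have a1 : 0 ≤ 1 - q / (2 : ℝ) ^ k := by
      rw [sub_nonneg, div_le_one (by positivity)]
      exact hq1.le.trans (one_le_pow₀ one_le_two)
    refine (pow_le_pow_left₀ a1 (Real.one_sub_le_exp_neg _) _).trans (le_of_eq ?_)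
    rw [← Real.exp_nat_mul, hm, hc]
    congr 1
    field_simp
    ring
  have h3 : (2 : ℝ) ^ n = Real.exp (Real.log 2 * n) := by
    rw [mul_comm, Real.exp_nat_mul, Real.exp_log two_pos]
  have h4 : (n * d + 1 : ℝ) ≤ Real.exp (c / 2 * n) := by
    refine le_trans ?_ hpoly
    have : (0 : ℝ) ≤ n := Nat.cast_nonneg n
    rw [pow_one]; nlinarith
  calc satProb n d (d * n / k) k
      ≤ 2 ^ n * ((n * d + 1) * (1 - q / 2 ^ k) ^ (d * n / k)) := h1
    _ ≤ Real.exp (Real.log 2 * n) * (Real.exp (c / 2 * n) *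
          Real.exp (-(c + Real.log 2) * n)) := by
        rw [h3]
        refine mul_le_mul_of_nonneg_left ?_ (Real.exp_pos _).le
        refine mul_le_mul h4 h2 ?_ (Real.exp_pos _).le
        refine pow_nonneg ?_ _
        rw [sub_nonneg, div_le_one (by positivity)]
        exact hq1.le.trans (one_le_pow₀ one_le_two)
    _ = Real.exp (-(c / 2 * n)) := by
        rw [← Real.exp_add, ← Real.exp_add]; congr 1; ring

theorem dSAT_le (hk : 0 < k) : dSAT k ≤ k * (2 ^ k * Real.log 2 + 2) := by
  have hk1 : (1 : ℝ) ≤ k := by exact_mod_cast hk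
  have hl2 := Real.log_pos one_lt_two
  refine csSup_le ⟨0, fun d _ hd => absurd hd (not_lt.2 (Nat.cast_nonneg d))⟩ fun D hD => ?_
  by_contra! hlt
  set x : ℝ := k * 2 ^ k * Real.log 2 with hx
  have hx0 : 0 ≤ x := by positivity
  set r : ℕ := ⌊x / 2⌋₊ + 1 with hr
  have hr1 : x < (r + r : ℕ) := by
    have := Nat.lt_floor_add_one (x / 2)
    rw [hr]; push_cast; linarith
  have hr2 : ((r + r : ℕ) : ℝ) < D := by
    have := Nat.floor_le (by positivity : 0 ≤ x / 2)
    rw [hr]; push_cast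
    have e : (k : ℝ) * (2 ^ k * Real.log 2 + 2) = x + 2 * k := by rw [hx]; ring
    rw [e] at hlt
    linarith
  have hpos := hD (r + r) ⟨r, rfl⟩ hr2
  have := nLimit_neBot (d := r + r) hk
  rw [(tendsto_satProb_zero hk ⟨r, rfl⟩ hr1).liminf_eq] at hpos
  exact lt_irrefl _ hpos

/-! ### Clause lengths to which the estimates apply -/

theorem eventually_mul_pow_le_pow (A : ℝ) (p : ℕ) {r : ℝ} (hr : 1 < r) :
    ∀ᶠ k : ℕ in atTop, A * (k : ℝ) ^ p ≤ r ^ k := by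
  have h := tendsto_pow_const_div_const_pow_of_one_lt p hr
  have h2 := (h.const_mul A).eventually (gt_mem_nhds (by simp : A * 0 < 1))
  filter_upwards [h2] with k hk
  have hpos : 0 < r ^ k := by positivity
  rw [mul_div_assoc', div_lt_one hpos] at hk
  exact hk.le

theorem eventually_clauseLength : ∀ᶠ k : ℕ in atTop,
    20 ≤ k ∧ 1000 * (k : ℝ) ≤ 2 ^ k ∧ 8 * (k : ℝ) ^ 2 ≤ 2 ^ k ∧
      8 * (k : ℝ) ^ 2 * (3 / 2) ^ k ≤ 2 ^ k ∧
      200 * (k : ℝ) ≤ (2 : ℝ) ^ k * (2 : ℝ) ^ (-(k : ℝ) / 10) := by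
  have hr : (1 : ℝ) < (2 : ℝ) ^ (9 / 10 : ℝ) := Real.one_lt_rpow one_lt_two (by norm_num)
  filter_upwards [eventually_ge_atTop 20, eventually_mul_pow_le_pow 1000 1 one_lt_two,
    eventually_mul_pow_le_pow 8 2 one_lt_two,
    eventually_mul_pow_le_pow 8 2 (by norm_num : (1 : ℝ) < 4 / 3),
    eventually_mul_pow_le_pow 200 1 hr] with k h1 h2 h3 h4 h5
  refine ⟨h1, by simpa using h2, h3, ?_, ?_⟩
  · have e : (2 : ℝ) ^ k = (4 / 3) ^ k * (3 / 2) ^ k := by rw [← mul_pow]; norm_num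
    rw [e]
    exact mul_le_mul_of_nonneg_right h4 (by positivity)
  · rw [pow_one] at h5
    refine h5.trans (le_of_eq ?_)
    rw [← Real.rpow_natCast, ← Real.rpow_natCast, ← Real.rpow_mul two_pos.le,
      ← Real.rpow_add two_pos]
    congr 1
    ring

/-! ### Pairs of assignments in different clusters -/

theorem pairFactor_nonneg {β ε α : ℝ} (h0 : 0 ≤ ε) (h1 : ε < 1)
    (hfix : ε = (1 - Real.exp (-β)) * ((1 + ε) / 2) ^ k) (hα : -1 ≤ α) (hα1 : α ≤ 1) :
    0 ≤ pairFactor k ε α := by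
  rw [← sum_prod_pairWeight α hfix]
  refine Finset.sum_nonneg fun t _ => mul_nonneg (Finset.prod_nonneg fun j _ => ?_)
    (mul_nonneg (clauseWeight_pos _ _).le (clauseWeight_pos _ _).le)
  have a1 := (slotWeight_pos h0 h1 (t j).1).le
  have a2 := (slotWeight_pos h0 h1 (t j).2).le
  have a3 : 0 ≤ (1 + α) / 4 := by linarith
  have a4 : 0 ≤ (1 - α) / 4 := by linarith
  unfold pairWeight
  split_ifs <;> positivity

/-- The Chernoff bound, with weights `exp α` and `exp (-α)` for agreements and disagreements. -/
theorem card_agreement_le_gaussian (hn : 0 < n) (σ : Assignment n) {j : ℕ} (hj : j ≤ n) {α : ℝ}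
    (hα : α = (2 * j - n : ℝ) / n) :
    ((Finset.univ.filter fun τ : Assignment n => agreement σ τ = j).card : ℝ)
      ≤ 2 ^ n * Real.exp (-(n * (α ^ 2 / 2))) := by
  have hn0 : (n : ℝ) ≠ 0 := by positivity
  have h := card_agreement_mul_le σ (Real.exp_pos α).le (Real.exp_pos (-α)).le j
  have e1 : Real.exp α ^ j * Real.exp (-α) ^ (n - j) = Real.exp (n * α ^ 2) := by
    rw [← Real.exp_nat_mul, ← Real.exp_nat_mul, ← Real.exp_add, Nat.cast_sub hj, hα]
    congr 1
    field_simp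
    ring
  have e2 : (Real.exp α + Real.exp (-α)) ^ n ≤ 2 ^ n * Real.exp (n * (α ^ 2 / 2)) := by
    have : Real.exp α + Real.exp (-α) = 2 * Real.cosh α := by rw [Real.cosh_eq]; ring
    rw [this, mul_pow, Real.exp_nat_mul]
    exact mul_le_mul_of_nonneg_left
      (pow_le_pow_left₀ (Real.cosh_pos α).le (Real.cosh_le_exp_half_sq α) n) (by positivity)
  rw [e1] at h
  have h2 := h.trans e2
  rw [← le_div_iff₀ (Real.exp_pos _)] at h2
  refine h2.trans (le_of_eq ?_)
  rw [mul_div_assoc, ← Real.exp_sub]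
  congr 2
  ring

/-- With weights `1` and `δ` for agreements and disagreements; this is the stronger bound for small
fractions `δ` of disagreements. -/
theorem card_agreement_le_entropy (hn : 0 < n) (σ : Assignment n) {j : ℕ} (hj : j ≤ n) {δ : ℝ}
    (hδ : δ = (n - j : ℝ) / n) (hδ0 : 0 < δ) :
    ((Finset.univ.filter fun τ : Assignment n => agreement σ τ = j).card : ℝ)
      ≤ Real.exp (n * (δ - δ * Real.log δ)) := by
  have hn0 : (n : ℝ) ≠ 0 := by positivity
  have h := card_agreement_mul_le σ zero_le_one hδ0.le j
  have e1 : (1 : ℝ) ^ j * δ ^ (n - j) = Real.exp (n * (δ * Real.log δ)) := by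
    have : (n : ℝ) * (δ * Real.log δ) = (n - j : ℕ) * Real.log δ := by
      rw [Nat.cast_sub hj, ← mul_assoc]
      congr 1
      rw [hδ]; field_simp
    rw [this, Real.exp_nat_mul, Real.exp_log hδ0, one_pow, one_mul]
  have e2 : (1 + δ) ^ n ≤ Real.exp (n * δ) := by
    rw [Real.exp_nat_mul]
    exact pow_le_pow_left₀ (by linarith) (by linarith [Real.add_one_le_exp δ]) n
  rw [e1] at h
  have h2 := h.trans e2
  rw [← le_div_iff₀ (Real.exp_pos _)] at h2
  refine h2.trans (le_of_eq ?_)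
  rw [← Real.exp_sub]
  congr 1
  ring

theorem sum_agreement_le (σ : Assignment n) (p : Assignment n → Prop) [DecidablePred p]
    (F : Assignment n → ℝ) (hF : ∀ τ, 0 ≤ F τ) {C : ℝ}
    (hC : ∀ j ≤ n, (∃ τ, p τ ∧ agreement σ τ = j) →
      ∑ τ ∈ Finset.univ.filter (fun τ => agreement σ τ = j), F τ ≤ C) (hC0 : 0 ≤ C) :
    ∑ τ ∈ Finset.univ.filter p, F τ ≤ (n + 1) * C := by
  rw [← Finset.sum_fiberwise_of_maps_to (s := Finset.univ.filter p) (t := Finset.range (n + 1))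
    (g := agreement σ) fun τ _ => Finset.mem_range.2 (Nat.lt_succ_of_le (agreement_le σ τ))]
  have : ((n : ℝ) + 1) * C = ∑ j ∈ Finset.range (n + 1), C := by simp
  rw [this]
  refine Finset.sum_le_sum fun j hj => ?_
  by_cases hex : ∃ τ, p τ ∧ agreement σ τ = j
  · refine le_trans ?_ (hC j (Nat.le_of_lt_succ (Finset.mem_range.1 hj)) hex)
    refine Finset.sum_le_sum_of_subset_of_nonneg ?_ fun τ _ _ => hF τ
    exact Finset.filter_subset_filter _ (Finset.subset_univ _)
  · refine le_trans (le_of_eq ?_) hC0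
    refine Finset.sum_eq_zero fun τ hτ => absurd ?_ hex
    rw [Finset.mem_filter, Finset.mem_filter] at hτ
    exact ⟨τ, hτ.1.2, hτ.2⟩

theorem overlap_comm (σ τ : Assignment n) : overlap σ τ = overlap τ σ :=
  Finset.sum_congr rfl fun _ _ => mul_comm _ _

/-- The second moment, restricted to pairs of assignments that do not share a cluster, is of the
same exponential order as the square of the first moment. -/
theorem sum_expect_pairs_le {β ε : ℝ} (hn : 0 < n) (hd : Even d) (hN : m * k = n * d)
    (hk : 20 ≤ k) (hku : 1000 * (k : ℝ) ≤ 2 ^ k)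
    (hk2 : 8 * (k : ℝ) ^ 2 ≤ 2 ^ k) (hk34 : 8 * (k : ℝ) ^ 2 * (3 / 2) ^ k ≤ 2 ^ k)
    (hk10 : 200 * (k : ℝ) ≤ (2 : ℝ) ^ k * (2 : ℝ) ^ (-(k : ℝ) / 10))
    (hdk : (d : ℝ) ≤ k * (2 ^ k * Real.log 2 + 2))
    (h0 : 0 ≤ ε) (h1 : ε < 1) (hfix : ε = (1 - Real.exp (-β)) * ((1 + ε) / 2) ^ k)
    (hε : ε * 2 ^ k ≤ 1 + 4 * k / 2 ^ k) :
    ∑ σ : Assignment n, ∑ τ ∈ Finset.univ.filter (fun τ => τ ∉ cluster k σ),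
        expect (fun Φ : Formula n d m k => weight β Φ σ * weight β Φ τ)
      ≤ (n + 1) * (Real.exp 1 * (n * d + 1)) ^ 4 * Real.exp (annealedValue d k ε * n) ^ 2 := by
  have hn0 : (0 : ℝ) < n := by exact_mod_cast hn
  have hk0 : (0 : ℝ) < k := by exact_mod_cast (by omega : 0 < k)
  have hε2 : 0 < 1 - ε ^ 2 := by nlinarith
  have h1ε : 0 < (1 - ε) ^ 2 := by
    have : 0 < 1 - ε := by linarith
    positivity
  have hmD : (m : ℝ) = n * ((d : ℝ) / k) := by
    have : (m : ℝ) * k = n * d := by exact_mod_cast hN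
    field_simp; linarith
  set P : ℝ := (Real.exp 1 * (n * d + 1)) ^ 4 with hP
  set A : ℝ := (1 - ε) ^ m / (1 - ε ^ 2) ^ (n * (d / 2)) with hA
  have hA2 : A ^ 2 * (1 - ε ^ 2) ^ (n * d) = ((1 - ε) ^ 2) ^ m := by
    have h2 : n * d = n * (d / 2) * 2 := by rw [mul_comm _ 2, ← two_mul_half hd hN, hN]
    have hne : (1 - ε ^ 2) ^ (n * (d / 2)) ≠ 0 := by positivity
    rw [h2, pow_mul, ← mul_pow, hA, div_mul_cancel₀ _ hne, ← pow_mul, ← pow_mul, mul_comm m 2]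
  -- the contribution of each value of the overlap
  have hlevel : ∀ σ : Assignment n, ∀ j ≤ n, (∃ τ, τ ∉ cluster k σ ∧ agreement σ τ = j) →
      ∑ τ ∈ Finset.univ.filter (fun τ => agreement σ τ = j),
        expect (fun Φ : Formula n d m k => weight β Φ σ * weight β Φ τ) ≤ P * (2 ^ n * A ^ 2) := by
    rintro σ j hj ⟨τ₀, hτ₀, hag⟩
    have hj' : (j : ℝ) ≤ n := by exact_mod_cast hj
    set α : ℝ := (2 * j - n : ℝ) / n with hα
    have hαm : -1 ≤ α := by
      rw [hα, le_div_iff₀ hn0]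
      have : (0 : ℝ) ≤ j := Nat.cast_nonneg j
      linarith
    have hα1 : α ≤ 1 - (2 : ℝ) ^ (-(k : ℝ) / 10) := by
      have : ¬ ((n : ℝ) * (1 - (2 : ℝ) ^ (-(k : ℝ) / 10)) < (overlap τ₀ σ : ℝ)) := fun h =>
        hτ₀ (Finset.mem_filter.2 ⟨Finset.mem_univ _, h⟩)
      rw [not_lt, overlap_comm, overlap_eq_agreement, hag] at this
      rw [hα, div_le_iff₀ hn0]
      linarith
    have hα1' : α ≤ 1 := by
      have : 0 < (2 : ℝ) ^ (-(k : ℝ) / 10) := by positivity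
      linarith
    set K := pairFactor k ε α with hK
    have hK0 : 0 ≤ K := pairFactor_nonneg h0 h1 hfix hαm hα1'
    set Dx : ℝ := (d : ℝ) / k * (K / (1 - ε) ^ 2 - 1) with hDx
    set c : ℝ := ((Finset.univ.filter fun τ : Assignment n => agreement σ τ = j).card : ℝ) with hc
    have hc0 : 0 ≤ c := Nat.cast_nonneg _
    have hG : (K / (1 - ε) ^ 2) ^ m ≤ Real.exp (n * Dx) := by
      have : (n : ℝ) * Dx = m * (K / (1 - ε) ^ 2 - 1) := by rw [hmD, hDx]; ring
      rw [this, Real.exp_nat_mul]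
      refine pow_le_pow_left₀ (by positivity) ?_ m
      linarith [Real.add_one_le_exp (K / (1 - ε) ^ 2 - 1)]
    have hcG : c * Real.exp (n * Dx) ≤ 2 ^ n := by
      rcases excess_le hk hku hk2 hk34 hk10 h0 hε (by positivity : (0 : ℝ) ≤ (d : ℝ) / k)
        (by rw [div_le_iff₀ hk0]; linarith) hαm hα1 with h | ⟨hδ0, h⟩
      · have b1 := card_agreement_le_gaussian hn σ hj hα
        have b2 : Real.exp (n * Dx) ≤ Real.exp (n * (α ^ 2 / 2)) :=
          Real.exp_le_exp.2 (mul_le_mul_of_nonneg_left h hn0.le)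
        refine (mul_le_mul b1 b2 (Real.exp_pos _).le (by positivity)).trans (le_of_eq ?_)
        rw [mul_assoc, ← Real.exp_add, neg_add_cancel, Real.exp_zero, mul_one]
      · set δ := (1 - α) / 2 with hδ
        have hδj : δ = (n - j : ℝ) / n := by rw [hδ, hα]; field_simp; ring
        have b1 := card_agreement_le_entropy hn σ hj hδj hδ0
        have b2 : Real.exp (n * Dx) ≤ Real.exp (n * (Real.log 2 - δ + δ * Real.log δ)) :=
          Real.exp_le_exp.2 (mul_le_mul_of_nonneg_left h hn0.le)
        refine (mul_le_mul b1 b2 (Real.exp_pos _).le (Real.exp_pos _).le).trans (le_of_eq ?_)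
        rw [← Real.exp_add]
        have : (n : ℝ) * (δ - δ * Real.log δ) + n * (Real.log 2 - δ + δ * Real.log δ)
            = n * Real.log 2 := by ring
        rw [this, Real.exp_nat_mul, Real.exp_log two_pos]
    have hone : ∀ τ ∈ Finset.univ.filter (fun τ : Assignment n => agreement σ τ = j),
        expect (fun Φ : Formula n d m k => weight β Φ σ * weight β Φ τ)
          ≤ P * (A ^ 2 * (K / (1 - ε) ^ 2) ^ m) := by
      intro τ hτ
      have b := expect_weight_mul_weight_le hn hd hN h0 h1 hfix σ τ
      rw [(Finset.mem_filter.1 hτ).2, ← hα, ← hK, ← hP, ← le_div_iff₀ (by positivity)] at b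
      refine b.trans (le_of_eq ?_)
      have hne : ((1 - ε) ^ 2) ^ m ≠ 0 := by positivity
      rw [div_eq_iff (by positivity), div_pow K, mul_assoc, mul_right_comm, hA2]
      field_simp
    refine (Finset.sum_le_sum hone).trans ?_
    rw [Finset.sum_const, nsmul_eq_mul]
    calc c * (P * (A ^ 2 * (K / (1 - ε) ^ 2) ^ m))
        = P * A ^ 2 * (c * (K / (1 - ε) ^ 2) ^ m) := by ring
      _ ≤ P * A ^ 2 * 2 ^ n := by
          refine mul_le_mul_of_nonneg_left (le_trans ?_ hcG) (by positivity)
          exact mul_le_mul_of_nonneg_left hG hc0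
      _ = _ := by ring
  have hsum : ∀ σ : Assignment n, ∑ τ ∈ Finset.univ.filter (fun τ => τ ∉ cluster k σ),
      expect (fun Φ : Formula n d m k => weight β Φ σ * weight β Φ τ)
        ≤ (n + 1) * (P * (2 ^ n * A ^ 2)) := fun σ =>
    sum_agreement_le σ _ _ (fun τ => div_nonneg (Finset.sum_nonneg fun Φ _ =>
      mul_nonneg (Real.exp_pos _).le (Real.exp_pos _).le) (Nat.cast_nonneg _)) (hlevel σ)
      (by positivity)
  refine (Finset.sum_le_sum fun σ _ => hsum σ).trans (le_of_eq ?_)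
  rw [Finset.sum_const, nsmul_eq_mul, Finset.card_univ,
    exp_annealedValue (by omega) hd hN h0 h1, ← hA]
  simp
  ring

/-! ### The partition function without large clusters -/

/-- The contribution to the partition function of the assignments whose cluster has size at most
`M`. -/
noncomputable def truncatedPartition (β M : ℝ) (Φ : Formula n d m k) : ℝ :=
  ∑ σ ∈ Finset.univ.filter (fun σ : Assignment n => clusterSize β Φ σ ≤ M), weight β Φ σ

theorem truncatedPartition_nonneg (β M : ℝ) (Φ : Formula n d m k) :
    0 ≤ truncatedPartition β M Φ := Finset.sum_nonneg fun _ _ => (Real.exp_pos _).le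

theorem truncatedPartition_le (β M : ℝ) (Φ : Formula n d m k) :
    truncatedPartition β M Φ ≤ partitionFunction β Φ :=
  Finset.sum_le_univ_sum_of_nonneg fun _ => (Real.exp_pos _).le

theorem truncatedPartition_sq_le {M : ℝ} (β : ℝ) (hM : 0 ≤ M) (Φ : Formula n d m k) :
    truncatedPartition β M Φ ^ 2 ≤ M * partitionFunction β Φ
      + ∑ σ : Assignment n, ∑ τ ∈ Finset.univ.filter (fun τ => τ ∉ cluster k σ),
          weight β Φ σ * weight β Φ τ := by
  have hw : ∀ σ, 0 ≤ weight β Φ σ := fun σ => (Real.exp_pos _).le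
  have hsplit : ∀ σ, partitionFunction β Φ = clusterSize β Φ σ
      + ∑ τ ∈ Finset.univ.filter (fun τ => τ ∉ cluster k σ), weight β Φ τ := by
    intro σ
    rw [clusterSize_eq_sum]
    unfold partitionFunction
    rw [← Finset.sum_filter_add_sum_filter_not Finset.univ (fun τ => τ ∈ cluster k σ)]
    congr 2
    ext τ; simp
  have h1 : truncatedPartition β M Φ ^ 2
      ≤ truncatedPartition β M Φ * partitionFunction β Φ := by
    rw [pow_two]
    exact mul_le_mul_of_nonneg_left (truncatedPartition_le β M Φ)
      (truncatedPartition_nonneg β M Φ)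
  refine h1.trans ?_
  have h2 : M * partitionFunction β Φ = ∑ σ : Assignment n, weight β Φ σ * M := by
    unfold partitionFunction
    rw [← Finset.sum_mul, mul_comm]
  rw [h2, ← Finset.sum_add_distrib]
  unfold truncatedPartition
  rw [Finset.sum_mul]
  have hnn : ∀ σ, 0 ≤ weight β Φ σ * M
      + ∑ τ ∈ Finset.univ.filter (fun τ => τ ∉ cluster k σ), weight β Φ σ * weight β Φ τ :=
    fun σ => add_nonneg (mul_nonneg (hw σ) hM)
      (Finset.sum_nonneg fun τ _ => mul_nonneg (hw σ) (hw τ))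
  refine le_trans (Finset.sum_le_sum fun σ hσ => ?_) (Finset.sum_le_univ_sum_of_nonneg hnn)
  rw [hsplit σ, mul_add, ← Finset.mul_sum]
  exact add_le_add (mul_le_mul_of_nonneg_left (Finset.mem_filter.1 hσ).2 (hw σ)) le_rfl

theorem expect_truncatedPartition_sq_le {M : ℝ} (β : ℝ) (hM : 0 ≤ M) :
    expect (fun Φ : Formula n d m k => truncatedPartition β M Φ ^ 2)
      ≤ M * expect (fun Φ : Formula n d m k => partitionFunction β Φ)
        + ∑ σ : Assignment n, ∑ τ ∈ Finset.univ.filter (fun τ => τ ∉ cluster k σ),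
            expect (fun Φ : Formula n d m k => weight β Φ σ * weight β Φ τ) := by
  refine (expect_mono fun Φ => truncatedPartition_sq_le β hM Φ).trans (le_of_eq ?_)
  unfold expect
  rw [Finset.sum_add_distrib, add_div, ← Finset.mul_sum, mul_div_assoc]
  congr 1
  rw [Finset.sum_comm, Finset.sum_div]
  refine Finset.sum_congr rfl fun σ _ => ?_
  rw [Finset.sum_comm, Finset.sum_div]

theorem sum_partitionFunction_pos (hN : m * k = n * d) (β : ℝ) :
    0 < ∑ Φ : Formula n d m k, partitionFunction β Φ := by
  have Φ₀ : Formula n d m k := Fintype.equivOfCardEq (by simp [hN])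
  exact Finset.sum_pos (fun Φ _ => partitionFunction_pos β Φ) ⟨Φ₀, Finset.mem_univ _⟩

theorem plantedExpect_le (hN : m * k = n * d) (β : ℝ) {X : Formula n d m k → Assignment n → ℝ}
    {c : ℝ} (h : ∀ Φ σ, X Φ σ ≤ c) : plantedExpect β X ≤ c := by
  unfold plantedExpect
  rw [div_le_iff₀ (sum_partitionFunction_pos hN β), Finset.mul_sum]
  refine Finset.sum_le_sum fun Φ _ => ?_
  unfold partitionFunction
  rw [Finset.mul_sum]
  refine Finset.sum_le_sum fun σ _ => ?_
  rw [mul_comm c]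
  exact mul_le_mul_of_nonneg_left (h Φ σ) (Real.exp_pos _).le

theorem le_plantedExpect (hN : m * k = n * d) (β : ℝ) {X : Formula n d m k → Assignment n → ℝ}
    {c : ℝ} (h : ∀ Φ σ, c ≤ X Φ σ) : c ≤ plantedExpect β X := by
  unfold plantedExpect
  rw [le_div_iff₀ (sum_partitionFunction_pos hN β), Finset.mul_sum]
  refine Finset.sum_le_sum fun Φ _ => ?_
  unfold partitionFunction
  rw [Finset.mul_sum]
  refine Finset.sum_le_sum fun σ _ => ?_
  rw [mul_comm c]
  exact mul_le_mul_of_nonneg_left (h Φ σ) (Real.exp_pos _).le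

theorem neg_mul_le_log_clusterSize (hn : 0 < n) {β : ℝ} (hβ : 0 ≤ β) (Φ : Formula n d m k)
    (σ : Assignment n) : -(β * m) ≤ Real.log (clusterSize β Φ σ) := by
  refine le_trans ?_ (Real.log_le_log (Real.exp_pos _) (weight_le_clusterSize hn β Φ σ))
  rw [Real.log_exp, neg_mul, neg_le_neg_iff]
  refine mul_le_mul_of_nonneg_left ?_ hβ
  have : energy Φ σ ≤ m := (Finset.card_le_univ _).trans (by simp)
  exact_mod_cast this

theorem log_clusterSize_le (hn : 0 < n) {β : ℝ} (hβ : 0 ≤ β) (Φ : Formula n d m k)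
    (σ : Assignment n) : Real.log (clusterSize β Φ σ) ≤ n * Real.log 2 := by
  rw [← Real.log_pow]
  refine Real.log_le_log (clusterSize_pos hn β Φ σ)
    ((clusterSize_le_partitionFunction β Φ σ).trans ?_)
  have : ∀ τ : Assignment n, weight β Φ τ ≤ 1 := by
    intro τ
    unfold weight
    refine Real.exp_le_one_iff.2 ?_
    have : (0 : ℝ) ≤ energy Φ τ := Nat.cast_nonneg _
    nlinarith
  refine (Finset.sum_le_sum fun τ _ => this τ).trans (le_of_eq ?_)
  simp

/-- Markov's inequality in the planted model. -/
theorem mul_expect_partitionFunction_le (hN : m * k = n * d) (hn : 0 < n) {β : ℝ} (hβ : 0 ≤ β)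
    {u v : ℝ} (hu : plantedExpect β
      (fun (Φ : Formula n d m k) σ => Real.log (clusterSize β Φ σ)) ≤ u) :
    (v - u) * expect (fun Φ : Formula n d m k => partitionFunction β Φ)
      ≤ (v + β * m) * expect (fun Φ : Formula n d m k => truncatedPartition β (Real.exp v) Φ) := by
  have hK0 : (0 : ℝ) < Fintype.card (Formula n d m k) := by
    rw [card_formula hN]; exact_mod_cast Nat.factorial_pos _
  unfold expect
  rw [mul_div_assoc', mul_div_assoc', div_le_div_iff_of_pos_right hK0]
  unfold plantedExpect at hu
  rw [div_le_iff₀ (sum_partitionFunction_pos hN β)] at hu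
  have hΦ : ∀ Φ : Formula n d m k, (v + β * m) * partitionFunction β Φ
      ≤ (v + β * m) * truncatedPartition β (Real.exp v) Φ
        + (∑ σ, weight β Φ σ * Real.log (clusterSize β Φ σ) + β * m * partitionFunction β Φ) := by
    intro Φ
    have e : truncatedPartition β (Real.exp v) Φ
        = ∑ σ, if clusterSize β Φ σ ≤ Real.exp v then weight β Φ σ else 0 := by
      unfold truncatedPartition
      rw [Finset.sum_filter]
    rw [e]
    unfold partitionFunction
    rw [Finset.mul_sum, Finset.mul_sum, Finset.mul_sum, ← Finset.sum_add_distrib,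
      ← Finset.sum_add_distrib]
    refine Finset.sum_le_sum fun σ _ => ?_
    have hw : 0 < weight β Φ σ := Real.exp_pos _
    have hlow := neg_mul_le_log_clusterSize hn hβ Φ σ
    split_ifs with hc
    · nlinarith
    · have : v ≤ Real.log (clusterSize β Φ σ) :=
        (Real.le_log_iff_exp_le (clusterSize_pos hn β Φ σ)).2 (not_le.1 hc).le
      nlinarith
  have hs := Finset.sum_le_sum fun Φ (_ : Φ ∈ (Finset.univ : Finset (Formula n d m k))) => hΦ Φ
  rw [Finset.sum_add_distrib, Finset.sum_add_distrib, ← Finset.mul_sum, ← Finset.mul_sum,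
    ← Finset.mul_sum] at hs
  linarith

/-- An interpolation between the second moment and a small moment, with a free parameter `l`. -/
theorem expect_truncatedPartition_le (β M : ℝ) {lam : ℝ} (hl0 : 0 ≤ lam) (hl1 : lam ≤ 1) (l : ℝ) :
    expect (fun Φ : Formula n d m k => truncatedPartition β M Φ)
      ≤ Real.exp ((1 - lam) * l) * expect (fun Φ : Formula n d m k =>
          Real.exp (lam * Real.log (partitionFunction β Φ)))
        + Real.exp (-l) * expect (fun Φ : Formula n d m k => truncatedPartition β M Φ ^ 2) := by
  have h : ∀ Φ : Formula n d m k, truncatedPartition β M Φ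
      ≤ Real.exp ((1 - lam) * l) * Real.exp (lam * Real.log (partitionFunction β Φ))
        + Real.exp (-l) * truncatedPartition β M Φ ^ 2 := by
    intro Φ
    set x := truncatedPartition β M Φ with hx
    have hx0 : 0 ≤ x := truncatedPartition_nonneg β M Φ
    have hxZ : x ≤ partitionFunction β Φ := truncatedPartition_le β M Φ
    rcases hx0.eq_or_lt with h0 | h0
    · rw [← h0]; positivity
    rcases le_total x (Real.exp l) with hle | hle
    · have b1 : Real.log x ≤ l := (Real.log_le_iff_le_exp h0).2 hle
      have b2 := Real.log_le_log h0 hxZ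
      have b3 : x ≤ Real.exp ((1 - lam) * l) *
          Real.exp (lam * Real.log (partitionFunction β Φ)) := by
        rw [← Real.exp_add]
        calc x = Real.exp (Real.log x) := (Real.exp_log h0).symm
          _ ≤ _ := Real.exp_le_exp.2 (by nlinarith)
      have : 0 ≤ Real.exp (-l) * x ^ 2 := by positivity
      linarith
    · have b1 : x ≤ Real.exp (-l) * x ^ 2 := by
        have : 1 ≤ Real.exp (-l) * x := by
          rw [Real.exp_neg, inv_mul_eq_div, le_div_iff₀ (Real.exp_pos _), one_mul]
          exact hle
        calc x = 1 * x := (one_mul x).symm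
          _ ≤ (Real.exp (-l) * x) * x := mul_le_mul_of_nonneg_right this hx0
          _ = _ := by ring
      have : 0 ≤ Real.exp ((1 - lam) * l) *
          Real.exp (lam * Real.log (partitionFunction β Φ)) := by positivity
      linarith
  refine (expect_mono h).trans (le_of_eq ?_)
  unfold expect
  rw [Finset.sum_add_distrib, add_div, ← Finset.mul_sum, ← Finset.mul_sum, mul_div_assoc,
    mul_div_assoc]

theorem expect_exp_mul_log_partitionFunction_le (hN : m * k = n * d) {β lam : ℝ} (hβ : 0 ≤ β)
    (hl : 0 ≤ lam) :
    expect (fun Φ : Formula n d m k => Real.exp (lam * Real.log (partitionFunction β Φ)))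
      ≤ Real.exp (lam * expect (fun Φ : Formula n d m k => Real.log (partitionFunction β Φ))
          + 2 * (n * d) * (2 * β * lam) ^ 2) := by
  have h := expect_exp_le hN (f := fun Φ : Formula n d m k =>
    lam * Real.log (partitionFunction β Φ)) (c := 2 * β * lam) (fun Φ x y => by
      have := abs_log_sum_weight_swap_le hβ Finset.univ_nonempty Φ x y
      rw [← mul_sub, abs_mul, abs_of_nonneg hl, mul_comm (2 * β)]
      exact mul_le_mul_of_nonneg_left this hl)
  have e : expect (fun Φ : Formula n d m k => lam * Real.log (partitionFunction β Φ))
      = lam * expect (fun Φ : Formula n d m k => Real.log (partitionFunction β Φ)) := by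
    unfold expect; rw [← Finset.mul_sum, mul_div_assoc]
  rw [e] at h
  exact h

theorem quenchedRate_le_annealedRate (hN : d * n / k * k = n * d) (β : ℝ) :
    quenchedRate d k β n ≤ annealedRate d k β n := by
  refine div_le_div_of_nonneg_right ?_ (Nat.cast_nonneg n)
  rw [Real.le_log_iff_exp_le (expect_partitionFunction_pos hN β)]
  refine (exp_expect_le hN _).trans (expect_mono fun Φ => ?_)
  rw [Real.exp_log (partitionFunction_pos β Φ)]

/-! ### From the planted cluster size to the free energy -/

theorem isBoundedUnder_clusterRate (hk : 0 < k) {β : ℝ} (hβ : 0 ≤ β) :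
    (nLimit d k).IsBoundedUnder (· ≤ ·) (clusterRate d k β) ∧
      (nLimit d k).IsBoundedUnder (· ≥ ·) (clusterRate d k β) := by
  have hk0 : (0 : ℝ) < k := by exact_mod_cast hk
  constructor
  · refine ⟨Real.log 2, ?_⟩
    rw [eventually_map]
    filter_upwards [eventually_dvd, eventually_nLimit (eventually_ge_atTop 1)] with n hdvd hn
    have hn0 : (0 : ℝ) < n := by exact_mod_cast hn
    unfold clusterRate
    rw [div_le_iff₀ hn0, mul_comm (Real.log 2)]
    exact plantedExpect_le (mul_eq_of_dvd hdvd) β fun Φ σ => log_clusterSize_le hn hβ Φ σ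
  · refine ⟨-(β * (d / k)), ?_⟩
    rw [eventually_map]
    filter_upwards [eventually_dvd, eventually_nLimit (eventually_ge_atTop 1)] with n hdvd hn
    have hn0 : (0 : ℝ) < n := by exact_mod_cast hn
    have hN := mul_eq_of_dvd hdvd
    have hm : ((d * n / k : ℕ) : ℝ) = n * d / k := by
      rw [eq_div_iff hk0.ne']; exact_mod_cast hN
    unfold clusterRate
    rw [ge_iff_le, le_div_iff₀ hn0]
    refine le_trans (le_of_eq ?_)
      (le_plantedExpect hN β fun Φ σ => neg_mul_le_log_clusterSize hn hβ Φ σ)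
    rw [hm]; ring

/-- A truncated second moment argument: if planted clusters are exponentially no larger than the
annealed partition function, then the partition function restricted to assignments with clusters of
at most this size has a first moment of the annealed order and a matching second moment.  This gives
a lower bound on `E[Z ^ lam]`, which concentration turns into one on `E[log Z]`. -/
theorem eventually_le_quenchedRate {β ε : ℝ} (hβ : 0 ≤ β) (hd : Even d)
    (hk : 20 ≤ k) (hku : 1000 * (k : ℝ) ≤ 2 ^ k)
    (hk2 : 8 * (k : ℝ) ^ 2 ≤ 2 ^ k) (hk34 : 8 * (k : ℝ) ^ 2 * (3 / 2) ^ k ≤ 2 ^ k)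
    (hk10 : 200 * (k : ℝ) ≤ (2 : ℝ) ^ k * (2 : ℝ) ^ (-(k : ℝ) / 10))
    (hdk : (d : ℝ) ≤ k * (2 ^ k * Real.log 2 + 2))
    (h0 : 0 ≤ ε) (h1 : ε < 1) (hfix : ε = (1 - Real.exp (-β)) * ((1 + ε) / 2) ^ k)
    (hε : ε * 2 ^ k ≤ 1 + 4 * k / 2 ^ k)
    (hC : ∀ η > 0, ∀ᶠ n in nLimit d k, clusterRate d k β n ≤ annealedValue d k ε + η)
    {η : ℝ} (hη : 0 < η) :
    ∀ᶠ n in nLimit d k, annealedValue d k ε - η ≤ quenchedRate d k β n := by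
  set a := annealedValue d k ε with ha
  have hkpos : 0 < k := by omega
  have hk0 : (0 : ℝ) < k := by exact_mod_cast hkpos
  -- the exponent of the lower bound on `lam * E[log Z]` loses `10 * lam ^ 2` by the estimates below
  -- and `8 * d * β ^ 2 * lam ^ 2` by concentration
  set K : ℝ := 10 + 8 * d * β ^ 2 with hK
  have hK0 : 0 < K := by positivity
  set lam : ℝ := min 1 (η / K) with hlam
  have hl0 : 0 < lam := by positivity
  have hl1 : lam ≤ 1 := min_le_left _ _
  have hlK : K * lam ≤ η := by
    have : lam ≤ η / K := min_le_right _ _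
    rw [le_div_iff₀ hK0] at this
    linarith
  -- all exponential errors are of order `lam ^ 2`
  set θ : ℝ := lam ^ 2 with hθ
  have hθ0 : 0 < θ := by positivity
  set B : ℝ := a + 2 * θ + β * (d / k) with hB
  have hconst : ∀ᶠ n : ℕ in atTop, B / θ ≤ Real.exp (θ * n) := by
    have := Real.tendsto_exp_atTop.comp
      (tendsto_natCast_atTop_atTop (R := ℝ) |>.const_mul_atTop hθ0)
    exact this.eventually (eventually_ge_atTop _)
  have htwo : ∀ᶠ n : ℕ in atTop, 2 ≤ Real.exp (θ * n) := by
    have := Real.tendsto_exp_atTop.comp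
      (tendsto_natCast_atTop_atTop (R := ℝ) |>.const_mul_atTop hθ0)
    exact this.eventually (eventually_ge_atTop _)
  have hann := tendsto_annealedRate hkpos hd h0 h1 hfix
  rw [← ha] at hann
  filter_upwards [hC θ hθ0,
    hann.eventually (gt_mem_nhds (by linarith : a < a + θ)),
    hann.eventually (lt_mem_nhds (by linarith : a - θ < a)),
    eventually_nLimit hconst, eventually_nLimit htwo,
    eventually_nLimit (eventually_poly_le_exp 1 1 hθ0),
    eventually_nLimit (eventually_poly_le_exp (Real.exp 1 * (d + 1)) 4 hθ0),
    eventually_dvd, eventually_nLimit (eventually_ge_atTop 1)]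
    with n hclus hann1 hann2 hcon htw hp1 hp2 hdvd hn1
  have hN := mul_eq_of_dvd hdvd
  have hn : (0 : ℝ) < n := by exact_mod_cast hn1
  have hm : ((d * n / k : ℕ) : ℝ) = n * (d / k) := by
    rw [mul_div_assoc', eq_div_iff hk0.ne']; exact_mod_cast hN
  set EZ := expect fun Φ : Formula n d (d * n / k) k => partitionFunction β Φ with hEZ
  have hEZ0 : 0 < EZ := expect_partitionFunction_pos hN β
  have e1 : Real.log EZ = annealedRate d k β n * n := by unfold annealedRate; field_simp; rfl
  have hEZu : EZ ≤ Real.exp ((a + θ) * n) := by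
    rw [← Real.log_le_iff_le_exp hEZ0, e1]
    exact mul_le_mul_of_nonneg_right hann1.le hn.le
  have hEZl : Real.exp ((a - θ) * n) ≤ EZ := by
    rw [← Real.le_log_iff_exp_le hEZ0, e1]
    exact mul_le_mul_of_nonneg_right hann2.le hn.le
  set v : ℝ := (a + 2 * θ) * n with hv
  set EY := expect fun Φ : Formula n d (d * n / k) k => truncatedPartition β (Real.exp v) Φ with hEY
  set EY2 := expect fun Φ : Formula n d (d * n / k) k =>
    truncatedPartition β (Real.exp v) Φ ^ 2 with hEY2
  set EL := expect fun Φ : Formula n d (d * n / k) k => Real.log (partitionFunction β Φ) with hEL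
  have hEY0 : 0 ≤ EY := div_nonneg (Finset.sum_nonneg fun Φ _ => truncatedPartition_nonneg _ _ _)
    (Nat.cast_nonneg _)
  -- the truncation preserves the exponential order of the first moment
  have hfirst : Real.exp ((a - 2 * θ) * n) ≤ EY := by
    have hmarkov := mul_expect_partitionFunction_le hN hn1 hβ (v := v) (u := (a + θ) * n) (by
      unfold clusterRate at hclus
      rwa [div_le_iff₀ hn] at hclus)
    rw [← hEZ, ← hEY] at hmarkov
    have e2 : v - (a + θ) * n = θ * n := by rw [hv]; ring
    have e3 : v + β * ((d * n / k : ℕ) : ℝ) = B * n := by rw [hv, hm, hB]; ring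
    rw [e2, e3] at hmarkov
    have h2 : θ * EZ ≤ B * EY := by
      have : (θ * EZ) * n ≤ (B * EY) * n := by linarith
      exact le_of_mul_le_mul_right this hn
    have h3 : θ * EZ ≤ θ * (Real.exp (θ * n) * EY) := by
      refine h2.trans ?_
      rw [← mul_assoc]
      refine mul_le_mul_of_nonneg_right ?_ hEY0
      rw [div_le_iff₀ hθ0] at hcon
      linarith
    have h4 := le_of_mul_le_mul_left h3 hθ0
    have h5 : Real.exp (θ * n) * Real.exp ((a - 2 * θ) * n) ≤ Real.exp (θ * n) * EY := by
      rw [← Real.exp_add]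
      refine le_trans (le_of_eq ?_) (hEZl.trans h4)
      congr 1; ring
    exact le_of_mul_le_mul_left h5 (Real.exp_pos _)
  -- the second moment splits into pairs in a common cluster and pairs in different clusters
  have hsecond : EY2 ≤ Real.exp ((2 * a + 4 * θ) * n) := by
    have h2 := expect_truncatedPartition_sq_le (n := n) (d := d) (m := d * n / k) (k := k) β
      (Real.exp_pos v).le
    rw [← hEZ, ← hEY2] at h2
    have h3 := sum_expect_pairs_le hn1 hd hN hk hku hk2 hk34 hk10 hdk h0 h1 hfix hε
    rw [← ha] at h3
    have b1 : Real.exp v * EZ ≤ Real.exp ((2 * a + 3 * θ) * n) := by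
      refine (mul_le_mul_of_nonneg_left hEZu (Real.exp_pos v).le).trans (le_of_eq ?_)
      rw [← Real.exp_add, hv]; congr 1; ring
    have b2 : ((n : ℝ) + 1) * (Real.exp 1 * (n * d + 1)) ^ 4 * Real.exp (a * n) ^ 2
        ≤ Real.exp ((2 * a + 3 * θ) * n) := by
      have c1 : (n : ℝ) + 1 ≤ Real.exp (θ * n) := by simpa using hp1
      have c2 : (Real.exp 1 * (n * d + 1)) ^ 4 ≤ Real.exp (θ * n) := by
        refine le_trans (pow_le_pow_left₀ (by positivity) ?_ 4) hp2
        rw [mul_assoc]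
        refine mul_le_mul_of_nonneg_left ?_ (Real.exp_pos 1).le
        have : (0 : ℝ) ≤ d := Nat.cast_nonneg d
        linarith
      calc _ ≤ Real.exp (θ * n) * Real.exp (θ * n) * Real.exp (a * n) ^ 2 := by gcongr
        _ = Real.exp ((2 * a + 2 * θ) * n) := by
            rw [pow_two, ← Real.exp_add, ← Real.exp_add, ← Real.exp_add]; congr 1; ring
        _ ≤ _ := by
            refine Real.exp_le_exp.2 (mul_le_mul_of_nonneg_right ?_ hn.le)
            linarith
    calc EY2 ≤ 2 * Real.exp ((2 * a + 3 * θ) * n) := by linarith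
      _ ≤ Real.exp (θ * n) * Real.exp ((2 * a + 3 * θ) * n) :=
          mul_le_mul_of_nonneg_right htw (Real.exp_pos _).le
      _ = _ := by rw [← Real.exp_add]; congr 1; ring
  -- the interpolation parameter is chosen so that the second moment term is negligible
  set l : ℝ := (a + 7 * θ) * n with hl
  have hint := expect_truncatedPartition_le (n := n) (d := d) (m := d * n / k) (k := k) β
    (Real.exp v) hl0.le hl1 l
  have hconc := expect_exp_mul_log_partitionFunction_le hN hβ hl0.le
  rw [← hEY, ← hEY2] at hint
  rw [← hEL] at hconc
  have hhalf : 2 * (Real.exp (-l) * EY2) ≤ Real.exp ((a - 2 * θ) * n) := by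
    calc 2 * (Real.exp (-l) * EY2)
        ≤ Real.exp (θ * n) * (Real.exp (-l) * Real.exp ((2 * a + 4 * θ) * n)) := by
          refine mul_le_mul htw (mul_le_mul_of_nonneg_left hsecond (Real.exp_pos _).le) ?_
            (Real.exp_pos _).le
          refine mul_nonneg (Real.exp_pos _).le (div_nonneg (Finset.sum_nonneg fun Φ _ => ?_)
            (Nat.cast_nonneg _))
          positivity
      _ = _ := by rw [← Real.exp_add, ← Real.exp_add, hl]; congr 1; ring
  have hmain : Real.exp ((a - 2 * θ) * n) ≤ Real.exp (θ * n) * (Real.exp ((1 - lam) * l) *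
      Real.exp (lam * EL + 2 * (n * d) * (2 * β * lam) ^ 2)) := by
    have b1 : Real.exp ((a - 2 * θ) * n) ≤ 2 * (Real.exp ((1 - lam) * l) *
        Real.exp (lam * EL + 2 * (n * d) * (2 * β * lam) ^ 2)) := by
      have := mul_le_mul_of_nonneg_left hconc (Real.exp_pos ((1 - lam) * l)).le
      linarith
    exact b1.trans (mul_le_mul_of_nonneg_right htw (by positivity))
  rw [← Real.exp_add, ← Real.exp_add, Real.exp_le_exp] at hmain
  have hfin : lam * ((a - K * lam) * n) ≤ lam * EL := by
    have e4 : lam * ((a - K * lam) * n) = (a - 2 * θ) * n - θ * n - (1 - lam) * l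
        - 2 * (n * d) * (2 * β * lam) ^ 2 - 7 * lam * θ * n := by
      rw [hl, hK, hθ]; ring
    have e5 : 0 ≤ 7 * lam * θ * n := by positivity
    rw [e4]; linarith
  have hfin2 := le_of_mul_le_mul_left hfin hl0
  unfold quenchedRate
  rw [le_div_iff₀ hn]
  refine le_trans (mul_le_mul_of_nonneg_right ?_ hn.le) hfin2
  linarith

end RegKSAT

theorem lemma2p2 :
    ∃ k₀ : ℕ, 3 ≤ k₀ ∧ ∀ k : ℕ, k₀ ≤ k →
      ∀ d : ℕ, Even d → (d : ℝ) ≤ RegKSAT.dSAT k → ∀ β : ℝ, 0 < β →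
        ∃ a : ℝ, Tendsto (RegKSAT.annealedRate d k β) (RegKSAT.nLimit d k) (𝓝 a) ∧
          (Tendsto (RegKSAT.quenchedRate d k β) (RegKSAT.nLimit d k) (𝓝 a) ↔
            limsup (RegKSAT.clusterRate d k β) (RegKSAT.nLimit d k) ≤ a) := by
  obtain ⟨k₁, hk₁⟩ := eventually_atTop.1 RegKSAT.eventually_clauseLength
  refine ⟨max 3 k₁, le_max_left _ _, fun k hk d hd hdS β hβ => ?_⟩
  obtain ⟨hk20, hku, hk2, hk34, hk10⟩ := hk₁ k ((le_max_right _ _).trans hk)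
  have hk0 : 0 < k := by omega
  have hdk := hdS.trans (RegKSAT.dSAT_le hk0)
  obtain ⟨ε, h0, h1, hfix, hε⟩ := RegKSAT.exists_fixedPoint hk0 hku hβ
  have hann := RegKSAT.tendsto_annealedRate hk0 hd h0 h1 hfix
  have hbdd := RegKSAT.isBoundedUnder_clusterRate (d := d) hk0 hβ.le
  have := RegKSAT.nLimit_neBot (d := d) hk0
  refine ⟨RegKSAT.annealedValue d k ε, hann, fun hq => ?_, fun hC => ?_⟩
  · refine le_of_forall_pos_le_add fun η hη => ?_
    exact limsup_le_of_le hbdd.2.isCoboundedUnder_le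
      (RegKSAT.eventually_clusterRate_le hk0 hd hβ.le h0 h1 hfix hann hq hη)
  · have hC' : ∀ η > 0, ∀ᶠ n in RegKSAT.nLimit d k,
        RegKSAT.clusterRate d k β n ≤ RegKSAT.annealedValue d k ε + η := fun η hη =>
      (eventually_lt_of_limsup_lt (hC.trans_lt (lt_add_of_pos_right _ hη)) hbdd.1).mono
        fun _ h => h.le
    refine tendsto_order.2 ⟨fun b hb => ?_, fun b hb => ?_⟩
    · filter_upwards [RegKSAT.eventually_le_quenchedRate hβ.le hd hk20 hku hk2 hk34 hk10 hdk h0 h1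
        hfix hε hC' (half_pos (sub_pos.2 hb))] with n hn
      linarith
    · filter_upwards [hann.eventually (gt_mem_nhds hb), RegKSAT.eventually_dvd] with n hn hdvd
      exact (RegKSAT.quenchedRate_le_annealedRate (RegKSAT.mul_eq_of_dvd hdvd) β).trans_lt hn
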